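/- Composition is written in diagrammatic order: $fg$ means first $f$, then $g$. **The category $\mathsf{TOF}$.** Let $\mathsf{TOF}$ be the strict symmetric monoidal category whose objects are the natural numbers, with $n\otimes m=n+m$ on objects, generated by morphisms $|1\rangle:0\to1$, $\langle1|:1\to0$ and $\mathsf{tof}:3\to3$ subject to the identities below. Here $1_n$ is the identity of $n$, $c:2\to2$ is the symmetry, wires are numbered from top to bottom with $f\otimes g$ having $f$ on top, and $$\mathsf{cnot}=(|1\rangle\otimes1_2)\,\mathsf{tof}\,(\langle1|\otimes1_2),\quad \mathsf{not}=(|1\rangle\otimes1_1)\,\mathsf{cnot}\,(\langle1|\otimes1_1),\quad |0\rangle=|1\rangle\,\mathsf{not},\quad \langle0|=\mathsf{not}\,\langle1|,$$ $$\sigma=(c\otimes1_1)(1_1\otimes c)(c\otimes1_1),\quad \mathsf{tof}'=\sigma\,\mathsf{tof}\,\sigma,\quad \mathsf{cnot}'=c\,\mathsf{cnot}\,c,\quad \mathsf{cnot}_{13}=(1_1\otimes c)(\mathsf{cnot}\otimes1_1)(1_1\otimes c),$$ $$\mathsf{tof}_{124}=(1_2\otimes c)(\mathsf{tof}\otimes1_1)(1_2\otimes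 c),\qquad \mathsf{tof}_{134}=(c\otimes1_2)(1_1\otimes\mathsf{tof})(c\otimes1_2),$$ $$\kappa=(1_2\otimes|0\rangle\otimes1_2)(\mathsf{tof}\otimes1_2)(1_2\otimes\mathsf{tof})(\mathsf{tof}\otimes1_2)(1_2\otimes\langle0|\otimes1_2):4\to4 .$$ The identities are: 1. $(|1\rangle\otimes1_2)\,\mathsf{tof}=|1\rangle\otimes\mathsf{cnot}$ and $\mathsf{tof}\,(\langle1|\otimes1_2)=\langle1|\otimes\mathsf{cnot}$; 2. $(|0\rangle\otimes1_2)\,\mathsf{tof}=|0\rangle\otimes1_2$ and $\mathsf{tof}\,(\langle0|\otimes1_2)=\langle0|\otimes1_2$; 3. $(\mathsf{tof}\otimes1_2)(1_2\otimes\mathsf{tof}')=(1_2\otimes\mathsf{tof}')(\mathsf{tof}\otimes1_2)$; 4. $(\mathsf{tof}'\otimes1_2)(1_2\otimes\mathsf{tof})=(1_2\otimes\mathsf{tof})(\mathsf{tof}'\otimes1_2)$; 5. $(\mathsf{tof}'\otimes1_1)(1_1\otimes\mathsf{tof})=(1_1\otimes\mathsf{tof})(\mathsf{tof}'\otimes1_1)$;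 6. $\mathsf{tof}_{134}(1_1\otimes\mathsf{tof})=(1_1\otimes\mathsf{tof})\,\mathsf{tof}_{134}$; 7. $(1_2\otimes|1\rangle)\,\mathsf{cnot}_{13}\,(1_2\otimes\langle0|)(1_2\otimes|1\rangle)(1_1\otimes\mathsf{cnot})(1_2\otimes\langle0|)=(1_2\otimes|1\rangle)\,\mathsf{tof}\,(1_2\otimes\langle0|)$; 8. $(|1\rangle\langle0|)\otimes1_1=(|1\rangle\langle0|)\otimes(\langle1|\,|1\rangle)$, where $|1\rangle\langle0|:0\to0$ and $\langle1|\,|1\rangle:1\to1$; 9. $|1\rangle\langle1|=1_0$; 10. $\mathsf{tof}\,\mathsf{tof}=1_3$; 11. $(1_1\otimes\mathsf{tof})(\mathsf{tof}\otimes1_1)(1_1\otimes\mathsf{tof})=\mathsf{tof}_{124}(\mathsf{tof}\otimes1_1)$; 12. $(\mathsf{cnot}\otimes1_2)(1_1\otimes\mathsf{tof})(\mathsf{cnot}\otimes1_2)=\mathsf{tof}_{134}(1_1\otimes\mathsf{tof})$; 13. $(\mathsf{tof}\otimes1_1)(1_1\otimes\mathsf{tof})(\mathsf{tof}\otimes1_1)=\mathsf{tof}_{124}(1_1\otimes\mathsf{tof})$;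 14. $(\mathsf{tof}\otimes1_1)(1_2\otimes\mathsf{cnot})(\mathsf{tof}\otimes1_1)=\mathsf{tof}_{124}(1_2\otimes\mathsf{cnot})$; 15. $\mathsf{cnot}\,\mathsf{cnot}'\,\mathsf{cnot}=c$; 16. $\mathsf{tof}=(c\otimes1_1)\,\mathsf{tof}\,(c\otimes1_1)$; 17. $\kappa=(1_1\otimes c\otimes1_1)\,\kappa\,(1_1\otimes c\otimes1_1)$. Let $(\_)^\circ:\mathsf{TOF}^{\mathrm{op}}\to\mathsf{TOF}$ be the identity-on-objects monoidal functor flipping circuits horizontally ($|1\rangle^\circ=\langle1|$, $\langle1|^\circ=|1\rangle$, $\mathsf{tof}^\circ=\mathsf{tof}$), and put $\bar f=ff^\circ:n\to n$ for $f:n\to m$. **The category $\mathsf{FPinj}_2$.** Its objects are the sets $\{0,1\}^n$, $n\in\mathbb N$, and its morphisms are the partial injective functions (partial isomorphisms) between them; $\bar f$ is the partial identity on the domain of definition of $f$. In both categories an endomorphism $e$ is a *restriction idempotent* if $e=\bar e$. **The functor $\tilde H_0:\mathsf{TOF}\to\mathsf{FPinj}_2$.** A *total point* of $n$ is a morphism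 $g:0\to n$ of $\mathsf{TOF}$ with $\bar g=1_0$. The total points of $n$ are the pairwise distinct morphisms $|b_1,\dots,b_n\rangle=|b_1\rangle\otimes\cdots\otimes|b_n\rangle$ with $b_i\in\{0,1\}$, so they are identified with $\{0,1\}^n$. The functor $\tilde H_0$ sends $n$ to $\{0,1\}^n$ and $f:n\to m$ to the partial injective function sending a total point $g$ to $gf$ if $gf$ is total, and undefined at $g$ otherwise. It preserves $\overline{(\_)}$, hence restriction idempotents. **Corollary.** The functor $\tilde H_0:\mathsf{TOF}\to\mathsf{FPinj}_2$ is full and faithful on restriction idempotents. That is, for every $n\in\mathbb N$: - (full) for every restriction idempotent $p$ of $\{0,1\}^n$ in $\mathsf{FPinj}_2$ there is a restriction idempotent $e:n\to n$ of $\mathsf{TOF}$ with $\tilde H_0(e)=p$; - (faithful) if $e,e':n\to n$ are restriction idempotents of $\mathsf{TOF}$ with $\tilde H_0(e)=\tilde H_0(e')$, then $e=e'$. -/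

import Mathlib

open CategoryTheory

namespace Toffoli

/-- Circuits (formal expressions) with `n` input and `m` output wires, wires being listed from top to
bottom: built from the generators `|1⟩`, `⟨1|` and the Toffoli gate, identities and symmetries by
sequential composition `f ⨾ g` (first `f`, then `g`) and parallel composition `f ⊠ g` (`f` above `g`). -/
inductive Circ : ℕ → ℕ → Type
  | id (n : ℕ) : Circ n n
  | comp {n m k : ℕ} (f : Circ n m) (g : Circ m k) : Circ n k
  | tensor {a b c d : ℕ} (f : Circ a b) (g : Circ c d) : Circ (a + c) (b + d)
  | swap (a b : ℕ) : Circ (a + b) (b + a)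
  | ket1 : Circ 0 1
  | bra1 : Circ 1 0
  | tof : Circ 3 3

infixl:70 " ⨾ " => Circ.comp
notation:75 f:75 " ⊠ " g:76 => (Circ.tensor f g :)

namespace Circ

/-- Transport along equalities of the numbers of wires. -/
def cast {a b a' b' : ℕ} (h : a = a') (h' : b = b') (f : Circ a b) : Circ a' b' :=
  h ▸ h' ▸ f

/-- Controlled not: control on the first wire, target on the second. -/
def cnot : Circ 2 2 := ket1 ⊠ id 2 ⨾ tof ⨾ bra1 ⊠ id 2

/-- The not gate. -/
def not : Circ 1 1 := ket1 ⊠ id 1 ⨾ cnot ⨾ bra1 ⊠ id 1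

/-- The ancilla `|0⟩`. -/
def ket0 : Circ 0 1 := ket1 ⨾ not

/-- The ancilla `⟨0|`. -/
def bra0 : Circ 1 0 := not ⨾ bra1

/-- Exchange the first and the third of three wires. -/
def swap13 : Circ 3 3 := swap 1 1 ⊠ id 1 ⨾ id 1 ⊠ swap 1 1 ⨾ swap 1 1 ⊠ id 1

/-- Flipped Toffoli gate: controls on the wires 2, 3 and target on wire 1. -/
def flipTof : Circ 3 3 := swap13 ⨾ tof ⨾ swap13

/-- Flipped controlled not: control on wire 2 and target on wire 1. -/
def flipCnot : Circ 2 2 := swap 1 1 ⨾ cnot ⨾ swap 1 1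

/-- Controlled not with a gap: control on wire 1 and target on wire 3, of three wires. -/
def cnot13 : Circ 3 3 := id 1 ⊠ swap 1 1 ⨾ cnot ⊠ id 1 ⨾ id 1 ⊠ swap 1 1

/-- Toffoli gate with a gap: controls on the wires 1, 2 and target on wire 4, of four wires. -/
def tof124 : Circ 4 4 := id 2 ⊠ swap 1 1 ⨾ tof ⊠ id 1 ⨾ id 2 ⊠ swap 1 1

/-- Toffoli gate with a gap: controls on the wires 1, 3 and target on wire 4, of four wires. -/
def tof134 : Circ 4 4 := swap 1 1 ⊠ id 2 ⨾ id 1 ⊠ tof ⨾ swap 1 1 ⊠ id 2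

/-- The Toffoli gate with controls on the wires 1, 2 and target on an ancilla `|0⟩` inserted below
them, followed by the Toffoli gate with controls on the ancilla and wire 3 and target on wire 4,
followed by the first gate again and `⟨0|` on the ancilla. -/
def threeControl : Circ 4 4 :=
  id 2 ⊠ ket0 ⊠ id 2 ⨾ tof ⊠ id 2 ⨾ id 2 ⊠ tof ⨾ tof ⊠ id 2 ⨾ id 2 ⊠ bra0 ⊠ id 2

/-- The defining identities of `TOF` between circuits. -/
inductive Identity : {n m : ℕ} → Circ n m → Circ n m → Prop
  | tof1 : Identity (ket1 ⊠ id 2 ⨾ tof) (ket1 ⊠ cnot)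
  | tof1' : Identity (tof ⨾ bra1 ⊠ id 2) (bra1 ⊠ cnot)
  | tof2 : Identity (ket0 ⊠ id 2 ⨾ tof) (ket0 ⊠ id 2)
  | tof2' : Identity (tof ⨾ bra0 ⊠ id 2) (bra0 ⊠ id 2)
  | tof3 : Identity (tof ⊠ id 2 ⨾ id 2 ⊠ flipTof) (id 2 ⊠ flipTof ⨾ tof ⊠ id 2)
  | tof4 : Identity (flipTof ⊠ id 2 ⨾ id 2 ⊠ tof) (id 2 ⊠ tof ⨾ flipTof ⊠ id 2)
  | tof5 : Identity (flipTof ⊠ id 1 ⨾ id 1 ⊠ tof) (id 1 ⊠ tof ⨾ flipTof ⊠ id 1)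
  | tof5half : Identity (tof134 ⨾ id 1 ⊠ tof) (id 1 ⊠ tof ⨾ tof134)
  | tof6 : Identity ((id 2 ⊠ ket1 ⨾ cnot13 ⨾ id 2 ⊠ bra0) ⨾ (id 2 ⊠ ket1 ⨾ id 1 ⊠ cnot ⨾ id 2 ⊠ bra0))
      (id 2 ⊠ ket1 ⨾ tof ⨾ id 2 ⊠ bra0)
  | tof7 : Identity ((ket1 ⨾ bra0) ⊠ id 1) ((ket1 ⨾ bra0) ⊠ (bra1 ⨾ ket1))
  | tof8 : Identity (ket1 ⨾ bra1) (id 0)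
  | tof9 : Identity (tof ⨾ tof) (id 3)
  | tof10 : Identity (id 1 ⊠ tof ⨾ tof ⊠ id 1 ⨾ id 1 ⊠ tof) (tof124 ⨾ tof ⊠ id 1)
  | tof11 : Identity (cnot ⊠ id 2 ⨾ id 1 ⊠ tof ⨾ cnot ⊠ id 2) (tof134 ⨾ id 1 ⊠ tof)
  | tof12 : Identity (tof ⊠ id 1 ⨾ id 1 ⊠ tof ⨾ tof ⊠ id 1) (tof124 ⨾ id 1 ⊠ tof)
  | tof13 : Identity (tof ⊠ id 1 ⨾ id 2 ⊠ cnot ⨾ tof ⊠ id 1) (tof124 ⨾ id 2 ⊠ cnot)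
  | tof14 : Identity (cnot ⨾ flipCnot ⨾ cnot) (swap 1 1)
  | tof15 : Identity tof (swap 1 1 ⊠ id 1 ⨾ tof ⨾ swap 1 1 ⊠ id 1)
  | tof16 : Identity threeControl
      (id 1 ⊠ swap 1 1 ⊠ id 1 ⨾ threeControl ⨾ id 1 ⊠ swap 1 1 ⊠ id 1)

/-- Equality of circuits in the (strict) symmetric monoidal category generated by `|1⟩`, `⟨1|` and
the Toffoli gate subject to `Identity`: the least congruence containing the laws of strict symmetric
monoidal categories and `Identity`. -/
inductive Rel : {n m : ℕ} → Circ n m → Circ n m → Prop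
  | refl {n m : ℕ} (f : Circ n m) : Rel f f
  | symm {n m : ℕ} {f g : Circ n m} : Rel f g → Rel g f
  | trans {n m : ℕ} {f g h : Circ n m} : Rel f g → Rel g h → Rel f h
  | comp {n m k : ℕ} {f f' : Circ n m} {g g' : Circ m k} :
      Rel f f' → Rel g g' → Rel (f ⨾ g) (f' ⨾ g')
  | tensor {a b c d : ℕ} {f f' : Circ a b} {g g' : Circ c d} :
      Rel f f' → Rel g g' → Rel (f ⊠ g) (f' ⊠ g')
  | id_comp {n m : ℕ} (f : Circ n m) : Rel (id n ⨾ f) f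
  | comp_id {n m : ℕ} (f : Circ n m) : Rel (f ⨾ id m) f
  | comp_assoc {n m k l : ℕ} (f : Circ n m) (g : Circ m k) (h : Circ k l) :
      Rel (f ⨾ g ⨾ h) (f ⨾ (g ⨾ h))
  | tensor_id (a b : ℕ) : Rel (id a ⊠ id b) (id (a + b))
  | interchange {a b c a' b' c' : ℕ} (f : Circ a b) (g : Circ b c) (f' : Circ a' b')
      (g' : Circ b' c') : Rel ((f ⨾ g) ⊠ (f' ⨾ g')) (f ⊠ f' ⨾ g ⊠ g')
  | tensor_assoc {a b c a' b' c' : ℕ} (f : Circ a a') (g : Circ b b') (h : Circ c c') :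
      Rel (cast (Nat.add_assoc a b c) (Nat.add_assoc a' b' c') (f ⊠ g ⊠ h)) (f ⊠ (g ⊠ h))
  | unit_tensor {n m : ℕ} (f : Circ n m) : Rel (cast (Nat.zero_add n) (Nat.zero_add m) (id 0 ⊠ f)) f
  | tensor_unit {n m : ℕ} (f : Circ n m) : Rel (f ⊠ id 0) f
  | swap_natural {a b c d : ℕ} (f : Circ a b) (g : Circ c d) :
      Rel (f ⊠ g ⨾ swap b d) (swap a c ⨾ g ⊠ f)
  | swap_swap (a b : ℕ) : Rel (swap a b ⨾ swap b a) (id (a + b))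
  | hexagon (a b c : ℕ) :
      Rel (cast (Nat.add_assoc a b c).symm (Nat.add_assoc b c a) (swap a (b + c)))
        (cast rfl (Nat.add_assoc b a c) (swap a b ⊠ id c) ⨾ id b ⊠ swap a c)
  | ofIdentity {n m : ℕ} {f g : Circ n m} : Identity f g → Rel f g

/-- The horizontal flip of a circuit. -/
def dagger : {n m : ℕ} → Circ n m → Circ m n
  | _, _, id n => id n
  | _, _, comp f g => dagger g ⨾ dagger f
  | _, _, tensor f g => dagger f ⊠ dagger g
  | _, _, swap a b => swap b a
  | _, _, ket1 => bra1
  | _, _, bra1 => ket1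
  | _, _, tof => tof

/-! Evaluation of circuits on lists of bits, an auxiliary tool for showing that the functor on total
points below is well defined. -/

/-- Evaluation on lists of bits. -/
def eval : {n m : ℕ} → Circ n m → List Bool → Option (List Bool)
  | _, _, id _ => fun l => some l
  | _, _, comp f g => fun l => (eval f l).bind (eval g)
  | _, _, tensor (a := a) f g => fun l =>
      (eval f (l.take a)).bind fun x => (eval g (l.drop a)).map fun y => x ++ y
  | _, _, swap a _ => fun l => some (l.drop a ++ l.take a)
  | _, _, ket1 => fun _ => some [true]
  | _, _, bra1 => fun l => if l = [true] then some [] else none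
  | _, _, tof => fun l =>
      some [l.getD 0 false, l.getD 1 false, Bool.xor (l.getD 0 false && l.getD 1 false) (l.getD 2 false)]

theorem eval_cast {a b a' b' : ℕ} (h : a = a') (h' : b = b') (f : Circ a b) :
    eval (cast h h' f) = eval f := by subst h; subst h'; rfl

theorem dagger_cast {a b a' b' : ℕ} (h : a = a') (h' : b = b') (f : Circ a b) :
    dagger (cast h h' f) = cast h' h (dagger f) := by subst h; subst h'; rfl

theorem dagger_dagger {n m : ℕ} (f : Circ n m) : dagger (dagger f) = f := by
  induction f <;> simp_all [dagger]

theorem eval_length {n m : ℕ} (f : Circ n m) :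
    ∀ l l', l.length = n → eval f l = some l' → l'.length = m := by
  induction f with
  | id => intro l l' h e; simp [eval] at e; simp_all
  | comp f g hf hg =>
    intro l l' h e
    simp only [eval, Option.bind_eq_some_iff] at e
    obtain ⟨x, h1, h2⟩ := e
    exact hg _ _ (hf _ _ h h1) h2
  | tensor f g hf hg =>
    intro l l' h e
    simp only [eval, Option.bind_eq_some_iff, Option.map_eq_some_iff] at e
    obtain ⟨x, h1, y, h2, rfl⟩ := e
    rw [List.length_append, hf _ _ (by simp [h]) h1, hg _ _ (by simp [h]) h2]
  | swap a b => intro l l' h e; simp [eval] at e; subst e; simp; omega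
  | ket1 => intro l l' h e; simp [eval] at e; subst e; rfl
  | bra1 => intro l l' h e; simp [eval] at e; simp [← e.2]
  | tof => intro l l' h e; simp [eval] at e; subst e; rfl

theorem eval_dagger' {n m : ℕ} (f : Circ n m) :
    ∀ l l', l.length = n → eval f l = some l' → eval (dagger f) l' = some l := by
  induction f with
  | id => intro l l' h e; simp_all [eval, dagger]
  | comp f g hf hg =>
    intro l l' h e
    simp only [eval, Option.bind_eq_some_iff] at e
    obtain ⟨x, h1, h2⟩ := e
    simp only [eval, dagger, Option.bind_eq_some_iff]
    exact ⟨x, hg _ _ (eval_length f _ _ h h1) h2, hf _ _ h h1⟩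
  | tensor f g hf hg =>
    intro l l' h e
    simp only [eval, Option.bind_eq_some_iff, Option.map_eq_some_iff] at e
    obtain ⟨x, h1, y, h2, rfl⟩ := e
    have hx := eval_length f _ _ (by simp [h]) h1
    simp only [eval, dagger]
    rw [List.take_left' hx, List.drop_left' hx, hf _ _ (by simp [h]) h1, hg _ _ (by simp [h]) h2]
    simp
  | swap a b =>
    intro l l' h e; simp [eval] at e; subst e
    simp only [eval, dagger]
    rw [List.drop_left' (by simp [h]), List.take_left' (by simp [h])]; simp
  | ket1 => intro l l' h e; simp [eval] at e; subst e; simp_all [eval, dagger]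
  | bra1 => intro l l' h e; simp [eval] at e; simp_all [eval, dagger]
  | tof =>
    intro l l' h e; simp only [eval, Option.some.injEq] at e; subst e
    match l, h with
    | [a, b, c], _ => revert a b c; decide

theorem eval_dagger {n m : ℕ} (f : Circ n m) {l l' : List Bool} (h : l.length = n)
    (h' : l'.length = m) : eval f l = some l' ↔ eval (dagger f) l' = some l :=
  ⟨eval_dagger' f l l' h, fun e => by simpa [dagger_dagger] using eval_dagger' (dagger f) l' l h' e⟩

theorem identity_sound {n m : ℕ} {f g : Circ n m} (r : Identity f g) :
    ∀ l, l.length = n → eval f l = eval g l := by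
  intro l h
  cases r <;> rcases l with _ | ⟨a, _ | ⟨b, _ | ⟨c, _ | ⟨d, _ | ⟨e, _ | l⟩⟩⟩⟩⟩ <;>
    (try (simp at h; done)) <;> clear h
  case tof8 => decide +kernel
  case tof7 => revert a; decide +kernel
  case tof14 => revert a b; decide +kernel
  case tof1 => revert a b; decide +kernel
  case tof2 => revert a b; decide +kernel
  case tof6 => revert a b; decide +kernel
  case tof1' => revert a b c; decide +kernel
  case tof2' => revert a b c; decide +kernel
  case tof9 => revert a b c; decide +kernel
  case tof15 => revert a b c; decide +kernel
  case tof3 => revert a b c d e; decide +kernel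
  case tof4 => revert a b c d e; decide +kernel
  all_goals revert a b c d; decide +kernel

theorem sound {n m : ℕ} {f g : Circ n m} (r : Rel f g) :
    ∀ l, l.length = n → eval f l = eval g l := by
  induction r with
  | refl => intro l h; rfl
  | symm _ ih => intro l h; exact (ih l h).symm
  | trans _ _ ih ih' => intro l h; exact (ih l h).trans (ih' l h)
  | @comp n m k f f' g g' _ _ ih ih' =>
    intro l h
    simp only [eval]
    rw [ih l h]
    cases e : eval f' l with
    | none => rfl
    | some x => exact ih' x (eval_length f' _ _ h e)
  | tensor _ _ ih ih' =>
    intro l h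
    simp only [eval]
    rw [ih _ (by simp [h]), ih' _ (by simp [h])]
  | id_comp => intro l h; simp [eval]
  | comp_id => intro l h; simp [eval]
  | comp_assoc => intro l h; simp [eval, Option.bind_assoc]
  | tensor_id => intro l h; simp [eval]
  | @interchange a b c a' b' c' f g f' g' =>
    intro l h
    simp only [eval]
    cases e : eval f (l.take a) with
    | none => rfl
    | some x =>
      have hx := eval_length f _ _ (by simp [h]) e
      cases e' : eval f' (l.drop a) with
      | none => cases eval g x <;> simp
      | some y => simp [hx]
  | @tensor_assoc a b c a' b' c' f g k =>
    intro l h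
    simp only [eval, eval_cast]
    rw [List.take_take, min_eq_left (by omega)]
    cases e : eval f (l.take a) with
    | none => rfl
    | some x =>
      simp only [Option.bind_some, List.drop_take, List.drop_drop, Nat.add_sub_cancel_left]
      cases e' : eval g ((l.drop a).take b) with
      | none => rfl
      | some y =>
        cases eval k (l.drop (a + b)) <;> simp
  | unit_tensor f => intro l h; simp [eval, eval_cast]
  | tensor_unit f =>
    intro l h
    simp only [eval]
    rw [List.take_of_length_le (by omega), List.drop_of_length_le (by omega)]
    cases eval f l <;> simp
  | @swap_natural a b c d f g =>
    intro l h
    simp only [eval, Option.bind_some]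
    rw [List.take_left' (by simp [h]), List.drop_left' (by simp [h])]
    cases e : eval f (l.take a) with
    | none => cases eval g (l.drop a) <;> rfl
    | some x =>
      have hx := eval_length f _ _ (by simp [h]) e
      cases eval g (l.drop a) with
      | none => rfl
      | some y => simp [hx]
  | swap_swap a b =>
    intro l h
    simp only [eval, Option.bind_some]
    rw [List.take_left' (by simp [h]), List.drop_left' (by simp [h])]
    simp
  | hexagon a b c =>
    intro l h
    obtain ⟨x, y, z, rfl, hx, hy⟩ : ∃ x y z, l = x ++ (y ++ z) ∧ x.length = a ∧ y.length = b :=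
      ⟨l.take a, (l.drop a).take b, (l.drop a).drop b, by simp, by simp [h]; omega,
        by simp [h]; omega⟩
    simp only [eval, eval_cast, Option.bind_some, Option.map_some]
    subst hx hy
    simp [List.take_append, List.drop_append, List.drop_of_length_le, List.take_of_length_le]
  | ofIdentity r => exact identity_sound r

instance setoid (n m : ℕ) : Setoid (Circ n m) := ⟨Rel, .refl, .symm, .trans⟩

end Circ

/-- Morphisms `n ⟶ m` of `TOF`: circuits modulo equality in the symmetric monoidal category generated
by the generators and their identities. -/
def Diag (n m : ℕ) : Type := Quotient (Circ.setoid n m)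

namespace Diag

open Circ

def mk {n m : ℕ} (f : Circ n m) : Diag n m := Quotient.mk _ f

def comp {n m k : ℕ} : Diag n m → Diag m k → Diag n k :=
  Quotient.map₂ Circ.comp fun _ _ h _ _ h' => Rel.comp h h'

def tens {a b c d : ℕ} : Diag a b → Diag c d → Diag (a + c) (b + d) :=
  Quotient.map₂ Circ.tensor fun _ _ h _ _ h' => Rel.tensor h h'

theorem mk_eq {n m : ℕ} {f g : Circ n m} (h : Rel f g) : mk f = mk g := Quotient.sound h

theorem rel_of_eq {n m : ℕ} {f g : Circ n m} (h : mk f = mk g) : Rel f g := Quotient.exact h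

local infixl:70 " ⊚ " => comp
local notation:75 f:75 " ⊛ " g:76 => (tens f g :)

def one (n : ℕ) : Diag n n := mk (.id n)

theorem mk_comp {n m k : ℕ} (f : Circ n m) (g : Circ m k) : mk (f ⨾ g) = mk f ⊚ mk g := rfl

theorem mk_tensor {a b c d : ℕ} (f : Circ a b) (g : Circ c d) : mk (f ⊠ g) = mk f ⊛ mk g := rfl

theorem one_comp {n m : ℕ} (f : Diag n m) : one n ⊚ f = f :=
  Quotient.inductionOn f fun f => mk_eq (.id_comp f)

theorem comp_one {n m : ℕ} (f : Diag n m) : f ⊚ one m = f :=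
  Quotient.inductionOn f fun f => mk_eq (.comp_id f)

theorem assoc {n m k l : ℕ} (f : Diag n m) (g : Diag m k) (h : Diag k l) :
    f ⊚ g ⊚ h = f ⊚ (g ⊚ h) :=
  Quotient.inductionOn₃ f g h fun f g h => mk_eq (.comp_assoc f g h)

theorem interchange {a b c a' b' c' : ℕ} (f : Diag a b) (g : Diag b c) (f' : Diag a' b')
    (g' : Diag b' c') : (f ⊚ g) ⊛ (f' ⊚ g') = f ⊛ f' ⊚ g ⊛ g' :=
  Quotient.inductionOn₂ f g (fun f g => Quotient.inductionOn₂ f' g' fun f' g' =>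
    mk_eq (.interchange f g f' g'))

theorem one_tens_one (a b : ℕ) : one a ⊛ one b = one (a + b) := mk_eq (.tensor_id a b)

theorem tens_split {a b c d : ℕ} (f : Diag a b) (g : Diag c d) :
    f ⊛ g = f ⊛ one c ⊚ one b ⊛ g := by
  rw [← interchange, comp_one, one_comp]

theorem tens_split' {a b c d : ℕ} (f : Diag a b) (g : Diag c d) :
    f ⊛ g = one a ⊛ g ⊚ f ⊛ one d := by
  rw [← interchange, comp_one, one_comp]

theorem tens_one_comp {a b c : ℕ} (f : Diag a b) (g : Diag b c) (n : ℕ) :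
    (f ⊚ g) ⊛ one n = f ⊛ one n ⊚ g ⊛ one n := by
  rw [← interchange, one_comp]

theorem one_tens_comp {a b c : ℕ} (f : Diag a b) (g : Diag b c) (n : ℕ) :
    one n ⊛ (f ⊚ g) = one n ⊛ f ⊚ one n ⊛ g := by
  rw [← interchange, one_comp]

theorem tens_one_zero {n m : ℕ} (f : Diag n m) : f ⊛ one 0 = f :=
  Quotient.inductionOn f fun f => mk_eq (.tensor_unit f)

theorem swap_natural {a b c d : ℕ} (f : Diag a b) (g : Diag c d) :
    f ⊛ g ⊚ mk (swap b d) = mk (swap a c) ⊚ g ⊛ f :=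
  Quotient.inductionOn₂ f g fun f g => mk_eq (.swap_natural f g)

/-- Whiskering and conjugation preserve involutions. -/
theorem sq_tens {a : ℕ} {f : Diag a a} (h : f ⊚ f = one a) (n : ℕ) :
    f ⊛ one n ⊚ f ⊛ one n = one (a + n) := by
  rw [← tens_one_comp, h, one_tens_one]

theorem tens_sq {a : ℕ} {f : Diag a a} (h : f ⊚ f = one a) (n : ℕ) :
    one n ⊛ f ⊚ one n ⊛ f = one (n + a) := by
  rw [← one_tens_comp, h, one_tens_one]

theorem sq_conj {a : ℕ} {s f : Diag a a} (hs : s ⊚ s = one a) (h : f ⊚ f = one a) :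
    (s ⊚ f ⊚ s) ⊚ (s ⊚ f ⊚ s) = one a := by
  rw [show (s ⊚ f ⊚ s) ⊚ (s ⊚ f ⊚ s) = s ⊚ (f ⊚ (s ⊚ s) ⊚ f) ⊚ s by simp only [assoc], hs,
    comp_one, h, comp_one, hs]

theorem flip_of_sq {a : ℕ} {A B G : Diag a a} (hA : A ⊚ A = one a) (hB : B ⊚ B = one a)
    (hG : G ⊚ G = one a) (h : A ⊚ B ⊚ A = G ⊚ B) : A ⊚ (B ⊚ A) = B ⊚ G := by
  have h1 : (G ⊚ B) ⊚ (G ⊚ B) = one a := by rw [← h]; exact sq_conj hA hB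
  rw [← assoc, h]
  calc G ⊚ B = (B ⊚ (G ⊚ G) ⊚ B) ⊚ (G ⊚ B) := by rw [hG, comp_one, hB, one_comp]
    _ = B ⊚ G ⊚ ((G ⊚ B) ⊚ (G ⊚ B)) := by simp only [assoc]
    _ = B ⊚ G := by rw [h1, comp_one]

theorem swap_sq : mk (swap 1 1) ⊚ mk (swap 1 1) = one 2 := mk_eq (.swap_swap 1 1)

theorem tof_sq : mk tof ⊚ mk tof = one 3 := mk_eq (.ofIdentity .tof9)

theorem ket_bra : mk ket1 ⊚ mk bra1 = one 0 := mk_eq (.ofIdentity .tof8)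

theorem zero_tens2 (f : Diag 2 2) : (one 0 ⊛ f : Diag 2 2) = f :=
  Quotient.inductionOn f fun f => mk_eq (.unit_tensor f)

theorem cnot_sq : mk cnot ⊚ mk cnot = one 2 := by
  have h1 : mk ket1 ⊛ one 2 ⊚ mk tof = mk cnot ⊚ mk ket1 ⊛ one 2 := by
    refine (mk_eq (.ofIdentity .tof1)).trans ((tens_split' (mk ket1) (mk cnot)).trans ?_)
    exact congrArg (fun x : Diag 2 2 => x ⊚ mk ket1 ⊛ one 2) (zero_tens2 (mk cnot))
  have h2 : (mk ket1 ⊛ one 2 ⊚ mk bra1 ⊛ one 2 : Diag 2 2) = one 2 := by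
    refine (tens_one_comp (mk ket1) (mk bra1) 2).symm.trans ?_
    rw [ket_bra]; exact one_tens_one 0 2
  calc mk cnot ⊚ mk cnot = mk cnot ⊚ mk cnot ⊚ (mk ket1 ⊛ one 2 ⊚ mk bra1 ⊛ one 2 : Diag 2 2) := by
        rw [h2, comp_one]
    _ = mk cnot ⊚ (mk cnot ⊚ mk ket1 ⊛ one 2) ⊚ mk bra1 ⊛ one 2 := by simp only [assoc]
    _ = mk cnot ⊚ (mk ket1 ⊛ one 2 ⊚ mk tof) ⊚ mk bra1 ⊛ one 2 := by rw [h1]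
    _ = (mk cnot ⊚ mk ket1 ⊛ one 2) ⊚ mk tof ⊚ mk bra1 ⊛ one 2 := by simp only [assoc]
    _ = mk ket1 ⊛ one 2 ⊚ (mk tof ⊚ mk tof) ⊚ mk bra1 ⊛ one 2 := by
        rw [← h1]; simp only [assoc]
    _ = one 2 := by rw [tof_sq, comp_one]; exact h2

/-- Transport along equalities of the numbers of wires. -/
def dcast {a b a' b' : ℕ} (h : a = a') (h' : b = b') (f : Diag a b) : Diag a' b' :=
  h ▸ h' ▸ f

theorem mk_cast {a b a' b' : ℕ} (h : a = a') (h' : b = b') (f : Circ a b) :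
    mk (f.cast h h') = dcast h h' (mk f) := by subst h; subst h'; rfl

theorem zero_tens {n m : ℕ} (f : Diag n m) :
    dcast (Nat.zero_add n) (Nat.zero_add m) (one 0 ⊛ f) = f :=
  Quotient.inductionOn f fun f => (mk_cast _ _ _).symm.trans (mk_eq (.unit_tensor f))

theorem tens_assoc {a b c a' b' c' : ℕ} (f : Diag a a') (g : Diag b b') (h : Diag c c') :
    dcast (Nat.add_assoc a b c) (Nat.add_assoc a' b' c') (f ⊛ g ⊛ h) = f ⊛ (g ⊛ h) :=
  Quotient.inductionOn₃ f g h fun f g h =>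
    (mk_cast _ _ _).symm.trans (mk_eq (.tensor_assoc f g h))

theorem swap00 : mk (swap 0 0) = one 0 := by
  have h : mk (swap 0 0) = mk (swap 0 0) ⊛ one 0 ⊚ one 0 ⊛ mk (swap 0 0) := mk_eq (.hexagon 0 0 0)
  rw [tens_one_zero, show one 0 ⊛ mk (swap 0 0) = mk (swap 0 0) from
    zero_tens (n := 0) (m := 0) (mk (swap 0 0))] at h
  exact h.trans (mk_eq (.swap_swap 0 0))

theorem swap10 : mk (swap 1 0) = one 1 := by
  have h : mk (swap 1 0) = mk (swap 1 0) ⊛ one 0 ⊚ one 0 ⊛ mk (swap 1 0) := mk_eq (.hexagon 1 0 0)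
  rw [tens_one_zero, show one 0 ⊛ mk (swap 1 0) = mk (swap 1 0) from zero_tens (mk (swap 1 0))] at h
  have h2 : mk (swap 1 0) ⊚ mk (swap 0 1) = one 1 := mk_eq (.swap_swap 1 0)
  have h3 := congrArg (fun x => x ⊚ mk (swap 0 1)) h
  simp only [assoc] at h3
  rw [h2] at h3
  exact (h3.trans (comp_one _)).symm

theorem swap01 : mk (swap 0 1) = one 1 := by
  have h2 : mk (swap 1 0) ⊚ mk (swap 0 1) = one 1 := mk_eq (.swap_swap 1 0)
  rw [swap10] at h2
  exact (one_comp _).symm.trans h2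

/-- A state on the left of a wire can be moved to its right. -/
theorem ket_swap (x : Diag 0 1) : one 1 ⊛ x ⊚ mk (swap 1 1) = (x ⊛ one 1 : Diag 1 2) := by
  refine (swap_natural (one 1) x).trans ?_
  rw [swap10]; exact one_comp _

theorem bra_swap (x : Diag 1 0) : mk (swap 1 1) ⊚ x ⊛ one 1 = (one 1 ⊛ x : Diag 2 1) := by
  refine (swap_natural (one 1) x).symm.trans ?_
  rw [swap10]; exact comp_one _

theorem bra_swap' (x : Diag 1 0) : mk (swap 1 1) ⊚ one 1 ⊛ x = (x ⊛ one 1 : Diag 2 1) := by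
  refine (swap_natural x (one 1)).symm.trans ?_
  rw [swap01]; exact comp_one _

theorem ket_ket_swap (x y : Diag 0 1) : x ⊛ y ⊚ mk (swap 1 1) = y ⊛ x := by
  refine (swap_natural x y).trans ?_
  rw [swap00]; exact one_comp _

/-! Behaviour of the gates on states. -/

theorem F_comm (x y : Diag 0 1) :
    ((x ⊛ y ⊛ one 1 : Diag 1 3) ⊚ mk tof) =
      (y ⊛ x ⊛ one 1 : Diag 1 3) ⊚ mk tof ⊚ (mk (swap 1 1) ⊛ one 1 : Diag 3 3) := by
  have h : mk tof = (mk (swap 1 1) ⊛ one 1 : Diag 3 3) ⊚ mk tof ⊚ (mk (swap 1 1) ⊛ one 1 : Diag 3 3) :=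
    mk_eq (.ofIdentity .tof15)
  have h2 : (x ⊛ y ⊛ one 1 : Diag 1 3) ⊚ (mk (swap 1 1) ⊛ one 1 : Diag 3 3) = y ⊛ x ⊛ one 1 := by
    refine (tens_one_comp (x ⊛ y) (mk (swap 1 1)) 1).symm.trans ?_
    rw [ket_ket_swap]
  rw [← h2]
  conv_lhs => rw [h]
  simp only [assoc]

theorem F_one (y : Diag 0 1) : ((mk ket1 ⊛ y ⊛ one 1 : Diag 1 3) ⊚ mk tof) =
    (mk ket1 ⊛ (y ⊛ one 1 ⊚ mk cnot) : Diag 1 3) := by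
  have h : mk ket1 ⊛ one 2 ⊚ mk tof = (mk ket1 ⊛ mk cnot : Diag 2 3) := mk_eq (.ofIdentity .tof1)
  have h1 : (mk ket1 ⊛ y ⊛ one 1 : Diag 1 3) = (y ⊛ one 1 : Diag 1 2) ⊚ mk ket1 ⊛ one 2 := by
    refine (tens_assoc (mk ket1) y (one 1)).trans ((tens_split' (mk ket1) (y ⊛ one 1)).trans ?_)
    exact congrArg (fun x : Diag 1 2 => x ⊚ (mk ket1 ⊛ one 2 : Diag 2 3)) (zero_tens (y ⊛ one 1))
  rw [h1, assoc, h]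
  have h2 : (mk ket1 ⊛ (y ⊛ one 1 ⊚ mk cnot) : Diag 1 3) =
      (one 0 ⊛ (y ⊛ one 1) : Diag 1 2) ⊚ (mk ket1 ⊛ mk cnot : Diag 2 3) := by
    refine Eq.trans ?_ (interchange (one 0) (mk ket1) (y ⊛ one 1) (mk cnot))
    rw [one_comp]
  rw [h2]
  exact congrArg (fun x : Diag 1 2 => x ⊚ (mk ket1 ⊛ mk cnot : Diag 2 3)) (zero_tens (y ⊛ one 1)).symm

theorem F_zero (y : Diag 0 1) : ((mk ket0 ⊛ y ⊛ one 1 : Diag 1 3) ⊚ mk tof) =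
    (mk ket0 ⊛ y ⊛ one 1 : Diag 1 3) := by
  have h : mk ket0 ⊛ one 2 ⊚ mk tof = (mk ket0 ⊛ one 2 : Diag 2 3) := mk_eq (.ofIdentity .tof2)
  have h1 : (mk ket0 ⊛ y ⊛ one 1 : Diag 1 3) = (y ⊛ one 1 : Diag 1 2) ⊚ mk ket0 ⊛ one 2 := by
    refine (tens_assoc (mk ket0) y (one 1)).trans ((tens_split' (mk ket0) (y ⊛ one 1)).trans ?_)
    exact congrArg (fun x : Diag 1 2 => x ⊚ (mk ket0 ⊛ one 2 : Diag 2 3)) (zero_tens (y ⊛ one 1))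
  rw [h1, assoc, h]

theorem cancel11 (f : Diag 1 1) : (mk ket1 ⊛ f : Diag 1 2) ⊚ mk bra1 ⊛ one 1 = f := by
  refine (interchange (mk ket1) (mk bra1) f (one 1)).symm.trans ?_
  rw [ket_bra, comp_one]; exact zero_tens f

theorem cancel12 (f : Diag 1 2) : (mk ket1 ⊛ f : Diag 1 3) ⊚ mk bra1 ⊛ one 2 = f := by
  refine (interchange (mk ket1) (mk bra1) f (one 2)).symm.trans ?_
  rw [ket_bra, comp_one]; exact zero_tens f

theorem ket1_cnot : ((mk ket1 ⊛ one 1 : Diag 1 2) ⊚ mk cnot) = (mk ket1 ⊛ mk Circ.not : Diag 1 2) := by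
  have h := F_comm (mk ket1) (mk ket1)
  rw [F_one] at h
  have h2 := congrArg (fun x : Diag 1 3 => x ⊚ (mk bra1 ⊛ one 2 : Diag 3 2)) h
  simp only [cancel12] at h2
  rw [h2, assoc]
  have h3 : (mk (swap 1 1) ⊛ one 1 : Diag 3 3) ⊚ (mk bra1 ⊛ one 2 : Diag 3 2) =
      (one 1 ⊛ (mk bra1 ⊛ one 1) : Diag 3 2) := by
    refine Eq.trans ?_ (tens_assoc (one 1) (mk bra1) (one 1))
    refine Eq.trans ?_ (congrArg (fun x : Diag 2 1 => (x ⊛ one 1 : Diag 3 2)) (bra_swap (mk bra1)))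
    refine Eq.trans ?_ (tens_one_comp (mk (swap 1 1)) (mk bra1 ⊛ one 1) 1).symm
    refine congrArg (fun x : Diag 3 2 => (mk (swap 1 1) ⊛ one 1 : Diag 3 3) ⊚ x) ?_
    rw [← one_tens_one 1 1]
    exact (tens_assoc (mk bra1) (one 1) (one 1)).symm
  rw [h3]
  refine (interchange (mk ket1) (one 1) ((mk ket1 ⊛ one 1 : Diag 1 2) ⊚ mk cnot)
    (mk bra1 ⊛ one 1)).symm.trans ?_
  rw [comp_one]; rfl

theorem ket0_cnot : ((mk ket0 ⊛ one 1 : Diag 1 2) ⊚ mk cnot) = (mk ket0 ⊛ one 1 : Diag 1 2) := by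
  have h := F_comm (mk ket1) (mk ket0)
  rw [F_one, F_zero] at h
  have h1 : (mk ket0 ⊛ mk ket1 ⊛ one 1 : Diag 1 3) ⊚ (mk (swap 1 1) ⊛ one 1 : Diag 3 3) =
      (mk ket1 ⊛ (mk ket0 ⊛ one 1) : Diag 1 3) := by
    refine (tens_one_comp (mk ket0 ⊛ mk ket1) (mk (swap 1 1)) 1).symm.trans ?_
    rw [ket_ket_swap]; exact tens_assoc (mk ket1) (mk ket0) (one 1)
  rw [h1] at h
  have h2 := congrArg (fun x : Diag 1 3 => x ⊚ (mk bra1 ⊛ one 2 : Diag 3 2)) h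
  simpa only [cancel12] using h2

theorem ket_tens_comp11 (k : Diag 0 1) (f : Diag 1 1) (g : Diag 2 2) :
    (k ⊛ f : Diag 1 2) ⊚ g = f ⊚ ((k ⊛ one 1 : Diag 1 2) ⊚ g) := by
  rw [← assoc]
  refine congrArg (fun x : Diag 1 2 => x ⊚ g) ?_
  refine (tens_split' k f).trans ?_
  exact congrArg (fun x : Diag 1 1 => x ⊚ (k ⊛ one 1 : Diag 1 2)) (zero_tens f)

theorem not_sq : mk Circ.not ⊚ mk Circ.not = one 1 := by
  have h : (mk ket1 ⊛ one 1 : Diag 1 2) ⊚ (mk cnot ⊚ mk cnot) =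
      (mk ket1 ⊛ (mk Circ.not ⊚ mk Circ.not) : Diag 1 2) := by
    rw [← assoc, ket1_cnot, ket_tens_comp11, ket1_cnot]
    refine Eq.trans ?_ ((tens_split' (mk ket1) (mk Circ.not ⊚ mk Circ.not)).symm)
    have := zero_tens (mk Circ.not ⊚ mk Circ.not)
    refine Eq.trans ?_ (congrArg (fun x : Diag 1 1 => x ⊚ (mk ket1 ⊛ one 1 : Diag 1 2)) this.symm)
    rw [assoc]
    refine congrArg (fun x : Diag 1 2 => mk Circ.not ⊚ x) ?_
    refine (tens_split' (mk ket1) (mk Circ.not)).trans ?_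
    exact congrArg (fun x : Diag 1 1 => x ⊚ (mk ket1 ⊛ one 1 : Diag 1 2)) (zero_tens (mk Circ.not))
  rw [cnot_sq, comp_one] at h
  have h2 := congrArg (fun x : Diag 1 2 => x ⊚ (mk bra1 ⊛ one 1 : Diag 2 1)) h
  simp only [cancel11] at h2
  exact h2.symm

/-- The bit `b` as a state. -/
def bit (b : Bool) : Diag 0 1 := if b then mk ket1 else mk ket0

theorem bit_not (b : Bool) : bit b ⊚ mk Circ.not = bit (!b) := by
  cases b
  · show mk ket1 ⊚ mk Circ.not ⊚ mk Circ.not = mk ket1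
    rw [assoc, not_sq, comp_one]
  · rfl

theorem bit_tens_comp (z : Diag 0 1) (p : Diag 0 2) (f : Diag 1 1) :
    z ⊚ (p ⊛ f : Diag 1 3) = (p ⊛ (z ⊚ f) : Diag 0 3) := by
  have h : (p ⊛ (z ⊚ f) : Diag 0 3) = (one 0 ⊛ z : Diag 0 1) ⊚ (p ⊛ f : Diag 1 3) := by
    refine Eq.trans ?_ (interchange (one 0) p z f)
    rw [one_comp]
  rw [h]
  exact congrArg (fun x : Diag 0 1 => x ⊚ (p ⊛ f : Diag 1 3)) (zero_tens z).symm

theorem bits_tof (a b c : Bool) : (bit a ⊛ bit b ⊛ bit c : Diag 0 3) ⊚ mk tof =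
    (bit a ⊛ bit b ⊛ bit (Bool.xor (a && b) c) : Diag 0 3) := by
  have h1 : ∀ p : Diag 0 2, (p ⊛ bit c : Diag 0 3) = bit c ⊚ (p ⊛ one 1 : Diag 1 3) := fun p => by
    rw [bit_tens_comp, comp_one]
  have key : ∀ f : Diag 1 1, (bit a ⊛ bit b ⊛ one 1 : Diag 1 3) ⊚ mk tof = bit a ⊛ bit b ⊛ f →
      (bit a ⊛ bit b ⊛ bit c : Diag 0 3) ⊚ mk tof = bit a ⊛ bit b ⊛ (bit c ⊚ f) := by
    intro f h
    rw [h1, assoc, h]; exact bit_tens_comp _ _ _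
  cases a
  · refine (key (one 1) (F_zero (bit b))).trans ?_
    rw [comp_one]; simp
  · cases b
    · refine (key (one 1) ?_).trans ?_
      · refine (F_one (mk ket0)).trans ?_
        rw [ket0_cnot]; exact (tens_assoc (mk ket1) (mk ket0) (one 1)).symm
      · rw [comp_one]; simp
    · refine (key (mk Circ.not) ?_).trans ?_
      · refine (F_one (mk ket1)).trans ?_
        rw [ket1_cnot]; exact (tens_assoc (mk ket1) (mk ket1) (mk Circ.not)).symm
      · rw [bit_not]; simp

/-! Negating the target commutes with the controlled gates. -/

theorem swap13_sq : mk swap13 ⊚ mk swap13 = one 3 := by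
  have h1 : (mk (swap 1 1) ⊛ one 1 : Diag 3 3) ⊚ (mk (swap 1 1) ⊛ one 1 : Diag 3 3) = one 3 :=
    sq_tens swap_sq 1
  have h2 : (one 1 ⊛ mk (swap 1 1) : Diag 3 3) ⊚ (one 1 ⊛ mk (swap 1 1) : Diag 3 3) = one 3 :=
    tens_sq swap_sq 1
  exact sq_conj h1 h2

theorem kk_swap13 (k : Diag 0 1) : (one 1 ⊛ (k ⊛ k) : Diag 1 3) ⊚ mk swap13 =
    (k ⊛ k ⊛ one 1 : Diag 1 3) := by
  have e1 : (one 1 ⊛ (k ⊛ k) : Diag 1 3) ⊚ (mk (swap 1 1) ⊛ one 1 : Diag 3 3) =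
      (k ⊛ (one 1 ⊛ k) : Diag 1 3) := by
    have h := tens_assoc (one 1) k k
    refine (congrArg (fun x : Diag 1 3 => x ⊚ (mk (swap 1 1) ⊛ one 1 : Diag 3 3)) h.symm).trans ?_
    refine (interchange (one 1 ⊛ k) (mk (swap 1 1)) k (one 1)).symm.trans ?_
    rw [ket_swap, comp_one]; exact tens_assoc k (one 1) k
  have e2 : (k ⊛ (one 1 ⊛ k) : Diag 1 3) ⊚ (one 1 ⊛ mk (swap 1 1) : Diag 3 3) =
      (k ⊛ k ⊛ one 1 : Diag 1 3) := by
    refine (interchange k (one 1) (one 1 ⊛ k) (mk (swap 1 1))).symm.trans ?_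
    rw [ket_swap, comp_one]; exact (tens_assoc k k (one 1)).symm
  have e3 : (k ⊛ k ⊛ one 1 : Diag 1 3) ⊚ (mk (swap 1 1) ⊛ one 1 : Diag 3 3) =
      (k ⊛ k ⊛ one 1 : Diag 1 3) := by
    refine (interchange (k ⊛ k) (mk (swap 1 1)) (one 1) (one 1)).symm.trans ?_
    rw [ket_ket_swap, comp_one]
  show (one 1 ⊛ (k ⊛ k) : Diag 1 3) ⊚ ((mk (swap 1 1) ⊛ one 1 : Diag 3 3) ⊚
    (one 1 ⊛ mk (swap 1 1) : Diag 3 3) ⊚ (mk (swap 1 1) ⊛ one 1 : Diag 3 3)) = _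
  rw [← assoc, ← assoc, e1, e2, e3]

theorem flip_kk : (one 1 ⊛ (mk ket1 ⊛ mk ket1) : Diag 1 3) ⊚ mk flipTof =
    (mk Circ.not ⊛ (mk ket1 ⊛ mk ket1) : Diag 1 3) := by
  have e : (mk ket1 ⊛ mk ket1 ⊛ one 1 : Diag 1 3) ⊚ mk tof =
      mk Circ.not ⊚ (mk ket1 ⊛ mk ket1 ⊛ one 1 : Diag 1 3) := by
    rw [F_one, ket1_cnot]
    refine (tens_assoc (mk ket1) (mk ket1) (mk Circ.not)).symm.trans ?_
    refine (tens_split' (mk ket1 ⊛ mk ket1) (mk Circ.not)).trans ?_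
    exact congrArg (fun x : Diag 1 1 => x ⊚ (mk ket1 ⊛ mk ket1 ⊛ one 1 : Diag 1 3))
      (zero_tens (mk Circ.not))
  have e' : (mk ket1 ⊛ mk ket1 ⊛ one 1 : Diag 1 3) ⊚ mk swap13 =
      (one 1 ⊛ (mk ket1 ⊛ mk ket1) : Diag 1 3) := by
    rw [← kk_swap13, assoc, swap13_sq, comp_one]
  show (one 1 ⊛ (mk ket1 ⊛ mk ket1) : Diag 1 3) ⊚ (mk swap13 ⊚ mk tof ⊚ mk swap13) = _
  rw [← assoc, ← assoc, kk_swap13, e, assoc, e']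
  refine Eq.trans ?_ (tens_split (mk Circ.not) (mk ket1 ⊛ mk ket1)).symm
  exact congrArg (fun x : Diag 1 1 => x ⊚ (one 1 ⊛ (mk ket1 ⊛ mk ket1) : Diag 1 3))
    (tens_one_zero (mk Circ.not)).symm

theorem tof_not : mk tof ⊚ (one 2 ⊛ mk Circ.not : Diag 3 3) =
    (one 2 ⊛ mk Circ.not : Diag 3 3) ⊚ mk tof := by
  have h : (mk tof ⊛ one 2 : Diag 5 5) ⊚ (one 2 ⊛ mk flipTof : Diag 5 5) =
      (one 2 ⊛ mk flipTof : Diag 5 5) ⊚ (mk tof ⊛ one 2 : Diag 5 5) := mk_eq (.ofIdentity .tof3)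
  let kk : Diag 0 2 := mk ket1 ⊛ mk ket1
  let bb : Diag 2 0 := mk bra1 ⊛ mk bra1
  have hkb : kk ⊚ bb = one 0 := by
    refine (interchange (mk ket1) (mk bra1) (mk ket1) (mk bra1)).symm.trans ?_
    rw [ket_bra]; exact one_tens_one 0 0
  have e0 : (one 3 ⊛ kk : Diag 3 5) = (one 2 ⊛ (one 1 ⊛ kk) : Diag 3 5) := by
    refine Eq.trans ?_ (tens_assoc (one 2) (one 1) kk)
    rw [one_tens_one 2 1]; rfl
  have e1 : (one 3 ⊛ kk : Diag 3 5) ⊚ (one 2 ⊛ mk flipTof : Diag 5 5) =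
      (one 2 ⊛ mk Circ.not : Diag 3 3) ⊚ (one 3 ⊛ kk : Diag 3 5) := by
    rw [e0]
    refine (one_tens_comp (one 1 ⊛ kk) (mk flipTof) 2).symm.trans ?_
    rw [flip_kk]
    refine (tens_assoc (one 2) (mk Circ.not) kk).symm.trans ?_
    refine (tens_split (one 2 ⊛ mk Circ.not) kk).trans ?_
    have h1 := congrArg (fun x : Diag 3 3 => x ⊚ (one 3 ⊛ kk : Diag 3 5))
      (tens_one_zero (one 2 ⊛ mk Circ.not : Diag 3 3))
    exact h1.trans (by rw [e0])
  have e2 : (one 3 ⊛ kk : Diag 3 5) ⊚ (mk tof ⊛ one 2 : Diag 5 5) =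
      mk tof ⊚ (one 3 ⊛ kk : Diag 3 5) := by
    refine (tens_split' (mk tof) kk).symm.trans ((tens_split (mk tof) kk).trans ?_)
    exact congrArg (fun x : Diag 3 3 => x ⊚ (one 3 ⊛ kk : Diag 3 5)) (tens_one_zero (mk tof))
  have e3 : (one 3 ⊛ kk : Diag 3 5) ⊚ (one 3 ⊛ bb : Diag 5 3) = one 3 := by
    refine (one_tens_comp kk bb 3).symm.trans ?_
    rw [hkb]; exact one_tens_one 3 0
  have h2 := congrArg (fun x : Diag 5 5 => (one 3 ⊛ kk : Diag 3 5) ⊚ x ⊚ (one 3 ⊛ bb : Diag 5 3)) h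
  simp only [← assoc] at h2
  rw [e2, e1, assoc (mk tof), e1, assoc _ _ (mk tof ⊛ one 2), e2] at h2
  simp only [assoc] at h2
  rw [e3] at h2
  simpa only [comp_one] using h2

theorem cnot_not : mk cnot ⊚ (one 1 ⊛ mk Circ.not : Diag 2 2) =
    (one 1 ⊛ mk Circ.not : Diag 2 2) ⊚ mk cnot := by
  let N : Diag 2 2 := one 1 ⊛ mk Circ.not
  have e0 : (one 2 ⊛ mk Circ.not : Diag 3 3) = (one 1 ⊛ N : Diag 3 3) := by
    refine Eq.trans ?_ (tens_assoc (one 1) (one 1) (mk Circ.not))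
    rw [one_tens_one 1 1]; rfl
  have e1 : (mk bra1 ⊛ one 2 : Diag 3 2) ⊚ N = (one 1 ⊛ N : Diag 3 3) ⊚ (mk bra1 ⊛ one 2 : Diag 3 2) := by
    refine Eq.trans ?_ (tens_split' (mk bra1) N)
    refine Eq.trans ?_ (tens_split (mk bra1) N).symm
    exact congrArg (fun x : Diag 2 2 => (mk bra1 ⊛ one 2 : Diag 3 2) ⊚ x) (zero_tens N).symm
  have e2 : (mk ket1 ⊛ one 2 : Diag 2 3) ⊚ (one 1 ⊛ N : Diag 3 3) = N ⊚ (mk ket1 ⊛ one 2 : Diag 2 3) := by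
    refine (tens_split (mk ket1) N).symm.trans ((tens_split' (mk ket1) N).trans ?_)
    exact congrArg (fun x : Diag 2 2 => x ⊚ (mk ket1 ⊛ one 2 : Diag 2 3)) (zero_tens N)
  have e3 := tof_not
  rw [e0] at e3
  show ((mk ket1 ⊛ one 2 : Diag 2 3) ⊚ mk tof ⊚ (mk bra1 ⊛ one 2 : Diag 3 2)) ⊚ N =
    N ⊚ ((mk ket1 ⊛ one 2 : Diag 2 3) ⊚ mk tof ⊚ (mk bra1 ⊛ one 2 : Diag 3 2))
  rw [assoc, e1, assoc, ← assoc (mk tof), e3, assoc, ← assoc, e2]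
  simp only [assoc]

/-- Controlled gates with an ancilla on the target. -/
theorem proj_cnot : (one 1 ⊛ mk ket0 : Diag 1 2) ⊚ mk cnot ⊚ (one 1 ⊛ mk bra1 : Diag 2 1) =
    (one 1 ⊛ mk ket1 : Diag 1 2) ⊚ mk cnot ⊚ (one 1 ⊛ mk bra0 : Diag 2 1) := by
  have h1 : (one 1 ⊛ mk ket0 : Diag 1 2) = (one 1 ⊛ mk ket1 : Diag 1 2) ⊚ (one 1 ⊛ mk Circ.not : Diag 2 2) :=
    one_tens_comp (mk ket1) (mk Circ.not) 1
  have h2 : (one 1 ⊛ mk bra0 : Diag 2 1) = (one 1 ⊛ mk Circ.not : Diag 2 2) ⊚ (one 1 ⊛ mk bra1 : Diag 2 1) :=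
    one_tens_comp (mk Circ.not) (mk bra1) 1
  rw [h1, h2, assoc (one 1 ⊛ mk ket1), ← cnot_not]
  simp only [assoc]

theorem proj_tof : (one 2 ⊛ mk ket0 : Diag 2 3) ⊚ mk tof ⊚ (one 2 ⊛ mk bra1 : Diag 3 2) =
    (one 2 ⊛ mk ket1 : Diag 2 3) ⊚ mk tof ⊚ (one 2 ⊛ mk bra0 : Diag 3 2) := by
  have h1 : (one 2 ⊛ mk ket0 : Diag 2 3) = (one 2 ⊛ mk ket1 : Diag 2 3) ⊚ (one 2 ⊛ mk Circ.not : Diag 3 3) :=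
    one_tens_comp (mk ket1) (mk Circ.not) 2
  have h2 : (one 2 ⊛ mk bra0 : Diag 3 2) = (one 2 ⊛ mk Circ.not : Diag 3 3) ⊚ (one 2 ⊛ mk bra1 : Diag 3 2) :=
    one_tens_comp (mk Circ.not) (mk bra1) 2
  rw [h1, h2, assoc (one 2 ⊛ mk ket1), ← tof_not]
  simp only [assoc]

def P (x : Diag 0 1) (y : Diag 1 0) : Diag 1 1 :=
  (one 1 ⊛ x : Diag 1 2) ⊚ mk cnot ⊚ (one 1 ⊛ y : Diag 2 1)

theorem one_one_tens {n m : ℕ} (x : Diag n m) :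
    dcast (Nat.add_assoc 1 1 n) (Nat.add_assoc 1 1 m) (one 2 ⊛ x) = one 1 ⊛ (one 1 ⊛ x) := by
  rw [← tens_assoc, one_tens_one]

theorem P_lower (x : Diag 0 1) (y : Diag 1 0) :
    (one 2 ⊛ x : Diag 2 3) ⊚ (one 1 ⊛ mk cnot : Diag 3 3) ⊚ (one 2 ⊛ y : Diag 3 2) =
      (one 1 ⊛ P x y : Diag 2 2) := by
  rw [show (one 2 ⊛ x : Diag 2 3) = one 1 ⊛ (one 1 ⊛ x) from one_one_tens x,
    show (one 2 ⊛ y : Diag 3 2) = one 1 ⊛ (one 1 ⊛ y) from one_one_tens y]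
  refine Eq.trans ?_ (one_tens_comp ((one 1 ⊛ x : Diag 1 2) ⊚ mk cnot) (one 1 ⊛ y) 1).symm
  exact congrArg (fun z : Diag 2 3 => z ⊚ (one 1 ⊛ (one 1 ⊛ y) : Diag 3 2))
    (one_tens_comp (one 1 ⊛ x) (mk cnot) 1).symm

theorem P_upper (x : Diag 0 1) (y : Diag 1 0) :
    (one 2 ⊛ x : Diag 2 3) ⊚ mk cnot13 ⊚ (one 2 ⊛ y : Diag 3 2) = (P x y ⊛ one 1 : Diag 2 2) := by
  have h1 : (one 2 ⊛ x : Diag 2 3) ⊚ (one 1 ⊛ mk (swap 1 1) : Diag 3 3) =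
      ((one 1 ⊛ x : Diag 1 2) ⊛ one 1 : Diag 2 3) := by
    rw [show (one 2 ⊛ x : Diag 2 3) = one 1 ⊛ (one 1 ⊛ x) from one_one_tens x]
    refine (one_tens_comp (one 1 ⊛ x) (mk (swap 1 1)) 1).symm.trans ?_
    rw [ket_swap]; exact (tens_assoc (one 1) x (one 1)).symm
  have h2 : (one 1 ⊛ mk (swap 1 1) : Diag 3 3) ⊚ (one 2 ⊛ y : Diag 3 2) =
      ((one 1 ⊛ y : Diag 2 1) ⊛ one 1 : Diag 3 2) := by
    rw [show (one 2 ⊛ y : Diag 3 2) = one 1 ⊛ (one 1 ⊛ y) from one_one_tens y]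
    refine (one_tens_comp (mk (swap 1 1)) (one 1 ⊛ y) 1).symm.trans ?_
    rw [bra_swap']; exact (tens_assoc (one 1) y (one 1)).symm
  show (one 2 ⊛ x : Diag 2 3) ⊚ ((one 1 ⊛ mk (swap 1 1) : Diag 3 3) ⊚ (mk cnot ⊛ one 1 : Diag 3 3) ⊚
    (one 1 ⊛ mk (swap 1 1) : Diag 3 3)) ⊚ (one 2 ⊛ y : Diag 3 2) = _
  rw [← assoc, ← assoc, h1, assoc, h2]
  refine Eq.trans ?_ (tens_one_comp ((one 1 ⊛ x : Diag 1 2) ⊚ mk cnot) (one 1 ⊛ y) 1).symm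
  exact congrArg (fun z : Diag 2 3 => z ⊚ ((one 1 ⊛ y) ⊛ one 1 : Diag 3 2))
    (tens_one_comp (one 1 ⊛ x) (mk cnot) 1).symm

/-! The horizontal flip is compatible with equality of circuits. -/

theorem dagger_cnot : mk (dagger cnot) = mk cnot := mk_eq (.symm (.comp_assoc _ _ _))

theorem dagger_not : mk (dagger Circ.not) = mk Circ.not := by
  show (mk ket1 ⊛ one 1 : Diag 1 2) ⊚ (mk (dagger cnot) ⊚ (mk bra1 ⊛ one 1 : Diag 2 1)) = _
  rw [dagger_cnot]; exact (assoc _ _ _).symm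

theorem dagger_ket0 : mk (dagger ket0) = mk bra0 := by
  show mk (dagger Circ.not) ⊚ mk bra1 = _
  rw [dagger_not]; rfl

theorem dagger_bra0 : mk (dagger bra0) = mk ket0 := by
  show mk ket1 ⊚ mk (dagger Circ.not) = _
  rw [dagger_not]; rfl

theorem dagger_swap13 : mk (dagger swap13) = mk swap13 := mk_eq (.symm (.comp_assoc _ _ _))

theorem dagger_flipTof : mk (dagger flipTof) = mk flipTof := by
  show mk (dagger swap13) ⊚ (mk tof ⊚ mk (dagger swap13)) = _
  rw [dagger_swap13]; exact (assoc _ _ _).symm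

theorem dagger_flipCnot : mk (dagger flipCnot) = mk flipCnot := by
  show mk (swap 1 1) ⊚ (mk (dagger cnot) ⊚ mk (swap 1 1)) = _
  rw [dagger_cnot]; exact (assoc _ _ _).symm

theorem dagger_cnot13 : mk (dagger cnot13) = mk cnot13 := by
  show (one 1 ⊛ mk (swap 1 1) : Diag 3 3) ⊚ ((mk (dagger cnot) ⊛ one 1 : Diag 3 3) ⊚
    (one 1 ⊛ mk (swap 1 1) : Diag 3 3)) = _
  rw [dagger_cnot]; exact (assoc _ _ _).symm

theorem dagger_tof124 : mk (dagger tof124) = mk tof124 := mk_eq (.symm (.comp_assoc _ _ _))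

theorem dagger_tof134 : mk (dagger tof134) = mk tof134 := mk_eq (.symm (.comp_assoc _ _ _))

theorem dagger_threeControl : mk (dagger threeControl) = mk threeControl := by
  show (one 2 ⊛ mk (dagger bra0) ⊛ one 2 : Diag 4 5) ⊚ ((mk tof ⊛ one 2 : Diag 5 5) ⊚
    ((one 2 ⊛ mk tof : Diag 5 5) ⊚ ((mk tof ⊛ one 2 : Diag 5 5) ⊚
      (one 2 ⊛ mk (dagger ket0) ⊛ one 2 : Diag 5 4)))) = _
  rw [dagger_bra0, dagger_ket0, ← assoc, ← assoc, ← assoc]; rfl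

theorem tof124_sq : mk tof124 ⊚ mk tof124 = one 4 := by
  have h1 : (one 2 ⊛ mk (swap 1 1) : Diag 4 4) ⊚ (one 2 ⊛ mk (swap 1 1) : Diag 4 4) = one 4 :=
    tens_sq swap_sq 2
  have h2 : (mk tof ⊛ one 1 : Diag 4 4) ⊚ (mk tof ⊛ one 1 : Diag 4 4) = one 4 := sq_tens tof_sq 1
  exact sq_conj h1 h2

theorem tof134_sq : mk tof134 ⊚ mk tof134 = one 4 := by
  have h1 : (mk (swap 1 1) ⊛ one 2 : Diag 4 4) ⊚ (mk (swap 1 1) ⊛ one 2 : Diag 4 4) = one 4 :=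
    sq_tens swap_sq 2
  have h2 : (one 1 ⊛ mk tof : Diag 4 4) ⊚ (one 1 ⊛ mk tof : Diag 4 4) = one 4 := tens_sq tof_sq 1
  exact sq_conj h1 h2

theorem dagger_identity {n m : ℕ} {f g : Circ n m} (r : Identity f g) :
    mk (dagger f) = mk (dagger g) := by
  have sT1 : (mk tof ⊛ one 1 : Diag 4 4) ⊚ (mk tof ⊛ one 1 : Diag 4 4) = one 4 := sq_tens tof_sq 1
  have s1T : (one 1 ⊛ mk tof : Diag 4 4) ⊚ (one 1 ⊛ mk tof : Diag 4 4) = one 4 := tens_sq tof_sq 1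
  have sC2 : (mk cnot ⊛ one 2 : Diag 4 4) ⊚ (mk cnot ⊛ one 2 : Diag 4 4) = one 4 := sq_tens cnot_sq 2
  have s2C : (one 2 ⊛ mk cnot : Diag 4 4) ⊚ (one 2 ⊛ mk cnot : Diag 4 4) = one 4 := tens_sq cnot_sq 2
  cases r
  case tof1 =>
    refine (mk_eq (.ofIdentity .tof1')).trans ?_
    show (mk bra1 ⊛ mk cnot : Diag 3 2) = mk bra1 ⊛ mk (dagger cnot)
    rw [dagger_cnot]
  case tof1' =>
    refine (mk_eq (.ofIdentity .tof1)).trans ?_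
    show (mk ket1 ⊛ mk cnot : Diag 2 3) = mk ket1 ⊛ mk (dagger cnot)
    rw [dagger_cnot]
  case tof2 =>
    show mk tof ⊚ (mk (dagger ket0) ⊛ one 2 : Diag 3 2) = mk (dagger ket0) ⊛ one 2
    rw [dagger_ket0]; exact mk_eq (.ofIdentity .tof2')
  case tof2' =>
    show (mk (dagger bra0) ⊛ one 2 : Diag 2 3) ⊚ mk tof = mk (dagger bra0) ⊛ one 2
    rw [dagger_bra0]; exact mk_eq (.ofIdentity .tof2)
  case tof3 =>
    show (one 2 ⊛ mk (dagger flipTof) : Diag 5 5) ⊚ (mk tof ⊛ one 2 : Diag 5 5) =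
      (mk tof ⊛ one 2 : Diag 5 5) ⊚ (one 2 ⊛ mk (dagger flipTof) : Diag 5 5)
    rw [dagger_flipTof]; exact mk_eq (.symm (.ofIdentity .tof3))
  case tof4 =>
    show (one 2 ⊛ mk tof : Diag 5 5) ⊚ (mk (dagger flipTof) ⊛ one 2 : Diag 5 5) =
      (mk (dagger flipTof) ⊛ one 2 : Diag 5 5) ⊚ (one 2 ⊛ mk tof : Diag 5 5)
    rw [dagger_flipTof]; exact mk_eq (.symm (.ofIdentity .tof4))
  case tof5 =>
    show (one 1 ⊛ mk tof : Diag 4 4) ⊚ (mk (dagger flipTof) ⊛ one 1 : Diag 4 4) =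
      (mk (dagger flipTof) ⊛ one 1 : Diag 4 4) ⊚ (one 1 ⊛ mk tof : Diag 4 4)
    rw [dagger_flipTof]; exact mk_eq (.symm (.ofIdentity .tof5))
  case tof5half =>
    show (one 1 ⊛ mk tof : Diag 4 4) ⊚ mk (dagger tof134) = mk (dagger tof134) ⊚ (one 1 ⊛ mk tof : Diag 4 4)
    rw [dagger_tof134]; exact mk_eq (.symm (.ofIdentity .tof5half))
  case tof6 =>
    have h : ((one 2 ⊛ mk ket1 : Diag 2 3) ⊚ mk cnot13 ⊚ (one 2 ⊛ mk bra0 : Diag 3 2)) ⊚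
        ((one 2 ⊛ mk ket1 : Diag 2 3) ⊚ (one 1 ⊛ mk cnot : Diag 3 3) ⊚ (one 2 ⊛ mk bra0 : Diag 3 2)) =
        (one 2 ⊛ mk ket1 : Diag 2 3) ⊚ mk tof ⊚ (one 2 ⊛ mk bra0 : Diag 3 2) :=
      mk_eq (.ofIdentity .tof6)
    have hP : P (mk ket0) (mk bra1) = P (mk ket1) (mk bra0) := proj_cnot
    show ((one 2 ⊛ mk (dagger bra0) : Diag 2 3) ⊚ ((one 1 ⊛ mk (dagger cnot) : Diag 3 3) ⊚
        (one 2 ⊛ mk bra1 : Diag 3 2))) ⊚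
      ((one 2 ⊛ mk (dagger bra0) : Diag 2 3) ⊚ (mk (dagger cnot13) ⊚ (one 2 ⊛ mk bra1 : Diag 3 2))) =
      (one 2 ⊛ mk (dagger bra0) : Diag 2 3) ⊚ (mk tof ⊚ (one 2 ⊛ mk bra1 : Diag 3 2))
    rw [dagger_cnot, dagger_cnot13, dagger_bra0, ← assoc (one 2 ⊛ mk ket0) (one 1 ⊛ mk cnot),
      ← assoc (one 2 ⊛ mk ket0) (mk cnot13), ← assoc (one 2 ⊛ mk ket0) (mk tof), P_lower, P_upper,
      proj_tof, ← h, P_lower, P_upper, hP]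
    exact (tens_split' _ _).symm.trans (tens_split _ _)
  case tof7 =>
    show (mk (dagger bra0) ⊚ mk bra1) ⊛ one 1 = (mk (dagger bra0) ⊚ mk bra1) ⊛ (mk bra1 ⊚ mk ket1)
    rw [dagger_bra0, show mk ket0 ⊚ mk bra1 = mk ket1 ⊚ mk bra0 from
      assoc (mk ket1) (mk Circ.not) (mk bra1)]
    exact mk_eq (.ofIdentity .tof7)
  case tof8 => exact mk_eq (.ofIdentity .tof8)
  case tof9 => exact mk_eq (.ofIdentity .tof9)
  case tof10 =>
    exact (flip_of_sq s1T sT1 tof124_sq (mk_eq (.ofIdentity .tof10))).trans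
      (congrArg (fun x : Diag 4 4 => (mk tof ⊛ one 1 : Diag 4 4) ⊚ x) dagger_tof124.symm)
  case tof11 =>
    show (mk (dagger cnot) ⊛ one 2 : Diag 4 4) ⊚ ((one 1 ⊛ mk tof : Diag 4 4) ⊚
      (mk (dagger cnot) ⊛ one 2 : Diag 4 4)) = (one 1 ⊛ mk tof : Diag 4 4) ⊚ mk (dagger tof134)
    rw [dagger_cnot, dagger_tof134]
    exact flip_of_sq sC2 s1T tof134_sq (mk_eq (.ofIdentity .tof11))
  case tof12 =>
    exact (flip_of_sq sT1 s1T tof124_sq (mk_eq (.ofIdentity .tof12))).trans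
      (congrArg (fun x : Diag 4 4 => (one 1 ⊛ mk tof : Diag 4 4) ⊚ x) dagger_tof124.symm)
  case tof13 =>
    show (mk tof ⊛ one 1 : Diag 4 4) ⊚ ((one 2 ⊛ mk (dagger cnot) : Diag 4 4) ⊚
      (mk tof ⊛ one 1 : Diag 4 4)) = (one 2 ⊛ mk (dagger cnot) : Diag 4 4) ⊚ mk (dagger tof124)
    rw [dagger_cnot, dagger_tof124]
    exact flip_of_sq sT1 s2C tof124_sq (mk_eq (.ofIdentity .tof13))
  case tof14 =>
    show mk (dagger cnot) ⊚ (mk (dagger flipCnot) ⊚ mk (dagger cnot)) = mk (swap 1 1)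
    rw [dagger_cnot, dagger_flipCnot, ← assoc]; exact mk_eq (.ofIdentity .tof14)
  case tof15 => exact (mk_eq (.ofIdentity .tof15)).trans (mk_eq (.comp_assoc _ _ _))
  case tof16 =>
    show mk (dagger threeControl) = (one 1 ⊛ mk (swap 1 1) ⊛ one 1 : Diag 4 4) ⊚
      (mk (dagger threeControl) ⊚ (one 1 ⊛ mk (swap 1 1) ⊛ one 1 : Diag 4 4))
    rw [dagger_threeControl, ← assoc]; exact mk_eq (.ofIdentity .tof16)

theorem dcast_comp {a b c a' b' c' : ℕ} (h : a = a') (h' : b = b') (h'' : c = c')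
    (f : Diag a b) (g : Diag b c) : dcast h h' f ⊚ dcast h' h'' g = dcast h h'' (f ⊚ g) := by
  subst h; subst h'; subst h''; rfl

theorem dcast_one {a a' : ℕ} (h : a = a') : dcast h h (one a) = one a' := by subst h; rfl

theorem dagger_rel {n m : ℕ} {f g : Circ n m} (r : Rel f g) : mk (dagger f) = mk (dagger g) := by
  induction r with
  | refl => rfl
  | symm _ ih => exact ih.symm
  | trans _ _ ih ih' => exact ih.trans ih'
  | comp _ _ ih ih' => exact congrArg₂ Diag.comp ih' ih
  | tensor _ _ ih ih' => exact congrArg₂ tens ih ih'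
  | id_comp f => exact mk_eq (.comp_id _)
  | comp_id f => exact mk_eq (.id_comp _)
  | comp_assoc f g h => exact mk_eq (.symm (.comp_assoc _ _ _))
  | tensor_id a b => exact mk_eq (.tensor_id a b)
  | interchange f g f' g' => exact mk_eq (.interchange _ _ _ _)
  | tensor_assoc f g h => rw [dagger_cast]; exact mk_eq (.tensor_assoc _ _ _)
  | unit_tensor f => rw [dagger_cast]; exact mk_eq (.unit_tensor _)
  | tensor_unit f => exact mk_eq (.tensor_unit _)
  | swap_natural f g => exact mk_eq (.symm (.swap_natural _ _))
  | swap_swap a b => exact mk_eq (.swap_swap a b)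
  | hexagon a b c =>
    have h := mk_eq (.hexagon a b c)
    simp only [dagger, dagger_cast]
    simp only [mk_comp, mk_tensor, mk_cast] at h ⊢
    have hX : dcast (Nat.add_assoc b c a) (Nat.add_assoc a b c).symm (mk (swap (b + c) a)) ⊚
        dcast (Nat.add_assoc a b c).symm (Nat.add_assoc b c a) (mk (swap a (b + c))) = one _ := by
      rw [dcast_comp, show mk (swap (b + c) a) ⊚ mk (swap a (b + c)) = one _ from
        mk_eq (.swap_swap _ _), dcast_one]
    have hY1 : dcast rfl (Nat.add_assoc b a c) (mk (swap a b) ⊛ one c) ⊚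
        dcast (Nat.add_assoc b a c) rfl (mk (swap b a) ⊛ one c) = one _ := by
      rw [dcast_comp, ← tens_one_comp, show mk (swap a b) ⊚ mk (swap b a) = one _ from
        mk_eq (.swap_swap _ _), one_tens_one, dcast_one]
    have hY2 : one b ⊛ mk (swap a c) ⊚ one b ⊛ mk (swap c a) = one _ := by
      rw [← one_tens_comp, show mk (swap a c) ⊚ mk (swap c a) = one _ from
        mk_eq (.swap_swap _ _), one_tens_one]
    generalize dcast (Nat.add_assoc b c a) (Nat.add_assoc a b c).symm (mk (swap (b + c) a)) = X' at *
    generalize dcast (Nat.add_assoc a b c).symm (Nat.add_assoc b c a) (mk (swap a (b + c))) = X at *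
    change X = dcast rfl (Nat.add_assoc b a c) (mk (swap a b) ⊛ one c) ⊚ (one b ⊛ mk (swap a c)) at h
    show X' = (one b ⊛ mk (swap c a)) ⊚ dcast (Nat.add_assoc b a c) rfl (mk (swap b a) ⊛ one c)
    generalize dcast rfl (Nat.add_assoc b a c) (mk (swap a b) ⊛ one c) = Y1 at *
    generalize dcast (Nat.add_assoc b a c) rfl (mk (swap b a) ⊛ one c) = Y1' at *
    calc X' = X' ⊚ (Y1 ⊚ (one b ⊛ mk (swap a c) ⊚ one b ⊛ mk (swap c a)) ⊚ Y1') := by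
          rw [hY2, comp_one, hY1, comp_one]
      _ = (X' ⊚ (Y1 ⊚ one b ⊛ mk (swap a c))) ⊚ (one b ⊛ mk (swap c a) ⊚ Y1') := by
          simp only [assoc]
      _ = _ := by rw [← h, hX, one_comp]
  | ofIdentity r => exact dagger_identity r

/-- The horizontal flip `f°`. -/
def dagger {n m : ℕ} : Diag n m → Diag m n :=
  Quotient.lift (fun f => mk f.dagger) fun _ _ h => dagger_rel h

/-- The point `|b₁, …, bₙ⟩ = |b₁⟩ ⊗ ⋯ ⊗ |bₙ⟩`. -/
def ket : {n : ℕ} → (Fin n → Bool) → Diag 0 n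
  | 0, _ => one 0
  | n + 1, b => ket (fun i : Fin n => b i.castSucc) ⊛ bit (b (Fin.last n))

/-- Auxiliary evaluation on lists of bits. -/
def eval {n m : ℕ} (f : Diag n m) (l : List Bool) : Option (List Bool) :=
  Quotient.lift (fun f => if l.length = n then f.eval l else none)
    (fun f g h => by
      by_cases hl : l.length = n
      · simp only [hl, if_true]; exact sound h l hl
      · simp only [hl, if_false]) f

theorem eval_mk {n m : ℕ} (f : Circ n m) {l : List Bool} (h : l.length = n) :
    eval (mk f) l = f.eval l := if_pos h

theorem eval_comp {n m k : ℕ} (f : Diag n m) (g : Diag m k) (l : List Bool) :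
    eval (f ⊚ g) l = (eval f l).bind (eval g) := by
  refine Quotient.inductionOn₂ f g fun f g => ?_
  show eval (mk (f ⨾ g)) l = (eval (mk f) l).bind (eval (mk g))
  by_cases h : l.length = n
  · rw [eval_mk _ h, eval_mk _ h]
    simp only [Circ.eval]
    cases e : f.eval l with
    | none => rfl
    | some x => exact (eval_mk g (eval_length f _ _ h e)).symm
  · have h1 : eval (mk (f ⨾ g)) l = none := if_neg h
    have h2 : eval (mk f) l = none := if_neg h
    rw [h1, h2]; rfl

theorem eval_one {n : ℕ} {l : List Bool} (h : l.length = n) : eval (one n) l = some l :=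
  eval_mk _ h

theorem eval_dagger_imp {n m : ℕ} (f : Diag n m) {l l' : List Bool} (h : eval f l = some l') :
    eval (dagger f) l' = some l := by
  revert h
  refine Quotient.inductionOn f fun f => ?_
  intro h
  by_cases hl : l.length = n
  · have e : f.eval l = some l' := (eval_mk f hl).symm.trans h
    exact (eval_mk f.dagger (eval_length f _ _ hl e)).trans (eval_dagger' f _ _ hl e)
  · have h1 : eval (mk f) l = none := if_neg hl
    exact absurd (h1.symm.trans h) (by simp)

theorem dagger_dagger {n m : ℕ} (f : Diag n m) : dagger (dagger f) = f :=
  Quotient.inductionOn f fun f => congrArg mk (Circ.dagger_dagger f)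

theorem eval_dagger {n m : ℕ} (f : Diag n m) {l l' : List Bool} :
    eval f l = some l' ↔ eval (dagger f) l' = some l :=
  ⟨eval_dagger_imp f, fun h => by simpa only [dagger_dagger] using eval_dagger_imp (dagger f) h⟩

theorem eval_bit (b : Bool) : eval (bit b) [] = some [b] := by
  cases b
  · exact (eval_mk ket0 rfl).trans (by decide)
  · exact (eval_mk ket1 rfl).trans rfl

theorem eval_tens {a b c d : ℕ} (f : Diag a b) (g : Diag c d) {x y x' y' : List Bool}
    (hx : x.length = a) (hy : y.length = c) (h : eval f x = some x') (h' : eval g y = some y') :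
    eval (f ⊛ g) (x ++ y) = some (x' ++ y') := by
  revert h h'
  refine Quotient.inductionOn₂ f g fun f g => ?_
  intro h h'
  have h1 : f.eval x = some x' := (eval_mk f hx).symm.trans h
  have h2 : g.eval y = some y' := (eval_mk g hy).symm.trans h'
  refine (eval_mk (f ⊠ g) (by simp [hx, hy])).trans ?_
  simp only [Circ.eval]
  rw [List.take_left' hx, List.drop_left' hx, h1, h2]; rfl

theorem eval_ket {n : ℕ} (b : Fin n → Bool) : eval (ket b) [] = some (List.ofFn b) := by
  induction n with
  | zero => exact (eval_one rfl).trans (by simp)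
  | succ n ih =>
    refine (eval_tens (ket fun i : Fin n => b i.castSucc) (bit (b (Fin.last n))) (x := [])
      (y := []) rfl rfl (ih _) (eval_bit _)).trans ?_
    rw [List.ofFn_succ_last]

theorem ket_append {n m : ℕ} (b : Fin n → Bool) (c : Fin m → Bool) :
    ket (Fin.append b c) = (ket b ⊛ ket c : Diag 0 (n + m)) := by
  induction m with
  | zero =>
    refine Eq.trans ?_ (tens_one_zero (ket b)).symm
    congr 1
    funext i
    exact Fin.append_left b c i
  | succ m ih =>
    have h : ket (Fin.append b c) =
        (ket b ⊛ ket (fun i : Fin m => c i.castSucc) ⊛ bit (c (Fin.last m)) : Diag 0 (n + m + 1)) := by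
      rw [← ih]
      show ket _ ⊛ bit _ = _
      have h1 : (fun i : Fin (n + m) => Fin.append b c (i.castSucc : Fin (n + m + 1))) =
          Fin.append b fun i : Fin m => c i.castSucc := by
        funext i
        refine Fin.addCases (fun i => ?_) (fun i => ?_) i
        · rw [Fin.append_left]; exact Fin.append_left b c i
        · rw [Fin.append_right]; exact Fin.append_right b c i.castSucc
      have h2 : Fin.append b c (Fin.last (n + m) : Fin (n + m + 1)) = c (Fin.last m) :=
        Fin.append_right b c (Fin.last m)
      refine Eq.trans (congrArg (fun x : Bool => (_ ⊛ bit x : Diag 0 (n + m + 1))) h2) ?_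
      exact congrArg (fun x : Fin (n + m) → Bool => (ket x ⊛ bit (c (Fin.last m)) : Diag 0 (n + m + 1)))
        h1
    exact h.trans (tens_assoc (ket b) (ket fun i : Fin m => c i.castSucc) (bit (c (Fin.last m))))

theorem exists_append {n m : ℕ} (b : Fin (n + m) → Bool) :
    ∃ (x : Fin n → Bool) (y : Fin m → Bool), b = Fin.append x y :=
  ⟨fun i => b (Fin.castAdd m i), fun i => b (Fin.natAdd n i), Fin.append_castAdd_natAdd.symm⟩

theorem ket_three (b : Fin 3 → Bool) : ket b = (bit (b 0) ⊛ bit (b 1) ⊛ bit (b 2) : Diag 0 3) :=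
  congrArg (fun x : Diag 0 1 => (x ⊛ bit (b 1) ⊛ bit (b 2) : Diag 0 3)) (zero_tens (bit (b 0)))

theorem ket_one (b : Fin 1 → Bool) : ket b = bit (b 0) := zero_tens (bit (b 0))

/-- Circuits act on points by evaluation. -/
theorem ket_comp_mk {n m : ℕ} (f : Circ n m) : ∀ (b : Fin n → Bool) (l : List Bool),
    f.eval (List.ofFn b) = some l → ∃ c : Fin m → Bool, l = List.ofFn c ∧ ket b ⊚ mk f = ket c := by
  induction f with
  | id n =>
    intro b l h
    exact ⟨b, (Option.some.inj h).symm, comp_one _⟩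
  | comp f g hf hg =>
    intro b l h
    simp only [Circ.eval, Option.bind_eq_some_iff] at h
    obtain ⟨x, h1, h2⟩ := h
    obtain ⟨c, rfl, hc⟩ := hf b x h1
    obtain ⟨d, rfl, hd⟩ := hg c l h2
    exact ⟨d, rfl, by rw [mk_comp, ← assoc, hc, hd]⟩
  | @tensor n _ m _ f g hf hg =>
    intro b l h
    obtain ⟨x, y, rfl⟩ := exists_append b
    simp only [Circ.eval, Option.bind_eq_some_iff, Option.map_eq_some_iff, List.ofFn_fin_append] at h
    rw [List.take_left' (by simp), List.drop_left' (by simp)] at h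
    obtain ⟨x', h1, y', h2, rfl⟩ := h
    obtain ⟨c, rfl, hc⟩ := hf x x' h1
    obtain ⟨d, rfl, hd⟩ := hg y y' h2
    refine ⟨Fin.append c d, by rw [List.ofFn_fin_append], ?_⟩
    rw [ket_append, ket_append, ← hc, ← hd]
    exact (interchange (ket x) (mk f) (ket y) (mk g)).symm
  | swap n m =>
    intro b l h
    obtain ⟨x, y, rfl⟩ := exists_append b
    simp only [Circ.eval, Option.some.injEq, List.ofFn_fin_append] at h
    rw [List.take_left' (by simp), List.drop_left' (by simp)] at h
    refine ⟨Fin.append y x, by rw [List.ofFn_fin_append, h], ?_⟩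
    rw [ket_append, ket_append]
    refine (swap_natural (ket x) (ket y)).trans ?_
    rw [swap00]; exact one_comp _
  | ket1 =>
    intro b l h
    refine ⟨fun _ => true, (Option.some.inj h).symm, ?_⟩
    rw [ket_one]; exact one_comp _
  | bra1 =>
    intro b l h
    simp only [Circ.eval, Option.ite_none_right_eq_some, Option.some.injEq] at h
    obtain ⟨h1, rfl⟩ := h
    have h2 : b 0 = true := by simpa using h1
    refine ⟨Fin.elim0, by simp, ?_⟩
    rw [ket_one, h2]; exact ket_bra
  | tof =>
    intro b l h
    refine ⟨![b 0, b 1, Bool.xor (b 0 && b 1) (b 2)], ?_, ?_⟩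
    · rw [← Option.some.inj h]; simp
    · rw [ket_three, ket_three]; exact bits_tof _ _ _

theorem ket_injective {n : ℕ} {b c : Fin n → Bool} (h : ket b = ket c) : b = c := by
  have h1 := (eval_ket b).symm.trans ((congrArg (fun x => eval x []) h).trans (eval_ket c))
  exact List.ofFn_injective (Option.some.inj h1)

theorem ket_comp {n m : ℕ} (f : Diag n m) (b : Fin n → Bool) {l : List Bool}
    (h : eval f (List.ofFn b) = some l) : ∃ c : Fin m → Bool, l = List.ofFn c ∧ ket b ⊚ f = ket c := by
  revert h
  refine Quotient.inductionOn f fun f h => ?_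
  exact ket_comp_mk f b l ((eval_mk f (by simp)).symm.trans h)

theorem ket_comp_iff {n m : ℕ} (f : Diag n m) (b : Fin n → Bool) (c : Fin m → Bool) :
    ket b ⊚ f = ket c ↔ eval f (List.ofFn b) = some (List.ofFn c) := by
  constructor
  · intro h
    have h1 := congrArg (fun x => eval x []) h
    simpa only [eval_comp, eval_ket, Option.bind_some] using h1
  · intro h
    obtain ⟨d, h1, h2⟩ := ket_comp f b h
    rw [h2, List.ofFn_injective h1]

/-- The total points are exactly the points `|b₁, …, bₙ⟩`. -/
theorem total_iff {n : ℕ} (f : Diag 0 n) : f ⊚ dagger f = one 0 ↔ ∃ b : Fin n → Bool, f = ket b := by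
  constructor
  · intro h
    have h1 := congrArg (fun x => eval x []) h
    simp only [eval_comp, eval_one (n := 0) (l := []) rfl, Option.bind_eq_some_iff] at h1
    obtain ⟨l, h2, _⟩ := h1
    obtain ⟨c, _, hc⟩ := ket_comp f (Fin.elim0 : Fin 0 → Bool) (l := l) (by simpa using h2)
    exact ⟨c, (one_comp f).symm.trans hc⟩
  · rintro ⟨b, rfl⟩
    have h := (eval_dagger _).1 (eval_ket b)
    obtain ⟨c, _, hc⟩ := ket_comp (dagger (ket b)) b h
    exact hc

end Diag

open Diag

/-! ### The category `TOF` -/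

/-- Objects of `TOF`: natural numbers. -/
def TOF : Type := ℕ

namespace TOF

instance : Category TOF where
  Hom n m := Diag n m
  id n := Diag.one n
  comp f g := Diag.comp f g
  id_comp := Diag.one_comp
  comp_id := Diag.comp_one
  assoc := Diag.assoc

/-- The object `0`. -/
def zero : TOF := (0 : ℕ)

/-- The horizontal flip `f°`. -/
def dagger {n m : TOF} (f : n ⟶ m) : m ⟶ n := Diag.dagger f

/-- The restriction `f̄ = f f°` (diagrammatic order). -/
def bar {n m : TOF} (f : n ⟶ m) : n ⟶ n := f ≫ dagger f

def IsRestrictionIdempotent {n : TOF} (e : n ⟶ n) : Prop := e = bar e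

/-- The total points of `n`: the morphisms `g : 0 ⟶ n` with `ḡ = 1`. -/
def TotalPoint (n : TOF) : Type := {g : zero ⟶ n // bar g = 𝟙 zero}

open Classical in
/-- The partial function induced by `f` on total points: `g ↦ g f` if `g f` is total, undefined
otherwise. -/
noncomputable def onPoints {n m : TOF} (f : n ⟶ m) (g : TotalPoint n) : Option (TotalPoint m) :=
  if h : bar (g.1 ≫ f) = 𝟙 zero then some ⟨g.1 ≫ f, h⟩ else none

/-- The identification of bit strings `b₁ … bₙ` with total points `|b₁, …, bₙ⟩`. -/
noncomputable def pointEquiv (n : TOF) : (Fin n → Bool) ≃ TotalPoint n :=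
  Equiv.ofBijective (fun b => ⟨ket b, (total_iff _).2 ⟨b, rfl⟩⟩)
    ⟨fun _ _ h => ket_injective (congrArg Subtype.val h), fun g => by
      obtain ⟨b, hb⟩ := (total_iff g.1).1 g.2
      exact ⟨b, Subtype.ext hb.symm⟩⟩

theorem mem_onPoints {n m : TOF} (f : n ⟶ m) (g : TotalPoint n) (k : TotalPoint m) :
    k ∈ onPoints f g ↔ g.1 ≫ f = k.1 := by
  unfold onPoints
  by_cases h : bar (g.1 ≫ f) = 𝟙 zero
  · rw [dif_pos h]
    exact ⟨fun e => congrArg Subtype.val (Option.some.inj e), fun e => congrArg some (Subtype.ext e)⟩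
  · rw [dif_neg h]
    exact ⟨fun e => absurd e (by simp), fun e => absurd (by rw [e]; exact k.2) h⟩

theorem mem_onPoints_ket {n m : TOF} (f : n ⟶ m) (b : Fin n → Bool) (c : Fin m → Bool) :
    pointEquiv m c ∈ onPoints f (pointEquiv n b) ↔
      Diag.eval f (List.ofFn b) = some (List.ofFn c) :=
  (mem_onPoints _ _ _).trans (ket_comp_iff f b c)

theorem mem_onPoints_dagger {n m : TOF} (f : n ⟶ m) (g : TotalPoint n) (k : TotalPoint m) :
    g ∈ onPoints (dagger f) k ↔ k ∈ onPoints f g := by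
  obtain ⟨b, rfl⟩ := (pointEquiv n).surjective g
  obtain ⟨c, rfl⟩ := (pointEquiv m).surjective k
  rw [mem_onPoints_ket, mem_onPoints_ket]
  exact (Diag.eval_dagger f).symm

end TOF

/-! ### Partial injections -/

/-- The category `Pinj` of sets and partial isomorphisms. -/
def Pinj : Type 1 := Type

namespace Pinj

instance : Category Pinj where
  Hom X Y := PEquiv X Y
  id X := PEquiv.refl X
  comp f g := PEquiv.trans f g
  id_comp f := PEquiv.refl_trans f
  comp_id f := PEquiv.trans_refl f
  assoc f g h := PEquiv.trans_assoc f g h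

open Classical in
/-- The restriction of a partial injection: the partial identity on its domain of definition. -/
noncomputable def bar {X Y : Pinj} (f : X ⟶ Y) : X ⟶ X :=
  PEquiv.ofSet {x : X | (PEquiv.toFun f x).isSome}

/-- The set `{0, 1}ⁿ`. -/
def bits (n : ℕ) : Pinj := (Fin n → Bool : Type)

end Pinj

/-- The full subcategory of `Pinj` on the powers `{0, 1}ⁿ` of the two-element set. -/
abbrev FPinj₂ : Type := InducedCategory Pinj Pinj.bits

namespace FPinj₂

noncomputable def bar {X Y : FPinj₂} (f : X ⟶ Y) : X ⟶ X :=
  InducedCategory.homMk (Pinj.bar f.hom)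

def IsRestrictionIdempotent {X : FPinj₂} (e : X ⟶ X) : Prop := e = bar e

end FPinj₂

/-! ### Evaluation on total points -/

namespace TOF

/-- The functor `H₀ : TOF ⥤ Pinj` sending `n` to its set of total points. -/
noncomputable def H₀ : TOF ⥤ Pinj where
  obj n := TotalPoint n
  map f := PEquiv.mk (onPoints f) (onPoints (dagger f)) fun g k => mem_onPoints_dagger f g k
  map_id n := PEquiv.ext fun g => Option.ext fun k =>
    (mem_onPoints (𝟙 n) g k).trans (by
      rw [Category.comp_id]
      exact ⟨fun h => congrArg some (Subtype.ext h), fun h => congrArg Subtype.val (Option.some.inj h)⟩)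
  map_comp {n m k} f f' := PEquiv.ext fun g => Option.ext fun k => by
    refine Iff.trans ?_ (PEquiv.mem_trans (PEquiv.mk (onPoints f) (onPoints (dagger f)) _)
      (PEquiv.mk (onPoints f') (onPoints (dagger f')) _) g k).symm
    refine (mem_onPoints _ _ _).trans ?_
    constructor
    · intro h
      obtain ⟨b, rfl⟩ := (pointEquiv n).surjective g
      obtain ⟨d, rfl⟩ := (pointEquiv _).surjective k
      have h1 := (ket_comp_iff (f ≫ f') b d).1 h
      rw [show Diag.eval (f ≫ f') (List.ofFn b) = _ from Diag.eval_comp f f' _,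
        Option.bind_eq_some_iff] at h1
      obtain ⟨l, h2, h3⟩ := h1
      obtain ⟨c, rfl, _⟩ := ket_comp f b h2
      exact ⟨pointEquiv m c, (mem_onPoints_ket f b c).2 h2, (mem_onPoints_ket f' c d).2 h3⟩
    · rintro ⟨c, h1, h2⟩
      rw [← Category.assoc, (mem_onPoints f g c).1 h1]
      exact (mem_onPoints f' c k).1 h2

theorem conj_comp {A B C A' B' C' : Type} (a : A ≃ A') (b : B ≃ B') (c : C ≃ C') (f : A' ≃. B')
    (g : B' ≃. C') : (a.toPEquiv.trans (f.trans g)).trans c.symm.toPEquiv =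
      ((a.toPEquiv.trans f).trans b.symm.toPEquiv).trans
        ((b.toPEquiv.trans g).trans c.symm.toPEquiv) := by
  have h : b.symm.toPEquiv.trans b.toPEquiv = PEquiv.refl B' := by
    rw [← Equiv.toPEquiv_trans]; simp
  simp only [PEquiv.trans_assoc]
  rw [← PEquiv.trans_assoc b.symm.toPEquiv, h, PEquiv.refl_trans]

/-- The functor `H̃₀ : TOF ⥤ FPinj₂`: the functor `H₀` with the set of total points of `n` identified
with `{0, 1}ⁿ`. -/
noncomputable def Htilde₀ : TOF ⥤ FPinj₂ where
  obj n := n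
  map {n m} f := InducedCategory.homMk
    (((pointEquiv n).toPEquiv.trans (H₀.map f)).trans (pointEquiv m).symm.toPEquiv)
  map_id n := by
    refine InducedCategory.hom_ext ?_
    rw [H₀.map_id]
    show ((pointEquiv n).toPEquiv.trans (PEquiv.refl _)).trans (pointEquiv n).symm.toPEquiv =
      PEquiv.refl _
    rw [PEquiv.trans_refl, ← Equiv.toPEquiv_trans]; simp
  map_comp {n m k} f f' := by
    refine InducedCategory.hom_ext ?_
    rw [H₀.map_comp]
    show ((pointEquiv n).toPEquiv.trans ((H₀.map f).trans (H₀.map f'))).trans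
        (pointEquiv k).symm.toPEquiv =
      (((pointEquiv n).toPEquiv.trans (H₀.map f)).trans (pointEquiv m).symm.toPEquiv).trans
        (((pointEquiv m).toPEquiv.trans (H₀.map f')).trans (pointEquiv k).symm.toPEquiv)
    exact conj_comp (pointEquiv n) (pointEquiv m) (pointEquiv k) (H₀.map f) (H₀.map f')

theorem H₀_map_dagger {n m : TOF} (f : n ⟶ m) : H₀.map (dagger f) = PEquiv.symm (H₀.map f) := by
  refine PEquiv.ext fun g => ?_
  rfl

/-- `H̃₀` preserves the restriction, hence restriction idempotents. -/
theorem Htilde₀_map_bar {n m : TOF} (f : n ⟶ m) :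
    Htilde₀.map (bar f) = FPinj₂.bar (Htilde₀.map f) := by
  refine InducedCategory.hom_ext ?_
  show ((pointEquiv n).toPEquiv.trans (H₀.map (f ≫ dagger f))).trans (pointEquiv n).symm.toPEquiv = _
  rw [H₀.map_comp, H₀_map_dagger]
  refine (conj_comp (pointEquiv n) (pointEquiv m) (pointEquiv n) (H₀.map f)
    (PEquiv.symm (H₀.map f))).trans ?_
  have h := PEquiv.self_trans_symm
    (((pointEquiv n).toPEquiv.trans (H₀.map f)).trans (pointEquiv m).symm.toPEquiv)
  refine Eq.trans ?_ (h.trans ?_)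
  · rfl
  · exact congrArg (fun d => @PEquiv.ofSet (Fin n → Bool)
      {x | (((((pointEquiv n).toPEquiv.trans (H₀.map f)).trans (pointEquiv m).symm.toPEquiv) :
        (Fin n → Bool) ≃. (Fin m → Bool)) x).isSome} d) (Subsingleton.elim _ _)

end TOF

end Toffoli

namespace Toffoli

namespace Diag

local infixl:70 " ⊚ " => Diag.comp
local notation:75 f:75 " ⊛ " g:76 => (Diag.tens f g :)

/-! ### Endomorphisms of `n` wires as a monoid (in diagrammatic order) -/

/-! Every restriction idempotent is brought to a normal form that is visibly determined by its
action on points. For a set `S` of bit words there is a circuit `filter N S`, built only from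
generators, acting as the partial identity on the words in `S`. Two facts suffice: each `f f°`
equals some filter (`isFilter_bar`), and a filter depends only on the values of `S` on words of
length `N`, which evaluation recovers (`IsFilter.eq_of_eval`). Faithfulness is then immediate.
Fullness holds because the domain of a partial identity is itself a table `S`, and `filter N S` is a
restriction idempotent, being a filter with the same values as its own restriction.

For `f f°` it is enough that `e ↦ f e f°` sends filters to filters for each generator `f` beside
idle wires (`ReflectsFilters`), starting from the identity, the filter of the full table. Wire
permutations rename wires, `|1⟩` fixes a letter of the word, `⟨1|` adds a condition on a letter, and
the Toffoli gate should substitute into the table. The last case is the heart of the proof.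

A filter is defined by a binary decision tree `E`. It carries a flag wire `y`; at each tested wire
`x` the gate `U y x a` splits the flag into `y` (when `x` carries 0) and a clean ancilla `a` (when
`x` carries 1), the two subtrees are applied to the two flags, and the splitting is undone. At a
leaf outside `S` the flag is projected onto 0. Reordering the tested wires rests on `U_U_U`:
splitting by two wires in either order agrees. Passing a Toffoli gate rests on `T_mul_split`: after
splitting by the two controls and the target, the gate only exchanges the two flags with both
controls equal to 1, that is, two leaves of the tree.

Both facts reduce to the not gate with three controls `K`, the commutator of two Toffoli gates
meeting at a borrowed wire. Comparing it with the circuit using a clean ancilla shows independence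
of the borrowed wire (`K_borrow`), and `Identity.tof16` gives full symmetry of the controls
(`K_symm_right`). Underneath lies the reduction of string diagrams to gates on named wires
(`place`), whose coherence is the Coxeter presentation of the symmetric group (`perms_coherence`).
-/

instance instMonoid (n : ℕ) : Monoid (Diag n n) where
  mul f g := f ⊚ g
  one := Diag.one n
  mul_assoc := Diag.assoc
  one_mul := Diag.one_comp
  mul_one := Diag.comp_one

theorem mul_def {n : ℕ} (f g : Diag n n) : f * g = f ⊚ g := rfl

/-- Placing endomorphisms above `r` further wires. -/
def above (n r : ℕ) : Diag n n →* Diag (n + r) (n + r) where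
  toFun f := f ⊛ (1 : Diag r r)
  map_one' := one_tens_one n r
  map_mul' f g := tens_one_comp f g r

/-- Placing endomorphisms below `r` further wires. -/
def below (r n : ℕ) : Diag n n →* Diag (r + n) (r + n) where
  toFun f := (1 : Diag r r) ⊛ f
  map_one' := one_tens_one r n
  map_mul' f g := one_tens_comp f g r

theorem above_apply {n : ℕ} (r : ℕ) (f : Diag n n) : above n r f = f ⊛ one r := rfl

theorem tens_eq_above_mul_below {a b : ℕ} (f : Diag a a) (g : Diag b b) :
    f ⊛ g = above a b f * below a b g := tens_split f g

theorem above_mul_below_comm {a b : ℕ} (f : Diag a a) (g : Diag b b) :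
    above a b f * below a b g = below a b g * above a b f :=
  (tens_split f g).symm.trans (tens_split' f g)

theorem above_succ {n r : ℕ} (f : Diag n n) :
    above n (r + 1) f = above (n + r) 1 (above n r f) := by
  show f ⊛ one (r + 1) = f ⊛ one r ⊛ one 1
  rw [← one_tens_one r 1]
  exact (tens_assoc f (one r) (one 1)).symm

theorem below_above {n r : ℕ} (f : Diag n n) :
    below r (n + 1) (above n 1 f) = above (r + n) 1 (below r n f) :=
  (tens_assoc (one r) f (one 1)).symm

/-! ### Adjacent transpositions -/

/-- The transposition of the wires `k` and `k + 1` of `N` wires. -/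
def sw : (N : ℕ) → ℕ → Diag N N
  -- Out-of-range indices `k + 1 ≥ N` end in the identity, so no bound has to be carried along.
  | 0, _ => 1
  | 1, _ => 1
  | N + 2, k => if k = N then below N 2 (mk (.swap 1 1)) else above (N + 1) 1 (sw (N + 1) k)

theorem sw_last (N : ℕ) : sw (N + 2) N = below N 2 (mk (.swap 1 1)) := if_pos rfl

theorem sw_succ {N k : ℕ} (h : k + 1 < N) : sw (N + 1) k = above N 1 (sw N k) := by
  cases N with
  | zero => omega
  | succ N => exact if_neg (by omega)

theorem sw_of_le {N k : ℕ} (h : N ≤ k + 1) : sw N k = 1 := by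
  induction N with
  | zero => rfl
  | succ N ih =>
    cases N with
    | zero => rfl
    | succ N =>
      refine (if_neg (by omega)).trans ?_
      rw [ih (by omega), map_one]

theorem sw_mul_self (N k : ℕ) : sw N k * sw N k = 1 := by
  induction N with
  | zero => exact one_mul _
  | succ N ih =>
    cases N with
    | zero => exact one_mul _
    | succ N =>
      by_cases h : k = N
      · subst h
        rw [sw_last, ← map_mul, show mk (.swap 1 1) * mk (.swap 1 1) = (1 : Diag 2 2) from swap_sq,
          map_one]
      · rw [show sw (N + 2) k = above (N + 1) 1 (sw (N + 1) k) from if_neg h, ← map_mul, ih, map_one]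

/-- Idle wires at the bottom are stripped until the lower transposition occupies the last two wires;
the other one then lies entirely above it. -/
theorem sw_comm {N k m : ℕ} (h : k + 1 < m) : sw N k * sw N m = sw N m * sw N k := by
  induction N with
  | zero => rfl
  | succ N ih =>
    cases N with
    | zero => rfl
    | succ N =>
      rcases lt_trichotomy m N with hm | rfl | hm
      · rw [sw_succ (k := k) (by omega), sw_succ (k := m) (by omega), ← map_mul, ih, map_mul]
      · obtain ⟨m, rfl⟩ : ∃ m', m = m' + 1 := ⟨m - 1, by omega⟩
        rw [sw_last, sw_succ (by omega), sw_succ (by omega)]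
        rw [← above_succ (r := 1)]
        exact above_mul_below_comm (a := m + 1) (b := 2) _ _
      · rw [sw_of_le (k := m) (by omega), mul_one, one_mul]

/-- The hexagon factors `swap 1 2` into adjacent swaps, and naturality slides `swap 1 1` through it;
comparing the two sides is the braid relation. -/
theorem yang_baxter : above 2 1 (mk (.swap 1 1)) * below 1 2 (mk (.swap 1 1)) * above 2 1 (mk (.swap 1 1)) =
    below 1 2 (mk (.swap 1 1)) * above 2 1 (mk (.swap 1 1)) * below 1 2 (mk (.swap 1 1)) := by
  have h : mk (.swap 1 2) = above 2 1 (mk (.swap 1 1)) * below 1 2 (mk (.swap 1 1)) :=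
    mk_eq (.hexagon 1 1 1)
  have h2 : below 1 2 (mk (.swap 1 1)) ⊚ mk (.swap 1 2) = mk (.swap 1 2) ⊚ above 2 1 (mk (.swap 1 1)) :=
    swap_natural (one 1) (mk (.swap 1 1))
  have h3 : below 1 2 (mk (.swap 1 1)) * mk (.swap 1 2) = mk (.swap 1 2) * above 2 1 (mk (.swap 1 1)) := h2
  rw [h] at h3
  rw [← h3, mul_assoc]

theorem below_assoc {n : ℕ} (r : ℕ) (f : Diag n n) :
    dcast (Nat.add_assoc r 1 n) (Nat.add_assoc r 1 n) (below (r + 1) n f) =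
      below r (1 + n) (below 1 n f) := by
  show dcast _ _ (one (r + 1) ⊛ f) = one r ⊛ (one 1 ⊛ f)
  rw [← one_tens_one r 1]
  exact tens_assoc (one r) (one 1) f

/-- Stripping idle bottom wires leaves the three last wires, where this is `yang_baxter`. -/
theorem sw_braid {N k : ℕ} (h : k + 2 < N) :
    sw N k * sw N (k + 1) * sw N k = sw N (k + 1) * sw N k * sw N (k + 1) := by
  induction N with
  | zero => omega
  | succ N ih =>
    rcases lt_or_ge (k + 2) N with hN | hN
    · rw [sw_succ (by omega), sw_succ (by omega), ← map_mul, ← map_mul, ih hN, map_mul, map_mul]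
    · obtain rfl : N = k + 2 := by omega
      have h1 : sw (k + 3) k = below k 3 (above 2 1 (mk (.swap 1 1))) := by
        rw [sw_succ (by omega), sw_last]
        exact (below_above _).symm
      have h2 : sw (k + 3) (k + 1) = below k 3 (below 1 2 (mk (.swap 1 1))) :=
        (sw_last (k + 1)).trans (below_assoc k (mk (.swap 1 1)))
      rw [show k + 2 + 1 = k + 3 from rfl, h1, h2, ← map_mul, ← map_mul, yang_baxter]
      simp only [map_mul]

/-! ### Wire permutations -/

/-- `f` permutes the wires by `σ`: the output wire `j` carries the input wire `σ j`. -/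
def Realizes {N : ℕ} (f : Diag N N) (σ : Equiv.Perm (Fin N)) : Prop :=
  ∀ b : Fin N → Bool, eval f (List.ofFn b) = some (List.ofFn (b ∘ σ))

theorem Realizes.one (N : ℕ) : Realizes (1 : Diag N N) 1 := fun b => eval_one (by simp)

/-- Since `σ` sends outputs to inputs, precomposition gives `b ∘ σ ∘ τ`; diagrammatic order thus
matches multiplication of permutations without an inverse. -/
theorem Realizes.mul {N : ℕ} {f g : Diag N N} {σ τ : Equiv.Perm (Fin N)} (hf : Realizes f σ)
    (hg : Realizes g τ) : Realizes (f * g) (σ * τ) := fun b => by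
  rw [mul_def, eval_comp, hf b, Option.bind_some, hg]; rfl

theorem Realizes.unique {N : ℕ} {f : Diag N N} {σ τ : Equiv.Perm (Fin N)} (h : Realizes f σ)
    (h' : Realizes f τ) : σ = τ := by
  refine Equiv.ext fun i => ?_
  -- The input with a single 1, on wire `σ i`, shows which input the output `i` carries.
  have h1 := (h fun j => decide (j = σ i)).symm.trans (h' _)
  have h2 := congrFun (List.ofFn_injective (Option.some.inj h1)) i
  exact Eq.symm (by simpa using h2)

/-- The permutation acting by `σ` on the first `a` and by `τ` on the last `b` wires. -/
def sumPerm {a b : ℕ} (σ : Equiv.Perm (Fin a)) (τ : Equiv.Perm (Fin b)) : Equiv.Perm (Fin (a + b)) :=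
  finSumFinEquiv.permCongr (Equiv.Perm.sumCongr σ τ)

theorem sumPerm_castAdd {a b : ℕ} (σ : Equiv.Perm (Fin a)) (τ : Equiv.Perm (Fin b)) (i : Fin a) :
    sumPerm σ τ (Fin.castAdd b i) = Fin.castAdd b (σ i) := by
  simp [sumPerm, Equiv.permCongr_apply]

theorem sumPerm_natAdd {a b : ℕ} (σ : Equiv.Perm (Fin a)) (τ : Equiv.Perm (Fin b)) (i : Fin b) :
    sumPerm σ τ (Fin.natAdd a i) = Fin.natAdd a (τ i) := by
  simp [sumPerm, Equiv.permCongr_apply]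

theorem Realizes.tens {a b : ℕ} {f : Diag a a} {g : Diag b b} {σ : Equiv.Perm (Fin a)}
    {τ : Equiv.Perm (Fin b)} (hf : Realizes f σ) (hg : Realizes g τ) :
    Realizes (f ⊛ g : Diag (a + b) (a + b)) (sumPerm σ τ) := fun c => by
  obtain ⟨x, y, rfl⟩ := exists_append c
  rw [List.ofFn_fin_append]
  refine (eval_tens f g (by simp) (by simp) (hf x) (hg y)).trans ?_
  rw [← List.ofFn_fin_append]
  congr 2
  funext i
  refine Fin.addCases (fun i => ?_) (fun i => ?_) i
  · simp [sumPerm_castAdd]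
  · simp [sumPerm_natAdd]

theorem Realizes.above {a b : ℕ} {f : Diag a a} {σ : Equiv.Perm (Fin a)} (hf : Realizes f σ) :
    Realizes (above a b f) (sumPerm σ 1) := hf.tens (Realizes.one b)

theorem Realizes.below {a b : ℕ} {f : Diag a a} {σ : Equiv.Perm (Fin a)} (hf : Realizes f σ) :
    Realizes (below b a f) (sumPerm 1 σ) := (Realizes.one b).tens hf

theorem realizes_swap : Realizes (mk (.swap 1 1)) (Equiv.swap 0 1) := fun b =>
  (eval_mk (.swap 1 1) (by simp)).trans (by simp [Circ.eval])

theorem sumPerm_swap_castAdd {a b : ℕ} (i j : Fin a) :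
    sumPerm (Equiv.swap i j) (1 : Equiv.Perm (Fin b)) = Equiv.swap (Fin.castAdd b i) (Fin.castAdd b j) := by
  refine Equiv.ext fun x => ?_
  refine Fin.addCases (fun x => ?_) (fun x => ?_) x
  · rw [sumPerm_castAdd, Equiv.swap_apply_def, Equiv.swap_apply_def]
    simp only [Fin.castAdd_inj]
    split_ifs <;> rfl
  · rw [sumPerm_natAdd, Equiv.swap_apply_of_ne_of_ne] <;> simp [Fin.ext_iff] <;> omega

theorem sumPerm_swap_natAdd {a b : ℕ} (i j : Fin b) :
    sumPerm (1 : Equiv.Perm (Fin a)) (Equiv.swap i j) = Equiv.swap (Fin.natAdd a i) (Fin.natAdd a j) := by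
  refine Equiv.ext fun x => ?_
  refine Fin.addCases (fun x => ?_) (fun x => ?_) x
  · rw [sumPerm_castAdd, Equiv.swap_apply_of_ne_of_ne] <;> simp [Fin.ext_iff] <;> omega
  · rw [sumPerm_natAdd, Equiv.swap_apply_def, Equiv.swap_apply_def]
    simp only [Fin.natAdd_inj]
    split_ifs <;> rfl

theorem realizes_sw {N k : ℕ} (h : k + 1 < N) :
    Realizes (sw N k) (Equiv.swap ⟨k, by omega⟩ ⟨k + 1, h⟩) := by
  induction N with
  | zero => omega
  | succ N ih =>
    rcases lt_or_ge (k + 1) N with hN | hN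
    · rw [sw_succ hN]
      have := (ih hN).above (b := 1)
      rwa [sumPerm_swap_castAdd] at this
    · obtain rfl : N = k + 1 := by omega
      rw [sw_last]
      have := realizes_swap.below (b := k)
      rwa [sumPerm_swap_natAdd] at this

/-- The wire permutations. -/
def perms (N : ℕ) : Submonoid (Diag N N) := Submonoid.closure (Set.range (sw N))

/-- Moves the last of `N + 1` wires up by `j` positions. -/
def moveUp (N : ℕ) : ℕ → Diag (N + 1) (N + 1)
  | 0 => 1
  | j + 1 => moveUp N j * sw (N + 1) (N - 1 - j)

theorem moveUp_sw_above {N j k : ℕ} (hk : k + 1 + j < N) :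
    moveUp N j * sw (N + 1) k = sw (N + 1) k * moveUp N j := by
  induction j with
  | zero => exact (one_mul _).trans (mul_one _).symm
  | succ j ih =>
    rw [moveUp, mul_assoc, ← sw_comm (by omega), ← mul_assoc, ih (by omega), mul_assoc]

/-- The wires crossed by the moving wire are pushed down by one, hence the index shift. The
transposition commutes with the last letters of `moveUp` until it meets the two adjacent ones, where
the braid relation applies. -/
theorem moveUp_sw_below {N j k : ℕ} (hj : j ≤ N) (hk : N < k + j) (hkN : k < N) :
    moveUp N j * sw (N + 1) k = sw (N + 1) (k - 1) * moveUp N j := by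
  induction j with
  | zero => omega
  | succ j ih =>
    rcases lt_or_ge N (k + j) with h | h
    · rw [moveUp, mul_assoc, sw_comm (k := N - 1 - j) (by omega), ← mul_assoc, ih (by omega) h, mul_assoc]
    -- Here `k + j = N`: the last two letters of `moveUp` have indices `k` and `k - 1`.
    · obtain ⟨i, rfl⟩ : ∃ i, k = i + 1 := ⟨k - 1, by omega⟩
      obtain ⟨j, rfl⟩ : ∃ i, j = i + 1 := ⟨j - 1, by omega⟩
      rw [moveUp, moveUp, show N - 1 - (j + 1) = i by omega, show N - 1 - j = i + 1 by omega]
      calc moveUp N j * sw (N + 1) (i + 1) * sw (N + 1) i * sw (N + 1) (i + 1)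
          = moveUp N j * (sw (N + 1) (i + 1) * sw (N + 1) i * sw (N + 1) (i + 1)) := by
            simp only [mul_assoc]
        _ = moveUp N j * sw (N + 1) i * (sw (N + 1) (i + 1) * sw (N + 1) i) := by
            rw [← sw_braid (by omega)]; simp only [mul_assoc]
        _ = _ := by rw [moveUp_sw_above (by omega)]; simp only [mul_assoc, Nat.add_sub_cancel]

/-- This is the decomposition of the symmetric group into cosets of the stabiliser of the last
point. Right multiplication by a transposition either passes through `moveUp` (with or without an
index shift) into the smaller group, or lengthens or shortens `moveUp` by one letter. -/
theorem perms_normal_form {N : ℕ} {f : Diag (N + 1) (N + 1)} (hf : f ∈ perms (N + 1)) :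
    ∃ u ∈ perms N, ∃ j ≤ N, f = above N 1 u * moveUp N j := by
  induction hf using Submonoid.closure_induction_right with
  | one => exact ⟨1, one_mem _, 0, by omega, by rw [map_one]; exact (one_mul _).symm⟩
  | mul_right f _ g hg ih =>
    obtain ⟨k, rfl⟩ := hg
    obtain ⟨u, hu, j, hj, rfl⟩ := ih
    have mem : ∀ k, u * sw N k ∈ perms N := fun k =>
      mul_mem hu (Submonoid.subset_closure ⟨k, rfl⟩)
    rcases le_or_gt N k with hk | hk
    · exact ⟨u, hu, j, hj, by rw [sw_of_le (by omega), mul_one]⟩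
    · rcases lt_trichotomy (k + 1 + j) N with h | h | h
      · exact ⟨_, mem k, j, hj, by
          rw [mul_assoc, moveUp_sw_above h, sw_succ (by omega), map_mul, mul_assoc]⟩
      · refine ⟨u, hu, j + 1, by omega, ?_⟩
        rw [moveUp, show N - 1 - j = k by omega, mul_assoc]
      · rcases lt_or_ge N (k + j) with h' | h'
        · exact ⟨_, mem (k - 1), j, hj, by
            rw [mul_assoc, moveUp_sw_below hj h' hk, sw_succ (by omega), map_mul, mul_assoc]⟩
        -- Here `k + j = N`, so the transposition is the last letter of `moveUp` and cancels it.
        · obtain ⟨j, rfl⟩ : ∃ i, j = i + 1 := ⟨j - 1, by omega⟩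
          refine ⟨u, hu, j, by omega, ?_⟩
          rw [moveUp, show N - 1 - j = k by omega, mul_assoc, mul_assoc, sw_mul_self, mul_one]

theorem exists_realizes {N : ℕ} {f : Diag N N} (hf : f ∈ perms N) : ∃ σ, Realizes f σ := by
  induction hf using Submonoid.closure_induction with
  | one => exact ⟨1, Realizes.one N⟩
  | mem f hf =>
    obtain ⟨k, rfl⟩ := hf
    rcases lt_or_ge (k + 1) N with h | h
    · exact ⟨_, realizes_sw h⟩
    · exact ⟨1, by rw [sw_of_le h]; exact Realizes.one N⟩
  | mul f g _ _ hf hg =>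
    obtain ⟨σ, hσ⟩ := hf
    obtain ⟨τ, hτ⟩ := hg
    exact ⟨_, hσ.mul hτ⟩

theorem exists_realizes_moveUp {N j : ℕ} (hj : j ≤ N) :
    ∃ γ : Equiv.Perm (Fin (N + 1)), Realizes (moveUp N j) γ ∧ γ ⟨N - j, by omega⟩ = Fin.last N := by
  induction j with
  | zero => exact ⟨1, Realizes.one _, rfl⟩
  | succ j ih =>
    obtain ⟨γ, h, h'⟩ := ih (by omega)
    refine ⟨_, h.mul (realizes_sw (N := N + 1) (k := N - 1 - j) (by omega)), ?_⟩
    have e : (⟨N - (j + 1), by omega⟩ : Fin (N + 1)) = ⟨N - 1 - j, by omega⟩ := by ext; simp; omega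
    rw [e, Equiv.Perm.mul_apply, Equiv.swap_apply_left, ← h']
    congr 2; omega

/-- Coherence: a wire permutation is determined by the permutation it realizes. -/
theorem perms_coherence {N : ℕ} {f g : Diag N N} (hf : f ∈ perms N) (hg : g ∈ perms N)
    {σ : Equiv.Perm (Fin N)} (h : Realizes f σ) (h' : Realizes g σ) : f = g := by
  induction N with
  | zero =>
    have : ∀ f ∈ perms 0, f = 1 := fun f hf => by
      induction hf using Submonoid.closure_induction with
      | one => rfl
      | mem f hf => obtain ⟨k, rfl⟩ := hf; exact sw_of_le (by omega)
      | mul f g _ _ hf hg => rw [hf, hg, mul_one]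
    rw [this f hf, this g hg]
  | succ N ih =>
    obtain ⟨u, hu, j, hj, rfl⟩ := perms_normal_form hf
    obtain ⟨v, hv, i, hi, rfl⟩ := perms_normal_form hg
    obtain ⟨τ, hτ⟩ := exists_realizes hu
    obtain ⟨τ', hτ'⟩ := exists_realizes hv
    obtain ⟨γ, hγ, e⟩ := exists_realizes_moveUp hj
    obtain ⟨γ', hγ', e'⟩ := exists_realizes_moveUp hi
    have h1 := h.unique (hτ.above.mul hγ)
    have h2 := h'.unique (hτ'.above.mul hγ')
    have key : ∀ τ : Equiv.Perm (Fin N), sumPerm τ 1 (Fin.last N) = Fin.last N := fun τ =>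
      sumPerm_natAdd τ (1 : Equiv.Perm (Fin 1)) 0
    have e1 : σ ⟨N - j, by omega⟩ = Fin.last N := by rw [h1, Equiv.Perm.mul_apply, e, key]
    have e2 : σ ⟨N - i, by omega⟩ = Fin.last N := by rw [h2, Equiv.Perm.mul_apply, e', key]
    -- The length of `moveUp` is visible in `σ`: output `N - j` carries the last input wire.
    obtain rfl : j = i := by
      have := congrArg Fin.val (σ.injective (e1.trans e2.symm))
      simp at this; omega
    obtain rfl := hγ.unique hγ'
    have h3 := mul_right_cancel (h1.symm.trans h2)
    have h4 : τ = τ' := by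
      refine Equiv.ext fun k => ?_
      have := congrArg (fun ρ => ρ (Fin.castAdd 1 k)) h3
      simpa [sumPerm_castAdd] using this
    subst h4
    rw [ih hu hv hτ hτ']

theorem exists_mem_perms {N : ℕ} (σ : Equiv.Perm (Fin N)) : ∃ f ∈ perms N, Realizes f σ := by
  cases N with
  | zero => exact ⟨1, one_mem _, by rw [Subsingleton.elim σ 1]; exact Realizes.one 0⟩
  | succ N =>
    have h : σ ∈ Submonoid.closure (Set.range fun i : Fin N ↦ Equiv.swap i.castSucc i.succ) := by
      rw [Equiv.Perm.mclosure_swap_castSucc_succ]; trivial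
    induction h using Submonoid.closure_induction with
    | one => exact ⟨1, one_mem _, Realizes.one _⟩
    | mem f hf =>
      obtain ⟨i, rfl⟩ := hf
      exact ⟨sw (N + 1) i, Submonoid.subset_closure ⟨i, rfl⟩, realizes_sw (by omega)⟩
    | mul σ τ _ _ hσ hτ =>
      obtain ⟨f, hf, hf'⟩ := hσ
      obtain ⟨g, hg, hg'⟩ := hτ
      exact ⟨f * g, mul_mem hf hg, hf'.mul hg'⟩

/-- The circuit permuting the wires by `σ`. -/
noncomputable def perm {N : ℕ} : Equiv.Perm (Fin N) →* Diag N N where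
  toFun σ := (exists_mem_perms σ).choose
  -- By coherence the choice of circuit does not matter, which makes it multiplicative.
  map_one' := perms_coherence (exists_mem_perms 1).choose_spec.1 (one_mem _)
    (exists_mem_perms 1).choose_spec.2 (Realizes.one N)
  map_mul' σ τ := perms_coherence (exists_mem_perms (σ * τ)).choose_spec.1
    (mul_mem (exists_mem_perms σ).choose_spec.1 (exists_mem_perms τ).choose_spec.1)
    (exists_mem_perms (σ * τ)).choose_spec.2
    ((exists_mem_perms σ).choose_spec.2.mul (exists_mem_perms τ).choose_spec.2)

theorem perm_mem {N : ℕ} (σ : Equiv.Perm (Fin N)) : perm σ ∈ perms N := (exists_mem_perms σ).choose_spec.1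

theorem perm_realizes {N : ℕ} (σ : Equiv.Perm (Fin N)) : Realizes (perm σ) σ :=
  (exists_mem_perms σ).choose_spec.2

theorem eq_perm {N : ℕ} {f : Diag N N} (hf : f ∈ perms N) {σ : Equiv.Perm (Fin N)}
    (h : Realizes f σ) : f = perm σ :=
  perms_coherence hf (perm_mem σ) h (perm_realizes σ)

theorem sw_mem (N k : ℕ) : sw N k ∈ perms N := Submonoid.subset_closure ⟨k, rfl⟩

theorem above_one_mem {N : ℕ} {f : Diag N N} (hf : f ∈ perms N) : above N 1 f ∈ perms (N + 1) := by
  induction hf using Submonoid.closure_induction with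
  | one => rw [map_one]; exact one_mem _
  | mem f hf =>
    obtain ⟨k, rfl⟩ := hf
    rcases lt_or_ge (k + 1) N with h | h
    · rw [← sw_succ h]; exact sw_mem _ _
    · rw [sw_of_le h, map_one]; exact one_mem _
  | mul f g _ _ hf hg => rw [map_mul]; exact mul_mem hf hg

theorem above_mem {N : ℕ} {f : Diag N N} (hf : f ∈ perms N) (r : ℕ) : above N r f ∈ perms (N + r) := by
  induction r with
  | zero => rw [above_apply, tens_one_zero]; exact hf
  | succ r ih => rw [above_succ]; exact above_one_mem ih

theorem below_sw (r : ℕ) {N k : ℕ} (h : k + 1 < N) : below r N (sw N k) = sw (r + N) (r + k) := by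
  induction N with
  | zero => omega
  | succ N ih =>
    rcases lt_or_ge (k + 1) N with h' | h'
    · rw [sw_succ h', below_above, ih h']; exact (sw_succ (by omega)).symm
    · obtain rfl : N = k + 1 := by omega
      rw [sw_last]
      refine Eq.trans ?_ (sw_last (r + k)).symm
      show one r ⊛ (one k ⊛ mk (.swap 1 1)) = one (r + k) ⊛ mk (.swap 1 1)
      rw [← one_tens_one r k]
      exact (tens_assoc (one r) (one k) (mk (.swap 1 1))).symm

theorem below_mem {N : ℕ} {f : Diag N N} (hf : f ∈ perms N) (r : ℕ) : below r N f ∈ perms (r + N) := by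
  induction hf using Submonoid.closure_induction with
  | one => rw [map_one]; exact one_mem _
  | mul f g _ _ hf hg => rw [map_mul]; exact mul_mem hf hg
  | mem f hf =>
    obtain ⟨k, rfl⟩ := hf
    rcases lt_or_ge (k + 1) N with h | h
    · rw [below_sw r h]; exact sw_mem _ _
    · rw [sw_of_le h, map_one]; exact one_mem _

theorem perm_above {N : ℕ} (σ : Equiv.Perm (Fin N)) (r : ℕ) :
    above N r (perm σ) = perm (sumPerm σ 1) :=
  eq_perm (above_mem (perm_mem σ) r) (perm_realizes σ).above

theorem perm_below {N : ℕ} (σ : Equiv.Perm (Fin N)) (r : ℕ) :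
    below r N (perm σ) = perm (sumPerm 1 σ) :=
  eq_perm (below_mem (perm_mem σ) r) (perm_realizes σ).below

theorem perm_swap_two : perm (Equiv.swap (0 : Fin 2) 1) = mk (.swap 1 1) := by
  refine (eq_perm ?_ realizes_swap).symm
  have := sw_mem 2 0
  rw [show sw 2 0 = below 0 2 (mk (.swap 1 1)) from sw_last 0] at this
  exact (zero_tens (mk (.swap 1 1))) ▸ this

/-- `f` is a wire permutation, up to transport. -/
def IsPerm {n m : ℕ} (f : Diag n m) : Prop := ∃ h : m = n, dcast rfl h f ∈ perms n

theorem IsPerm.comp {n m k : ℕ} {f : Diag n m} {g : Diag m k} (hf : IsPerm f) (hg : IsPerm g) :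
    IsPerm (f ⊚ g) := by
  obtain ⟨rfl, hf⟩ := hf
  obtain ⟨rfl, hg⟩ := hg
  exact ⟨rfl, mul_mem hf hg⟩

theorem IsPerm.tens {a b c d : ℕ} {f : Diag a b} {g : Diag c d} (hf : IsPerm f) (hg : IsPerm g) :
    IsPerm (f ⊛ g) := by
  obtain ⟨rfl, hf⟩ := hf
  obtain ⟨rfl, hg⟩ := hg
  refine ⟨rfl, ?_⟩
  show f ⊛ g ∈ _
  rw [tens_eq_above_mul_below]
  exact mul_mem (above_mem hf _) (below_mem hg _)

theorem IsPerm.one (n : ℕ) : IsPerm (Diag.one n) := ⟨rfl, one_mem _⟩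

theorem IsPerm.dcast {a b a' b' : ℕ} {f : Diag a b} (h : a = a') (h' : b = b') (hf : IsPerm f) :
    IsPerm (dcast h h' f) := by
  subst h; subst h'; exact hf

theorem IsPerm.of_dcast {a b a' b' : ℕ} {f : Diag a b} {h : a = a'} {h' : b = b'}
    (hf : IsPerm (Diag.dcast h h' f)) : IsPerm f := by
  subst h; subst h'; exact hf

theorem dcast_dcast {a b a' b' a'' b'' : ℕ} (h : a = a') (h' : b = b') (k : a' = a'') (k' : b' = b'')
    (f : Diag a b) : dcast k k' (dcast h h' f) = dcast (h.trans k) (h'.trans k') f := by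
  subst h; subst h'; rfl

/-- The hexagon with two empty factors makes this symmetry idempotent, up to transport along `0 + a
= a`; being invertible it is an identity. -/
theorem isPerm_swap_zero (a : ℕ) : IsPerm (mk (.swap a 0)) := by
  obtain ⟨s, hs⟩ : ∃ s : Diag (a + 0) (0 + a), s = mk (.swap a 0) := ⟨_, rfl⟩
  have e := mk_eq (.hexagon a 0 0)
  rw [mk_cast, mk_comp, mk_cast, mk_tensor, mk_tensor] at e
  replace e : dcast _ _ s = dcast _ _ (s ⊛ one 0) ⊚ (one 0 ⊛ s) := hs ▸ e
  have inv : s ⊚ mk (.swap 0 a) = one a := hs ▸ mk_eq (.swap_swap a 0)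
  have h0 : 0 + a = a := Nat.zero_add a
  have e' := congrArg (dcast (show a + 0 + 0 = a from rfl) (show 0 + (0 + a) = a by omega)) e
  rw [dcast_dcast, ← dcast_comp (a' := a) (b' := a) rfl (show 0 + (a + 0) = a by omega) (by omega),
    dcast_dcast, tens_one_zero] at e'
  have hz := congrArg (dcast (show a + 0 = a from rfl) h0) (zero_tens s)
  rw [dcast_dcast] at hz
  have e2 : dcast rfl h0 s = dcast rfl h0 s ⊚ dcast rfl h0 s := e'.trans (congrArg _ hz)
  have inv' : dcast rfl h0 s ⊚ dcast h0 rfl (mk (.swap 0 a)) = one a :=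
    (dcast_comp rfl h0 rfl s (mk (.swap 0 a))).trans inv
  refine ⟨h0, ?_⟩
  have : dcast rfl h0 s = one a := by
    calc dcast rfl h0 s = dcast rfl h0 s ⊚ (dcast rfl h0 s ⊚ dcast h0 rfl (mk (.swap 0 a))) := by
          rw [inv', comp_one]
      _ = _ := by rw [← assoc, ← e2, inv']
  rw [← hs]
  exact this ▸ one_mem _

theorem perm_inv_of_comp_eq_one {n m : ℕ} {f : Diag n m} {g : Diag m n} (hf : IsPerm f)
    (h : f ⊚ g = Diag.one n) : IsPerm g := by
  obtain ⟨rfl, hf⟩ := hf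
  refine ⟨rfl, ?_⟩
  obtain ⟨σ, hσ⟩ := exists_realizes hf
  have h1 : f = perm σ := eq_perm hf hσ
  have h2 : f * g = 1 := h
  have : g = perm σ⁻¹ := by
    calc g = perm σ⁻¹ * (perm σ * g) := by rw [← mul_assoc, ← map_mul]; simp
      _ = perm σ⁻¹ := by rw [← h1, h2, mul_one]
  show g ∈ _
  rw [this]; exact perm_mem _

theorem isPerm_swap_one_one : IsPerm (mk (.swap 1 1)) := ⟨rfl, by
  show mk (.swap 1 1) ∈ _
  rw [← perm_swap_two]; exact perm_mem _⟩

theorem isPerm_swap_add {a b c : ℕ} (h : IsPerm (mk (.swap a b))) (h' : IsPerm (mk (.swap a c))) :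
    IsPerm (mk (.swap a (b + c))) := by
  have e := mk_eq (.hexagon a b c)
  rw [mk_cast, mk_comp, mk_cast] at e
  refine IsPerm.of_dcast (h := (Nat.add_assoc a b c).symm) (h' := Nat.add_assoc b c a) ?_
  rw [e]
  exact ((h.tens (IsPerm.one c)).dcast _ _).comp ((IsPerm.one b).tens h')

theorem isPerm_swap_symm {a b : ℕ} (h : IsPerm (mk (.swap a b))) : IsPerm (mk (.swap b a)) :=
  perm_inv_of_comp_eq_one h (mk_eq (.swap_swap a b))

theorem isPerm_swap (a b : ℕ) : IsPerm (mk (.swap a b)) := by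
  have h1 : ∀ b, IsPerm (mk (.swap 1 b)) := fun b => by
    induction b with
    | zero => exact isPerm_swap_zero 1
    | succ b ih => exact isPerm_swap_add ih isPerm_swap_one_one
  induction b with
  | zero => exact isPerm_swap_zero a
  -- The crossing with one further wire is the inverse of `swap 1 a`, already treated.
  | succ b ih => exact isPerm_swap_add ih (isPerm_swap_symm (h1 a))

/-! ### Gates on named wires -/

/-- In a finite type the bijection between the two ranges extends to the complements. -/
theorem exists_perm_comp_eq {α β : Type*} [Fintype β] [DecidableEq β] {f g : α → β}
    (hf : Function.Injective f) (hg : Function.Injective g) : ∃ π : Equiv.Perm β, ∀ i, π (f i) = g i := by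
  classical
  let e : {x // x ∈ Set.range f} ≃ {x // x ∈ Set.range g} :=
    (Equiv.ofInjective f hf).symm.trans (Equiv.ofInjective g hg)
  refine ⟨e.extendSubtype, fun i => ?_⟩
  rw [Equiv.extendSubtype_apply_of_mem _ _ ⟨i, rfl⟩]
  simp [e]

theorem exists_perm_extension {k N : ℕ} {σ : Fin k → Fin N} (hσ : Function.Injective σ) :
    ∃ (r : ℕ) (e : k + r = N) (π : Equiv.Perm (Fin (k + r))),
      (fun i => Fin.cast e (π (Fin.castAdd r i))) = σ := by
  have hk : k ≤ N := by simpa using Fintype.card_le_of_injective σ hσ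
  obtain ⟨r, rfl⟩ := Nat.exists_eq_add_of_le hk
  obtain ⟨π, h⟩ := exists_perm_comp_eq (Fin.castAdd_injective k r) hσ
  exact ⟨r, rfl, π, funext h⟩

theorem eq_sumPerm_of_fixes {a b : ℕ} {ρ : Equiv.Perm (Fin (a + b))}
    (h : ∀ i : Fin a, ρ (Fin.castAdd b i) = Fin.castAdd b i) :
    ∃ τ : Equiv.Perm (Fin b), ρ = sumPerm 1 τ := by
  have h1 : finSumFinEquiv.symm.permCongr ρ ∈ (Equiv.Perm.sumCongrHom (Fin a) (Fin b)).range := by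
    apply Equiv.Perm.mem_sumCongrHom_range_of_perm_mapsTo_inl
    rintro _ ⟨i, rfl⟩
    exact ⟨i, by simp [Equiv.permCongr_apply, h]⟩
  obtain ⟨⟨σ, τ⟩, hστ⟩ := h1
  have h2 : ρ = sumPerm σ τ := by
    unfold sumPerm
    rw [show Equiv.Perm.sumCongr σ τ = finSumFinEquiv.symm.permCongr ρ from hστ]
    ext x; simp [Equiv.permCongr_apply]
  refine ⟨τ, ?_⟩
  have : σ = 1 := Equiv.ext fun i => by
    have := h i
    rw [h2, sumPerm_castAdd] at this
    simpa using this
  rw [h2, this]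

/-- Two permutations agreeing on the first `k` wires differ by one acting on the other `r` wires,
and that one commutes with `g`. Hence placing a gate depends only on the names of the wires it
touches. -/
theorem perm_conj_above_congr {k r : ℕ} {π ρ : Equiv.Perm (Fin (k + r))} (g : Diag k k)
    (h : ∀ i, π (Fin.castAdd r i) = ρ (Fin.castAdd r i)) :
    perm π * above k r g * perm π⁻¹ = perm ρ * above k r g * perm ρ⁻¹ := by
  obtain ⟨τ, hτ⟩ := eq_sumPerm_of_fixes (ρ := ρ⁻¹ * π) (fun i => by
    rw [Equiv.Perm.mul_apply, h]; simp)
  obtain rfl : π = ρ * sumPerm 1 τ := by rw [← hτ, mul_inv_cancel_left]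
  have h1 : perm (sumPerm (1 : Equiv.Perm (Fin k)) τ) * perm (sumPerm 1 τ)⁻¹ = 1 := by
    rw [← map_mul, mul_inv_cancel, map_one]
  have h2 : perm (sumPerm (1 : Equiv.Perm (Fin k)) τ) * above k r g =
      above k r g * perm (sumPerm 1 τ) := by
    rw [← perm_below, above_mul_below_comm]
  rw [mul_inv_rev, map_mul, map_mul, mul_assoc (perm ρ), h2]
  calc _ = perm ρ * above k r g * (perm (sumPerm 1 τ) * perm (sumPerm 1 τ)⁻¹) * perm ρ⁻¹ := by
        simp only [mul_assoc]
    _ = _ := by rw [h1, mul_one]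

/-- `x` is the endomorphism `g` acting on the wires `σ 0, …, σ (k - 1)`. -/
def IsPlacement {k N : ℕ} (σ : Fin k → Fin N) (g : Diag k k) (x : Diag N N) : Prop :=
  ∃ (r : ℕ) (e : k + r = N) (π : Equiv.Perm (Fin (k + r))),
    (fun i => Fin.cast e (π (Fin.castAdd r i))) = σ ∧
      x = dcast e e (perm π * above k r g * perm π⁻¹)

theorem IsPlacement.unique {k N : ℕ} {σ : Fin k → Fin N} {g : Diag k k} {x y : Diag N N}
    (hx : IsPlacement σ g x) (hy : IsPlacement σ g y) : x = y := by
  obtain ⟨r, rfl, π, h, rfl⟩ := hx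
  obtain ⟨r', e, ρ, h', rfl⟩ := hy
  obtain rfl : r' = r := by omega
  exact perm_conj_above_congr g fun i => (congrFun h i).trans (congrFun h' i).symm

open Classical in
/-- The endomorphism `g` acting on the distinct wires `σ 0, …, σ (k - 1)` among `N` wires. -/
noncomputable def placeFun {k N : ℕ} (σ : Fin k → Fin N) (g : Diag k k) : Diag N N :=
  -- Repeated wires give the identity, so that `place σ` is a homomorphism for every `σ` and
  -- degenerate gates satisfy many relations for free.
  if h : ∃ x, IsPlacement σ g x then h.choose else 1

theorem IsPlacement.eq {k N : ℕ} {σ : Fin k → Fin N} {g : Diag k k} {x : Diag N N}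
    (h : IsPlacement σ g x) : placeFun σ g = x := by
  have h' : ∃ x, IsPlacement σ g x := ⟨x, h⟩
  rw [placeFun, dif_pos h']
  exact h'.choose_spec.unique h

theorem placeFun_perm {k r : ℕ} (π : Equiv.Perm (Fin (k + r))) (g : Diag k k) :
    placeFun (fun i => π (Fin.castAdd r i)) g = perm π * above k r g * perm π⁻¹ :=
  IsPlacement.eq ⟨r, rfl, π, rfl, rfl⟩

theorem placeFun_of_not_injective {k N : ℕ} {σ : Fin k → Fin N} (h : ¬ Function.Injective σ)
    (g : Diag k k) : placeFun σ g = 1 := by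
  refine dif_neg ?_
  rintro ⟨x, r, rfl, π, rfl, -⟩
  exact h (π.injective.comp (Fin.castAdd_injective k r))

/-- The endomorphisms of `k` wires acting on the distinct wires `σ 0, …, σ (k - 1)` among `N`
wires (and trivially if these are not distinct). -/
noncomputable def place {k N : ℕ} (σ : Fin k → Fin N) : Diag k k →* Diag N N where
  toFun := placeFun σ
  map_one' := by
    by_cases hσ : Function.Injective σ
    · obtain ⟨r, rfl, π, rfl⟩ := exists_perm_extension hσ
      refine (placeFun_perm π 1).trans ?_
      rw [map_one, mul_one, ← map_mul, mul_inv_cancel, map_one]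
    · exact placeFun_of_not_injective hσ 1
  map_mul' f g := by
    by_cases hσ : Function.Injective σ
    · obtain ⟨r, rfl, π, rfl⟩ := exists_perm_extension hσ
      have h1 : perm π⁻¹ * perm π = 1 := by rw [← map_mul, inv_mul_cancel, map_one]
      refine (placeFun_perm π _).trans (Eq.trans ?_ (congrArg₂ (· * ·) (placeFun_perm π f).symm
        (placeFun_perm π g).symm))
      rw [map_mul]
      calc _ = perm π * above k r f * (perm π⁻¹ * perm π) * above k r g * perm π⁻¹ := by
            rw [h1, mul_one]; simp only [mul_assoc]
        _ = _ := by simp only [mul_assoc]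
    · simp only [placeFun_of_not_injective hσ, mul_one]

theorem place_perm {k r : ℕ} (π : Equiv.Perm (Fin (k + r))) (g : Diag k k) :
    place (fun i => π (Fin.castAdd r i)) g = perm π * above k r g * perm π⁻¹ := placeFun_perm π g

theorem place_of_not_injective {k N : ℕ} {σ : Fin k → Fin N} (h : ¬ Function.Injective σ)
    (g : Diag k k) : place σ g = 1 := placeFun_of_not_injective h g

theorem perm_mul_perm_inv {N : ℕ} (π : Equiv.Perm (Fin N)) : perm π * perm π⁻¹ = 1 := by
  rw [← map_mul, mul_inv_cancel, map_one]

theorem perm_inv_mul_perm {N : ℕ} (π : Equiv.Perm (Fin N)) : perm π⁻¹ * perm π = 1 := by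
  rw [← map_mul, inv_mul_cancel, map_one]

theorem perm_conj_place {k N : ℕ} (π : Equiv.Perm (Fin N)) (σ : Fin k → Fin N) (g : Diag k k) :
    perm π * place σ g * perm π⁻¹ = place (fun i => π (σ i)) g := by
  by_cases hσ : Function.Injective σ
  · obtain ⟨r, rfl, ρ, rfl⟩ := exists_perm_extension hσ
    refine Eq.trans ?_ (place_perm (π * ρ) g).symm
    simp only [Fin.cast_eq_self]
    rw [place_perm ρ g, mul_inv_rev, map_mul, map_mul]
    simp only [mul_assoc]
  · rw [place_of_not_injective hσ, mul_one, perm_mul_perm_inv, place_of_not_injective]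
    exact fun h => hσ h.of_comp

theorem perm_mul_place {k N : ℕ} (π : Equiv.Perm (Fin N)) (σ : Fin k → Fin N) (g : Diag k k) :
    perm π * place σ g = place (fun i => π (σ i)) g * perm π := by
  rw [← perm_conj_place, mul_assoc, mul_assoc, perm_inv_mul_perm, mul_one]

theorem place_castSucc {k N : ℕ} (σ : Fin k → Fin N) (g : Diag k k) :
    place (fun i => (σ i).castSucc) g = above N 1 (place σ g) := by
  by_cases hσ : Function.Injective σ
  · obtain ⟨r, rfl, π, rfl⟩ := exists_perm_extension hσ
    rw [show place (fun i => Fin.cast rfl (π (Fin.castAdd r i))) g = _ from place_perm π g, map_mul,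
      map_mul, perm_above, perm_above, ← above_succ]
    have h := place_perm (r := r + 1) (sumPerm (b := 1) π 1 : Equiv.Perm (Fin (k + r + 1))) g
    refine Eq.trans ?_ (h.trans ?_)
    · refine congrArg (fun σ => place σ g) (funext fun i => ?_)
      exact (sumPerm_castAdd π 1 (Fin.castAdd r i)).symm
    · congr 2
  · rw [place_of_not_injective hσ, map_one, place_of_not_injective]
    exact fun h => hσ (h.of_comp (f := Fin.castSucc))

theorem place_castAdd {k N : ℕ} (r : ℕ) (σ : Fin k → Fin N) (g : Diag k k) :
    place (fun i => Fin.castAdd r (σ i)) g = above N r (place σ g) := by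
  induction r with
  | zero => exact (tens_one_zero _).symm
  | succ r ih =>
    rw [above_succ, ← ih]
    exact place_castSucc (fun i => Fin.castAdd r (σ i)) g

theorem place_id {k : ℕ} (g : Diag k k) : place id g = g := by
  have h := place_perm (r := 0) (1 : Equiv.Perm (Fin (k + 0))) g
  rw [inv_one, map_one, one_mul, mul_one] at h
  exact h.trans (tens_one_zero g)

theorem place_castAdd_id {k : ℕ} (r : ℕ) (g : Diag k k) :
    place (Fin.castAdd r) g = above k r g :=
  (place_castAdd r id g).trans (congrArg _ (place_id g))

/-- This is what transports a relation between gates on a few numbered wires to arbitrary distinct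
wires. -/
theorem place_place {k l N : ℕ} {σ : Fin l → Fin N} (hσ : Function.Injective σ) (τ : Fin k → Fin l)
    (g : Diag k k) : place σ (place τ g) = place (fun i => σ (τ i)) g := by
  obtain ⟨r, rfl, π, rfl⟩ := exists_perm_extension hσ
  simp only [Fin.cast_eq_self]
  rw [place_perm π, ← place_castAdd, perm_conj_place]

theorem eval_dcast {a b a' b' : ℕ} (h : a = a') (h' : b = b') (f : Diag a b) :
    eval (dcast h h' f) = eval f := by subst h; subst h'; rfl

/-- Naturality of `swap k r` moves the gate from the first wires to the last ones; it remains to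
identify the permutation realized by that symmetry. -/
theorem place_natAdd {k : ℕ} (r : ℕ) (g : Diag k k) : place (Fin.natAdd r) g = below r k g := by
  have e : r + k = k + r := Nat.add_comm r k
  obtain ⟨h, hs⟩ := isPerm_swap k r
  obtain ⟨β, hβ⟩ := exists_realizes hs
  have hs' := eq_perm hs hβ
  have nat := swap_natural g (one r)
  have nat' : above k r g * perm β = perm β * dcast e e (below r k g) := by
    have h1 := congrArg (dcast (show k + r = k + r from rfl) e) nat
    rw [← dcast_comp rfl rfl e, ← dcast_comp rfl e e] at h1
    rw [← hs']
    exact h1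
  have hβi : ∀ i : Fin k, β (Fin.cast e (Fin.natAdd r i)) = Fin.castAdd r i := fun i => by
    -- A single 1 on input wire `i` reappears at position `r + i` of the output list.
    have h1 := hβ fun j => decide (j = Fin.castAdd r i)
    rw [eval_dcast, eval_mk _ (by simp)] at h1
    simp only [Circ.eval, Option.some.injEq] at h1
    have h2 := congrArg (fun l => l[r + (i : ℕ)]?) h1
    simp only [List.getElem?_append, List.getElem?_ofFn, List.length_drop, List.length_ofFn] at h2
    simp at h2
    exact h2.2.1 rfl
  refine IsPlacement.eq ⟨r, e.symm, β⁻¹, ?_, ?_⟩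
  · funext i
    have := congrArg β.symm (hβi i)
    rw [Equiv.symm_apply_apply] at this
    show Fin.cast _ (β.symm _) = _
    rw [← this]; rfl
  · rw [inv_inv, mul_assoc, nat', ← mul_assoc, perm_inv_mul_perm, one_mul, dcast_dcast]; rfl

/-- Disjoint families of wires assemble into one injective family, on which the gates sit above and
below each other. -/
theorem place_comm {k l N : ℕ} {σ : Fin k → Fin N} {τ : Fin l → Fin N} (h : ∀ i j, σ i ≠ τ j)
    (f : Diag k k) (g : Diag l l) : place σ f * place τ g = place τ g * place σ f := by
  by_cases hσ : Function.Injective σ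
  · by_cases hτ : Function.Injective τ
    · have hi : Function.Injective (Fin.append σ τ) := Fin.append_injective_iff.2 ⟨hσ, hτ, h⟩
      have h1 : place σ f = place (Fin.append σ τ) (above k l f) := by
        rw [← place_castAdd_id, place_place hi]; simp
      have h2 : place τ g = place (Fin.append σ τ) (below k l g) := by
        rw [← place_natAdd, place_place hi]; simp
      rw [h1, h2, ← map_mul, above_mul_below_comm, map_mul]
    · rw [place_of_not_injective hτ, mul_one, one_mul]
  · rw [place_of_not_injective hσ, mul_one, one_mul]

/-! ### The horizontal flip -/

theorem dagger_mul {n : ℕ} (f g : Diag n n) : dagger (f * g) = dagger g * dagger f :=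
  Quotient.inductionOn₂ f g fun _ _ => rfl

theorem dagger_comp {n m k : ℕ} (f : Diag n m) (g : Diag m k) : dagger (f ⊚ g) = dagger g ⊚ dagger f :=
  Quotient.inductionOn₂ f g fun _ _ => rfl

theorem dagger_tens {a b c d : ℕ} (f : Diag a b) (g : Diag c d) :
    dagger (f ⊛ g) = dagger f ⊛ dagger g :=
  Quotient.inductionOn₂ f g fun _ _ => rfl

theorem dagger_one (n : ℕ) : dagger (1 : Diag n n) = 1 := rfl

theorem dagger_above {n r : ℕ} (f : Diag n n) : dagger (above n r f) = above n r (dagger f) :=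
  dagger_tens f _

theorem dagger_below {n r : ℕ} (f : Diag n n) : dagger (below r n f) = below r n (dagger f) :=
  dagger_tens (one r) f

theorem dagger_sw (N k : ℕ) : dagger (sw N k) = sw N k := by
  induction N with
  | zero => rfl
  | succ N ih =>
    rcases lt_trichotomy (k + 1) N with h | rfl | h
    · rw [sw_succ h, dagger_above, ih]
    · rw [sw_last, dagger_below]; rfl
    · rw [sw_of_le (by omega)]; rfl

theorem dagger_mem_perms {N : ℕ} {f : Diag N N} (hf : f ∈ perms N) : dagger f ∈ perms N := by
  induction hf using Submonoid.closure_induction with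
  | one => exact one_mem _
  | mem f hf => obtain ⟨k, rfl⟩ := hf; rw [dagger_sw]; exact sw_mem N k
  | mul f g _ _ hf hg => rw [dagger_mul]; exact mul_mem hg hf

theorem dagger_perm {N : ℕ} (π : Equiv.Perm (Fin N)) : dagger (perm π) = perm π⁻¹ := by
  refine eq_perm (dagger_mem_perms (perm_mem π)) fun b => ?_
  rw [← eval_dagger]
  refine (perm_realizes π _).trans ?_
  congr 2
  funext i
  simp

theorem dagger_place {k N : ℕ} (σ : Fin k → Fin N) (g : Diag k k) :
    dagger (place σ g) = place σ (dagger g) := by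
  by_cases hσ : Function.Injective σ
  · obtain ⟨r, rfl, π, rfl⟩ := exists_perm_extension hσ
    simp only [Fin.cast_eq_self]
    rw [place_perm, place_perm, dagger_mul, dagger_mul, dagger_perm, dagger_perm, dagger_above, inv_inv,
      mul_assoc]
  · rw [place_of_not_injective hσ, place_of_not_injective hσ, dagger_one]

/-! ### Elementary gates on named wires -/

/-- The projection `⟨b| |b⟩` of one wire. -/
def proj (b : Bool) : Diag 1 1 := dagger (bit b) ⊚ bit b

/-- The not gate on the wire `i`. -/
noncomputable def X {N : ℕ} (i : Fin N) : Diag N N := place ![i] (mk Circ.not)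

/-- The projection of the wire `i` onto `b`. -/
noncomputable def Q {N : ℕ} (b : Bool) (i : Fin N) : Diag N N := place ![i] (proj b)

/-- Exchanging the wires `i` and `j`. -/
noncomputable def S {N : ℕ} (i j : Fin N) : Diag N N := place ![i, j] (mk (.swap 1 1))

/-- The controlled not gate with control `i` and target `j`. -/
noncomputable def C {N : ℕ} (i j : Fin N) : Diag N N := place ![i, j] (mk Circ.cnot)

/-- The Toffoli gate with controls `i`, `j` and target `k`. -/
noncomputable def T {N : ℕ} (i j k : Fin N) : Diag N N := place ![i, j, k] (mk Circ.tof)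

theorem comp_vec_one {α β : Type*} (σ : α → β) (i : α) : (fun a => σ (![i] a)) = ![σ i] := by
  funext a; fin_cases a; rfl

theorem comp_vec_two {α β : Type*} (σ : α → β) (i j : α) : (fun a => σ (![i, j] a)) = ![σ i, σ j] := by
  funext a; fin_cases a <;> rfl

theorem comp_vec_three {α β : Type*} (σ : α → β) (i j k : α) :
    (fun a => σ (![i, j, k] a)) = ![σ i, σ j, σ k] := by
  funext a; fin_cases a <;> rfl

theorem place_X {N M : ℕ} {σ : Fin N → Fin M} (hσ : Function.Injective σ) (i : Fin N) :
    place σ (X i) = X (σ i) := by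
  rw [X, place_place hσ, comp_vec_one]; rfl

theorem place_Q {N M : ℕ} {σ : Fin N → Fin M} (hσ : Function.Injective σ) (b : Bool) (i : Fin N) :
    place σ (Q b i) = Q b (σ i) := by
  rw [Q, place_place hσ, comp_vec_one]; rfl

theorem place_S {N M : ℕ} {σ : Fin N → Fin M} (hσ : Function.Injective σ) (i j : Fin N) :
    place σ (S i j) = S (σ i) (σ j) := by
  rw [S, place_place hσ, comp_vec_two]; rfl

theorem place_C {N M : ℕ} {σ : Fin N → Fin M} (hσ : Function.Injective σ) (i j : Fin N) :
    place σ (C i j) = C (σ i) (σ j) := by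
  rw [C, place_place hσ, comp_vec_two]; rfl

theorem place_T {N M : ℕ} {σ : Fin N → Fin M} (hσ : Function.Injective σ) (i j k : Fin N) :
    place σ (T i j k) = T (σ i) (σ j) (σ k) := by
  rw [T, place_place hσ, comp_vec_three]; rfl

theorem perm_conj_X {N : ℕ} (π : Equiv.Perm (Fin N)) (i : Fin N) :
    perm π * X i * perm π⁻¹ = X (π i) := by
  rw [X, perm_conj_place, comp_vec_one]; rfl

theorem perm_conj_Q {N : ℕ} (π : Equiv.Perm (Fin N)) (b : Bool) (i : Fin N) :
    perm π * Q b i * perm π⁻¹ = Q b (π i) := by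
  rw [Q, perm_conj_place, comp_vec_one]; rfl

theorem perm_conj_C {N : ℕ} (π : Equiv.Perm (Fin N)) (i j : Fin N) :
    perm π * C i j * perm π⁻¹ = C (π i) (π j) := by
  rw [C, perm_conj_place, comp_vec_two]; rfl

theorem perm_conj_T {N : ℕ} (π : Equiv.Perm (Fin N)) (i j k : Fin N) :
    perm π * T i j k * perm π⁻¹ = T (π i) (π j) (π k) := by
  rw [T, perm_conj_place, comp_vec_three]; rfl

theorem injective_vec_two {α : Type*} {i j : α} (h : i ≠ j) : Function.Injective ![i, j] := by
  intro a b; fin_cases a <;> fin_cases b <;> simp [h, h.symm]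

/-- Products of swaps can now be computed in the symmetric group. -/
theorem S_eq_perm {N : ℕ} (i j : Fin N) : S i j = perm (Equiv.swap i j) := by
  by_cases h : i = j
  · subst h
    rw [Equiv.swap_self, show perm (Equiv.refl (Fin N)) = 1 from map_one perm]
    exact place_of_not_injective (fun h => by simpa using @h 0 1 rfl) _
  · obtain ⟨r, rfl, π, e⟩ := exists_perm_extension (injective_vec_two h)
    simp only [Fin.cast_eq_self] at e
    have h0 : π (Fin.castAdd r 0) = i := congrFun e 0
    have h1 : π (Fin.castAdd r 1) = j := congrFun e 1
    rw [S, ← e, place_perm, ← perm_swap_two, perm_above, sumPerm_swap_castAdd, ← map_mul, ← map_mul,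
      ← h0, ← h1, Equiv.mul_swap_eq_swap_mul, mul_inv_cancel_right]

theorem dagger_X {N : ℕ} (i : Fin N) : dagger (X i) = X i :=
  (dagger_place _ _).trans (congrArg _ dagger_not)

theorem dagger_proj (b : Bool) : dagger (proj b) = proj b := by
  rw [proj, dagger_comp, dagger_dagger]

theorem dagger_Q {N : ℕ} (b : Bool) (i : Fin N) : dagger (Q b i) = Q b i :=
  (dagger_place _ _).trans (congrArg _ (dagger_proj b))

theorem dagger_S {N : ℕ} (i j : Fin N) : dagger (S i j) = S i j := dagger_place _ _

theorem dagger_C {N : ℕ} (i j : Fin N) : dagger (C i j) = C i j :=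
  (dagger_place _ _).trans (congrArg _ dagger_cnot)

theorem dagger_T {N : ℕ} (i j k : Fin N) : dagger (T i j k) = T i j k := dagger_place _ _

theorem X_sq {N : ℕ} (i : Fin N) : X i * X i = 1 := by
  rw [X, ← map_mul, show mk Circ.not * mk Circ.not = 1 from not_sq, map_one]

theorem C_sq {N : ℕ} (i j : Fin N) : C i j * C i j = 1 := by
  rw [C, ← map_mul, show mk Circ.cnot * mk Circ.cnot = 1 from cnot_sq, map_one]

theorem T_sq {N : ℕ} (i j k : Fin N) : T i j k * T i j k = 1 := by
  rw [T, ← map_mul, show mk Circ.tof * mk Circ.tof = 1 from tof_sq, map_one]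

theorem S_sq {N : ℕ} (i j : Fin N) : S i j * S i j = 1 := by
  rw [S, ← map_mul, show mk (.swap 1 1) * mk (.swap 1 1) = 1 from swap_sq, map_one]

theorem bit_dagger_bit (b : Bool) : bit b ⊚ dagger (bit b) = one 0 :=
  (total_iff _).2 ⟨fun _ => b, (zero_tens (bit b)).symm⟩

theorem Q_sq {N : ℕ} (b : Bool) (i : Fin N) : Q b i * Q b i = Q b i := by
  have h : proj b * proj b = proj b := by
    show dagger (bit b) ⊚ bit b ⊚ (dagger (bit b) ⊚ bit b) = _
    rw [assoc, ← assoc (bit b), bit_dagger_bit, one_comp]; rfl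
  rw [Q, ← map_mul, h]

/-! ### Ancillas -/

/-- Adding an ancilla `|b⟩` below. -/
def addKet (N : ℕ) (b : Bool) : Diag N (N + 1) := one N ⊛ bit b

/-- Removing an ancilla `⟨b|` below. -/
def addBra (N : ℕ) (b : Bool) : Diag (N + 1) N := one N ⊛ dagger (bit b)

theorem dagger_addKet (N : ℕ) (b : Bool) : dagger (addKet N b) = addBra N b := dagger_tens _ _

theorem dagger_addBra (N : ℕ) (b : Bool) : dagger (addBra N b) = addKet N b := by
  rw [← dagger_addKet, dagger_dagger]

theorem addKet_addBra (N : ℕ) (b : Bool) : addKet N b ⊚ addBra N b = one N := by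
  refine (one_tens_comp (bit b) (dagger (bit b)) N).symm.trans ?_
  rw [bit_dagger_bit]; exact one_tens_one N 0

theorem addBra_addKet (N : ℕ) (b : Bool) : addBra N b ⊚ addKet N b = Q b (Fin.last N) := by
  refine (one_tens_comp (dagger (bit b)) (bit b) N).symm.trans ?_
  refine (place_natAdd N (proj b)).symm.trans ?_
  refine congrArg (fun σ => place σ (proj b)) ?_
  funext i; fin_cases i; rfl

theorem comp_addKet {N : ℕ} (b : Bool) (f : Diag N N) : f ⊚ addKet N b = addKet N b ⊚ above N 1 f := by
  refine Eq.trans ?_ ((tens_split f (bit b)).symm.trans (tens_split' f (bit b)))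
  exact congrArg (fun g : Diag N N => g ⊚ addKet N b) (tens_one_zero f).symm

theorem addBra_comp {N : ℕ} (b : Bool) (f : Diag N N) : addBra N b ⊚ f = above N 1 f ⊚ addBra N b := by
  have h := congrArg dagger (comp_addKet b (dagger f))
  rwa [dagger_comp, dagger_comp, dagger_addKet, dagger_above, dagger_dagger] at h

theorem addKet_Q (N : ℕ) (b : Bool) : addKet N b ⊚ Q b (Fin.last N) = addKet N b := by
  rw [← addBra_addKet, ← assoc, addKet_addBra, one_comp]

theorem Q_addBra (N : ℕ) (b : Bool) : Q b (Fin.last N) ⊚ addBra N b = addBra N b := by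
  rw [← addBra_addKet, assoc, addKet_addBra, comp_one]

theorem addKet_above_addBra {N : ℕ} (b : Bool) (f : Diag N N) :
    addKet N b ⊚ above N 1 f ⊚ addBra N b = f := by
  rw [← comp_addKet, assoc, addKet_addBra, comp_one]

/-- An unused ancilla can be cancelled. -/
theorem cancel_ancilla {N : ℕ} (b : Bool) {f g : Diag N N}
    (h : Q b (Fin.last N) * above N 1 f = Q b (Fin.last N) * above N 1 g) : f = g := by
  have key : ∀ f : Diag N N, addKet N b ⊚ (Q b (Fin.last N) * above N 1 f) ⊚ addBra N b = f := fun f => by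
    rw [mul_def, ← assoc, addKet_Q, addKet_above_addBra]
  rw [← key f, h, key g]

/-- Sliding `⟨b|` past the compressed circuit turns the ancilla into projections on both sides, all
on `N + 1` wires, so that no gate changes the number of wires. -/
theorem addBra_comp_addKet {N : ℕ} (b : Bool) (g : Diag (N + 1) (N + 1)) :
    above N 1 (addKet N b ⊚ g ⊚ addBra N b) * Q b (Fin.last N) =
      Q b (Fin.last N) * g * Q b (Fin.last N) := by
  calc _ = above N 1 (addKet N b ⊚ g ⊚ addBra N b) ⊚ addBra N b ⊚ addKet N b := by
        rw [← addBra_addKet]; exact (assoc _ _ _).symm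
    _ = _ := by
        rw [← addBra_comp, mul_def, mul_def, ← addBra_addKet]
        simp only [assoc]

/-! ### Relations between the gates -/

/-- With the generators and derived gates read as gates on numbered wires, each defining identity
becomes an equation that `place` carries to any distinct wires. -/
theorem mk_tof_eq : mk Circ.tof = T 0 1 2 :=
  (place_id _).symm.trans (congrArg (fun σ => place σ (mk Circ.tof)) (by decide))

theorem mk_cnot_eq : mk Circ.cnot = C 0 1 :=
  (place_id _).symm.trans (congrArg (fun σ => place σ (mk Circ.cnot)) (by decide))

theorem mk_swap_eq : mk (.swap 1 1) = S (0 : Fin 2) 1 :=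
  (place_id _).symm.trans (congrArg (fun σ => place σ (mk (.swap 1 1))) (by decide))

theorem mk_not_eq : mk Circ.not = X (0 : Fin 1) :=
  (place_id _).symm.trans (congrArg (fun σ => place σ (mk Circ.not)) (by decide))

theorem above_eq_place {k : ℕ} (r : ℕ) (f : Diag k k) : above k r f = place (Fin.castAdd r) f :=
  (place_castAdd_id r f).symm

theorem below_eq_place {k : ℕ} (r : ℕ) (f : Diag k k) : below r k f = place (Fin.natAdd r) f :=
  (place_natAdd r f).symm

theorem above_T {N : ℕ} (r : ℕ) (i j k : Fin N) :
    above N r (T i j k) = T (Fin.castAdd r i) (Fin.castAdd r j) (Fin.castAdd r k) := by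
  rw [above_eq_place, place_T (Fin.castAdd_injective N r)]

theorem below_T {N : ℕ} (r : ℕ) (i j k : Fin N) :
    below r N (T i j k) = T (Fin.natAdd r i) (Fin.natAdd r j) (Fin.natAdd r k) := by
  rw [below_eq_place, place_T (Fin.natAdd_injective N r)]

theorem above_C {N : ℕ} (r : ℕ) (i j : Fin N) :
    above N r (C i j) = C (Fin.castAdd r i) (Fin.castAdd r j) := by
  rw [above_eq_place, place_C (Fin.castAdd_injective N r)]

theorem below_C {N : ℕ} (r : ℕ) (i j : Fin N) :
    below r N (C i j) = C (Fin.natAdd r i) (Fin.natAdd r j) := by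
  rw [below_eq_place, place_C (Fin.natAdd_injective N r)]

theorem above_S {N : ℕ} (r : ℕ) (i j : Fin N) :
    above N r (S i j) = S (Fin.castAdd r i) (Fin.castAdd r j) := by
  rw [above_eq_place, place_S (Fin.castAdd_injective N r)]

theorem below_S {N : ℕ} (r : ℕ) (i j : Fin N) :
    below r N (S i j) = S (Fin.natAdd r i) (Fin.natAdd r j) := by
  rw [below_eq_place, place_S (Fin.natAdd_injective N r)]

theorem S_conj_T {N : ℕ} (a b i j k : Fin N) : S a b * T i j k * S a b =
    T (Equiv.swap a b i) (Equiv.swap a b j) (Equiv.swap a b k) := by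
  rw [← perm_conj_T, S_eq_perm, Equiv.swap_inv]

theorem S_conj_C {N : ℕ} (a b i j : Fin N) : S a b * C i j * S a b =
    C (Equiv.swap a b i) (Equiv.swap a b j) := by
  rw [← perm_conj_C, S_eq_perm, Equiv.swap_inv]

theorem S_comm {N : ℕ} (a b : Fin N) : S a b = S b a := by
  rw [S_eq_perm, S_eq_perm, Equiv.swap_comm]

theorem mk_swap13_eq : mk Circ.swap13 = S (0 : Fin 3) 2 := by
  show above 2 1 (mk (.swap 1 1)) * below 1 2 (mk (.swap 1 1)) * above 2 1 (mk (.swap 1 1)) = _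
  rw [mk_swap_eq, above_S, below_S, S_eq_perm, S_eq_perm, S_eq_perm, ← map_mul, ← map_mul]
  exact congrArg perm (by decide)

theorem mk_flipTof_eq : mk Circ.flipTof = T 2 1 0 := by
  show mk Circ.swap13 * mk Circ.tof * mk Circ.swap13 = _
  rw [mk_swap13_eq, mk_tof_eq, S_conj_T]; rfl

theorem mk_tof124_eq : mk Circ.tof124 = T 0 1 3 := by
  show below 2 2 (mk (.swap 1 1)) * above 3 1 (mk Circ.tof) * below 2 2 (mk (.swap 1 1)) = _
  rw [mk_swap_eq, mk_tof_eq, above_T, below_S, S_conj_T]; rfl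

theorem mk_tof134_eq : mk Circ.tof134 = T 0 2 3 := by
  show above 2 2 (mk (.swap 1 1)) * below 1 3 (mk Circ.tof) * above 2 2 (mk (.swap 1 1)) = _
  rw [mk_swap_eq, mk_tof_eq, below_T, above_S, S_conj_T]; rfl

theorem injective_of_nodup {α : Type*} {n : ℕ} {f : Fin n → α} (h : (List.ofFn f).Nodup) :
    Function.Injective f := List.nodup_ofFn.1 h

theorem T_symm {N : ℕ} (i j k : Fin N) : T i j k = T j i k := by
  by_cases h : Function.Injective ![i, j, k]
  · have e : T (0 : Fin 3) 1 2 = T 1 0 2 := by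
      have := mk_eq (.ofIdentity .tof15)
      replace this : mk Circ.tof = above 2 1 (mk (.swap 1 1)) * mk Circ.tof * above 2 1 (mk (.swap 1 1)) :=
        this
      rw [mk_tof_eq, mk_swap_eq, above_S, S_conj_T] at this
      exact this
    have := congrArg (place ![i, j, k]) e
    rwa [place_T h, place_T h] at this
  · rw [T, T, place_of_not_injective h, place_of_not_injective]
    intro h'
    apply h
    have := h'.comp (Equiv.swap (0 : Fin 3) 1).injective
    convert this using 1
    funext a; fin_cases a <;> rfl

/-- This is `Identity.tof12` on named wires; the next lemmas treat `tof13`, `tof11` and `tof14` in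
the same way. -/
theorem tof_tof_tof {N : ℕ} (i j k l : Fin N) (h : [i, j, k, l].Nodup) :
    T i j k * T j k l * T i j k = T i j l * T j k l := by
  have e : T (0 : Fin 4) 1 2 * T 1 2 3 * T 0 1 2 = T 0 1 3 * T 1 2 3 := by
    have := mk_eq (.ofIdentity .tof12)
    replace this : above 3 1 (mk Circ.tof) * below 1 3 (mk Circ.tof) * above 3 1 (mk Circ.tof) =
      mk Circ.tof124 * below 1 3 (mk Circ.tof) := this
    rw [mk_tof_eq, mk_tof124_eq, above_T, below_T] at this
    exact this
  have hσ : Function.Injective ![i, j, k, l] := injective_of_nodup h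
  have := congrArg (place ![i, j, k, l]) e
  simp only [map_mul, place_T hσ] at this
  exact this

theorem tof_cnot_tof {N : ℕ} (i j k l : Fin N) (h : [i, j, k, l].Nodup) :
    T i j k * C k l * T i j k = T i j l * C k l := by
  have e : T (0 : Fin 4) 1 2 * C 2 3 * T 0 1 2 = T 0 1 3 * C 2 3 := by
    have := mk_eq (.ofIdentity .tof13)
    replace this : above 3 1 (mk Circ.tof) * below 2 2 (mk Circ.cnot) * above 3 1 (mk Circ.tof) =
      mk Circ.tof124 * below 2 2 (mk Circ.cnot) := this
    rw [mk_tof_eq, mk_tof124_eq, mk_cnot_eq, above_T, below_C] at this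
    exact this
  have hσ : Function.Injective ![i, j, k, l] := injective_of_nodup h
  have := congrArg (place ![i, j, k, l]) e
  simp only [map_mul, place_T hσ, place_C hσ] at this
  exact this

theorem cnot_tof_cnot {N : ℕ} (i j k l : Fin N) (h : [i, j, k, l].Nodup) :
    C i j * T j k l * C i j = T i k l * T j k l := by
  have e : C (0 : Fin 4) 1 * T 1 2 3 * C 0 1 = T 0 2 3 * T 1 2 3 := by
    have := mk_eq (.ofIdentity .tof11)
    replace this : above 2 2 (mk Circ.cnot) * below 1 3 (mk Circ.tof) * above 2 2 (mk Circ.cnot) =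
      mk Circ.tof134 * below 1 3 (mk Circ.tof) := this
    rw [mk_tof_eq, mk_tof134_eq, mk_cnot_eq, above_C, below_T] at this
    exact this
  have hσ : Function.Injective ![i, j, k, l] := injective_of_nodup h
  have := congrArg (place ![i, j, k, l]) e
  simp only [map_mul, place_T hσ, place_C hσ] at this
  exact this

theorem cnot_cnot_cnot {N : ℕ} (i j : Fin N) (h : i ≠ j) : C i j * C j i * C i j = S i j := by
  have e : C (0 : Fin 2) 1 * C 1 0 * C 0 1 = S 0 1 := by
    have := mk_eq (.ofIdentity .tof14)
    replace this : mk Circ.cnot * (mk (.swap 1 1) * mk Circ.cnot * mk (.swap 1 1)) * mk Circ.cnot =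
      mk (.swap 1 1) := this
    rw [mk_cnot_eq, mk_swap_eq, S_conj_C] at this
    exact this
  have hσ : Function.Injective ![i, j] := injective_vec_two h
  have := congrArg (place ![i, j]) e
  simp only [map_mul, place_C hσ, place_S hσ] at this
  exact this

/-! Commutation. -/

theorem disjoint_vec {α : Type*} {n m : ℕ} {f : Fin n → α} {g : Fin m → α}
    (h : List.Disjoint (List.ofFn f) (List.ofFn g)) (a : Fin n) (b : Fin m) : f a ≠ g b := fun e =>
  h (List.mem_ofFn.2 ⟨a, rfl⟩) (List.mem_ofFn.2 ⟨b, e.symm⟩)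

theorem not_injective_vec_three {α : Type*} {i j k : α} (h : ¬ (i ≠ j ∧ i ≠ k ∧ j ≠ k)) :
    ¬ Function.Injective ![i, j, k] := by
  intro hi
  apply h
  refine ⟨fun e => ?_, fun e => ?_, fun e => ?_⟩
  · simpa using @hi 0 1 e
  · simpa using @hi 0 2 e
  · simpa using @hi 1 2 e

/-- One overlap pattern of two commuting Toffoli gates, from `Identity.tof3`; the next three lemmas
cover a shared control (`tof4`), two shared controls (`tof5`), and a shared control and target
(`tof5half`). -/
theorem T_comm_target {N : ℕ} (i j l m k : Fin N) (h : [i, j, k, l, m].Nodup) :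
    T i j k * T l m k = T l m k * T i j k := by
  have e : T (0 : Fin 5) 1 2 * T 4 3 2 = T 4 3 2 * T 0 1 2 := by
    have := mk_eq (.ofIdentity .tof3)
    replace this : above 3 2 (mk Circ.tof) * below 2 3 (mk Circ.flipTof) =
      below 2 3 (mk Circ.flipTof) * above 3 2 (mk Circ.tof) := this
    rw [mk_tof_eq, mk_flipTof_eq, above_T, below_T] at this
    exact this
  have hσ : Function.Injective ![i, j, k, l, m] := injective_of_nodup h
  have := congrArg (place ![i, j, k, l, m]) e
  simp only [map_mul, place_T hσ] at this
  rw [T_symm l m k]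
  exact this

theorem T_comm_control {N : ℕ} (i j k l m : Fin N) (h : [i, j, k, l, m].Nodup) :
    T i j k * T i l m = T i l m * T i j k := by
  have e : T (2 : Fin 5) 1 0 * T 2 3 4 = T 2 3 4 * T 2 1 0 := by
    have := mk_eq (.ofIdentity .tof4)
    replace this : above 3 2 (mk Circ.flipTof) * below 2 3 (mk Circ.tof) =
      below 2 3 (mk Circ.tof) * above 3 2 (mk Circ.flipTof) := this
    rw [mk_tof_eq, mk_flipTof_eq, above_T, below_T] at this
    exact this
  have hσ : Function.Injective ![k, j, i, l, m] := injective_of_nodup (by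
    simp only [List.ofFn_succ, List.ofFn_zero] at h ⊢; simp at h ⊢; grind)
  have := congrArg (place ![k, j, i, l, m]) e
  simp only [map_mul, place_T hσ] at this
  exact this

theorem T_comm_controls {N : ℕ} (i j k m : Fin N) (h : [i, j, k, m].Nodup) :
    T i j k * T i j m = T i j m * T i j k := by
  have e : T (2 : Fin 4) 1 0 * T 1 2 3 = T 1 2 3 * T 2 1 0 := by
    have := mk_eq (.ofIdentity .tof5)
    replace this : above 3 1 (mk Circ.flipTof) * below 1 3 (mk Circ.tof) =
      below 1 3 (mk Circ.tof) * above 3 1 (mk Circ.flipTof) := this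
    rw [mk_tof_eq, mk_flipTof_eq, above_T, below_T] at this
    exact this
  have hσ : Function.Injective ![k, j, i, m] := injective_of_nodup (by simp at h ⊢; grind)
  have := congrArg (place ![k, j, i, m]) e
  simp only [map_mul, place_T hσ] at this
  rw [T_symm i j m]
  exact this

theorem T_comm_control_target {N : ℕ} (i j l k : Fin N) (h : [i, j, l, k].Nodup) :
    T i j k * T i l k = T i l k * T i j k := by
  have e : T (0 : Fin 4) 2 3 * T 1 2 3 = T 1 2 3 * T 0 2 3 := by
    have := mk_eq (.ofIdentity .tof5half)
    replace this : mk Circ.tof134 * below 1 3 (mk Circ.tof) =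
      below 1 3 (mk Circ.tof) * mk Circ.tof134 := this
    rw [mk_tof_eq, mk_tof134_eq, below_T] at this
    exact this
  have hσ : Function.Injective ![j, l, i, k] := injective_of_nodup (by simp at h ⊢; grind)
  have := congrArg (place ![j, l, i, k]) e
  simp only [map_mul, place_T hσ] at this
  rw [T_symm i j, T_symm i l]
  exact this

/-- Toffoli gates commute if neither has its target among the controls of the other. -/
theorem T_comm {N : ℕ} (i j k l m n : Fin N) (hkl : k ≠ l) (hkm : k ≠ m) (hni : n ≠ i) (hnj : n ≠ j) :
    T i j k * T l m n = T l m n * T i j k := by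
  by_cases h : i ≠ j ∧ i ≠ k ∧ j ≠ k
  swap
  · rw [T, place_of_not_injective (not_injective_vec_three h), one_mul, mul_one]
  by_cases h' : l ≠ m ∧ l ≠ n ∧ m ≠ n
  swap
  · rw [T, T, place_of_not_injective (not_injective_vec_three h'), one_mul, mul_one]
  obtain ⟨h1, h2, h3⟩ := h
  obtain ⟨h4, h5, h6⟩ := h'
  -- Symmetry in the controls brings a shared control to the first place of both gates; the other
  -- coincidences then select the pattern.
  have key : ∀ i j l m : Fin N, i ≠ j → i ≠ k → j ≠ k → l ≠ m → l ≠ n → m ≠ n → k ≠ l → k ≠ m →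
      n ≠ i → n ≠ j → i = l → T i j k * T l m n = T l m n * T i j k := by
    rintro i j l m h1 h2 h3 h4 h5 h6 hkl hkm hni hnj rfl
    by_cases hjm : j = m
    · subst hjm
      by_cases hkn : k = n
      · subst hkn; rfl
      · exact T_comm_controls i j k n (by simp; grind)
    · by_cases hkn : k = n
      · subst hkn
        exact T_comm_control_target i j m k (by simp; grind)
      · exact T_comm_control i j k m n (by simp; grind)
  by_cases hil : i = l
  · exact key i j l m h1 h2 h3 h4 h5 h6 hkl hkm hni hnj hil
  by_cases hjl : j = l
  · rw [T_symm i j k]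
    exact key j i l m h1.symm h3 h2 h4 h5 h6 hkl hkm hnj hni hjl
  by_cases him : i = m
  · rw [T_symm l m n]
    exact key i j m l h1 h2 h3 h4.symm h6 h5 hkm hkl hni hnj him
  by_cases hjm : j = m
  · rw [T_symm l m n, T_symm i j k]
    exact key j i m l h1.symm h3 h2 h4.symm h6 h5 hkm hkl hnj hni hjm
  -- No shared control remains: the gates share the target or are disjoint.
  by_cases hkn : k = n
  · subst hkn
    exact T_comm_target i j l m k (by simp; grind)
  · exact place_comm (disjoint_vec (by simp [List.Disjoint]; grind)) _ _

theorem Q_comm_T_of_ne {N : ℕ} (b : Bool) (l i j k : Fin N) (hi : l ≠ i) (hj : l ≠ j) (hk : l ≠ k) :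
    Q b l * T i j k = T i j k * Q b l :=
  place_comm (disjoint_vec (by simp [List.Disjoint]; grind)) _ _

theorem Q_comm_C_of_ne {N : ℕ} (b : Bool) (l i j : Fin N) (hi : l ≠ i) (hj : l ≠ j) :
    Q b l * C i j = C i j * Q b l :=
  place_comm (disjoint_vec (by simp [List.Disjoint]; grind)) _ _

theorem Q_comm_X {N : ℕ} (b : Bool) (l i : Fin N) (hi : l ≠ i) :
    Q b l * X i = X i * Q b l :=
  place_comm (disjoint_vec (by simp [List.Disjoint]; grind)) _ _

theorem Q_comm_Q {N : ℕ} (b c : Bool) (l i : Fin N) (hi : l ≠ i) :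
    Q b l * Q c i = Q c i * Q b l :=
  place_comm (disjoint_vec (by simp [List.Disjoint]; grind)) _ _

theorem X_comm_X {N : ℕ} (l i : Fin N) : X l * X i = X i * X l := by
  by_cases h : l = i
  · rw [h]
  · exact place_comm (disjoint_vec (by simp [List.Disjoint]; grind)) _ _

/-! Ancillas on the controls. -/

theorem proj_above (b : Bool) (r : ℕ) :
    above 1 r (proj b) = ((dagger (bit b) ⊛ one r) ⊚ (bit b ⊛ one r) : Diag (1 + r) (1 + r)) :=
  tens_one_comp (dagger (bit b)) (bit b) r

theorem Q_zero_eq (b : Bool) (r : ℕ) : Q b (Fin.castAdd r (0 : Fin 1)) = above 1 r (proj b) := by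
  rw [← place_castAdd_id]
  exact congrArg (fun σ => place σ (proj b)) (by funext i; fin_cases i; rfl)

/-- The projection ends in `|1⟩`, and `|1⟩` on a control is absorbed by `Identity.tof1`. The
variants below use `tof2`, `ket1_cnot` and `ket0_cnot` in place of it. -/
theorem Q_true_T {N : ℕ} (i j k : Fin N) (h : [i, j, k].Nodup) :
    Q true i * T i j k = Q true i * C j k := by
  have e : Q true (0 : Fin 3) * T 0 1 2 = Q true (0 : Fin 3) * C 1 2 := by
    have := mk_eq (.ofIdentity .tof1)
    replace this : (bit true ⊛ one 2 : Diag 2 3) ⊚ mk Circ.tof = bit true ⊛ mk Circ.cnot := this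
    have h2 : below 1 2 (mk Circ.cnot) = C (1 : Fin 3) 2 := by rw [mk_cnot_eq, below_C]; rfl
    rw [show Q true (0 : Fin 3) = above 1 2 (proj true) from Q_zero_eq true 2, proj_above, ← h2,
      ← mk_tof_eq]
    show (_ ⊚ (bit true ⊛ one 2 : Diag 2 3)) ⊚ _ = (_ ⊚ (bit true ⊛ one 2 : Diag 2 3)) ⊚ _
    rw [assoc, assoc, this]
    congr 1
    exact tens_split (bit true) (mk Circ.cnot)
  have hσ : Function.Injective ![i, j, k] := injective_of_nodup h
  have := congrArg (place ![i, j, k]) e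
  simp only [map_mul, place_T hσ, place_C hσ, place_Q hσ] at this
  exact this

theorem Q_false_T {N : ℕ} (i j k : Fin N) (h : [i, j, k].Nodup) :
    Q false i * T i j k = Q false i := by
  have e : Q false (0 : Fin 3) * T 0 1 2 = Q false (0 : Fin 3) := by
    have := mk_eq (.ofIdentity .tof2)
    replace this : (bit false ⊛ one 2 : Diag 2 3) ⊚ mk Circ.tof = bit false ⊛ one 2 := this
    rw [show Q false (0 : Fin 3) = above 1 2 (proj false) from Q_zero_eq false 2, proj_above,
      ← mk_tof_eq]
    show (_ ⊚ (bit false ⊛ one 2 : Diag 2 3)) ⊚ _ = (_ ⊚ (bit false ⊛ one 2 : Diag 2 3))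
    rw [assoc, this]
  have hσ : Function.Injective ![i, j, k] := injective_of_nodup h
  have := congrArg (place ![i, j, k]) e
  simp only [map_mul, place_T hσ, place_Q hσ] at this
  exact this

theorem Q_true_C {N : ℕ} (i j : Fin N) (h : i ≠ j) : Q true i * C i j = Q true i * X j := by
  have e : Q true (0 : Fin 2) * C 0 1 = Q true (0 : Fin 2) * X 1 := by
    have h2 : below 1 1 (mk Circ.not) = X (1 : Fin 2) := by
      rw [mk_not_eq, below_eq_place, place_X (Fin.natAdd_injective 1 1)]; rfl
    rw [show Q true (0 : Fin 2) = above 1 1 (proj true) from Q_zero_eq true 1, proj_above, ← h2,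
      ← mk_cnot_eq]
    show (_ ⊚ (bit true ⊛ one 1 : Diag 1 2)) ⊚ _ = (_ ⊚ (bit true ⊛ one 1 : Diag 1 2)) ⊚ _
    rw [assoc, assoc, show (bit true ⊛ one 1 : Diag 1 2) ⊚ mk Circ.cnot = _ from ket1_cnot]
    congr 1
    exact tens_split (bit true) (mk Circ.not)
  have hσ : Function.Injective ![i, j] := injective_vec_two h
  have := congrArg (place ![i, j]) e
  simp only [map_mul, place_C hσ, place_Q hσ, place_X hσ] at this
  exact this

theorem Q_false_C {N : ℕ} (i j : Fin N) (h : i ≠ j) : Q false i * C i j = Q false i := by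
  have e : Q false (0 : Fin 2) * C 0 1 = Q false (0 : Fin 2) := by
    rw [show Q false (0 : Fin 2) = above 1 1 (proj false) from Q_zero_eq false 1, proj_above,
      ← mk_cnot_eq]
    show (_ ⊚ (bit false ⊛ one 1 : Diag 1 2)) ⊚ _ = (_ ⊚ (bit false ⊛ one 1 : Diag 1 2))
    rw [assoc, show (bit false ⊛ one 1 : Diag 1 2) ⊚ mk Circ.cnot = _ from ket0_cnot]; rfl
  have hσ : Function.Injective ![i, j] := injective_vec_two h
  have := congrArg (place ![i, j]) e
  simp only [map_mul, place_C hσ, place_Q hσ] at this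
  exact this

theorem X_Q_X {N : ℕ} (i : Fin N) : X i * Q false i * X i = Q true i := by
  have h : mk Circ.not * proj false * mk Circ.not = proj true := by
    have h1 : mk Circ.ket0 ⊚ mk Circ.not = mk Circ.ket1 := bit_not false
    have h2 : mk Circ.not ⊚ mk Circ.bra0 = mk Circ.bra1 := by
      show mk Circ.not ⊚ (mk Circ.not ⊚ mk Circ.bra1) = _
      rw [← assoc, not_sq, one_comp]
    show mk Circ.not ⊚ (mk (Circ.dagger Circ.ket0) ⊚ mk Circ.ket0) ⊚ mk Circ.not = mk Circ.bra1 ⊚ mk Circ.ket1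
    rw [dagger_ket0, assoc, assoc, h1, ← assoc, h2]
  rw [X, Q, ← map_mul, ← map_mul, h]; rfl

/-- Two ancillas in the same state are interchangeable. -/
theorem Q_Q_S {N : ℕ} (b : Bool) (i j : Fin N) (h : i ≠ j) : Q b i * Q b j * S i j = Q b i * Q b j := by
  have e : Q b (0 : Fin 2) * Q b 1 * S 0 1 = Q b (0 : Fin 2) * Q b 1 := by
    have h2 : below 1 1 (proj b) = Q b (1 : Fin 2) := by
      rw [← place_natAdd]
      exact congrArg (fun σ => place σ (proj b)) (by funext i; fin_cases i; rfl)
    rw [show Q b (0 : Fin 2) = above 1 1 (proj b) from Q_zero_eq b 1, ← h2, ← mk_swap_eq]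
    have h3 : above 1 1 (proj b) * below 1 1 (proj b) =
        (dagger (bit b) ⊛ dagger (bit b) : Diag 2 0) ⊚ (bit b ⊛ bit b : Diag 0 2) :=
      (tens_split (proj b) (proj b)).symm.trans
        (interchange (dagger (bit b)) (bit b) (dagger (bit b)) (bit b))
    rw [h3]
    show (_ ⊚ (bit b ⊛ bit b : Diag 0 2)) ⊚ _ = _
    rw [assoc, ket_ket_swap]
  have hσ : Function.Injective ![i, j] := injective_vec_two h
  have := congrArg (place ![i, j]) e
  simp only [map_mul, place_S hσ, place_Q hσ] at this
  exact this

/-! Reflected versions. -/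

theorem T_Q_true {N : ℕ} (i j k : Fin N) (h : [i, j, k].Nodup) :
    T i j k * Q true i = C j k * Q true i := by
  have := congrArg dagger (Q_true_T i j k h)
  rwa [dagger_mul, dagger_mul, dagger_T, dagger_C, dagger_Q] at this

theorem T_Q_false {N : ℕ} (i j k : Fin N) (h : [i, j, k].Nodup) :
    T i j k * Q false i = Q false i := by
  have := congrArg dagger (Q_false_T i j k h)
  rwa [dagger_mul, dagger_T, dagger_Q] at this

theorem C_Q_true {N : ℕ} (i j : Fin N) (h : i ≠ j) : C i j * Q true i = X j * Q true i := by
  have := congrArg dagger (Q_true_C i j h)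
  rwa [dagger_mul, dagger_mul, dagger_X, dagger_C, dagger_Q] at this

theorem C_Q_false {N : ℕ} (i j : Fin N) (h : i ≠ j) : C i j * Q false i = Q false i := by
  have := congrArg dagger (Q_false_C i j h)
  rwa [dagger_mul, dagger_C, dagger_Q] at this

/-! ### Degenerate gates, and projections of wires that a gate does not modify -/

theorem T_eq_one {N : ℕ} (i j k : Fin N) (h : ¬ [i, j, k].Nodup) : T i j k = 1 :=
  place_of_not_injective (not_injective_vec_three (by simpa [and_assoc] using h)) _

theorem C_eq_one {N : ℕ} (i : Fin N) : C i i = 1 :=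
  place_of_not_injective (fun h => by simpa using @h 0 1 rfl) _

theorem Q_comm_C {N : ℕ} (b : Bool) (l i j : Fin N) (hj : l ≠ j) :
    Q b l * C i j = C i j * Q b l := by
  by_cases hi : l = i
  · subst hi
    cases b
    · rw [Q_false_C l j hj, C_Q_false l j hj]
    · rw [Q_true_C l j hj, C_Q_true l j hj, Q_comm_X _ _ _ hj]
  · exact Q_comm_C_of_ne b l i j hi hj

/-- Only the target is modified: on a control the projection either deletes the gate or lowers it to
a controlled not with another control. -/
theorem Q_comm_T {N : ℕ} (b : Bool) (l i j k : Fin N) (hk : l ≠ k) :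
    Q b l * T i j k = T i j k * Q b l := by
  have key : ∀ j, Q b l * T l j k = T l j k * Q b l := fun j => by
    by_cases h : [l, j, k].Nodup
    · cases b
      · rw [Q_false_T l j k h, T_Q_false l j k h]
      · rw [Q_true_T l j k h, T_Q_true l j k h, Q_comm_C _ _ _ _ hk]
    · rw [T_eq_one l j k h, one_mul, mul_one]
  by_cases hi : l = i
  · subst hi; exact key j
  · by_cases hj : l = j
    · subst hj; rw [T_symm]; exact key i
    · exact Q_comm_T_of_ne b l i j k hi hj hk

/-! Relations obtained by setting a control to `|1⟩`. -/

theorem above_one_T {N : ℕ} (i j k : Fin N) :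
    above N 1 (T i j k) = T i.castSucc j.castSucc k.castSucc := above_T 1 i j k

theorem above_one_C {N : ℕ} (i j : Fin N) : above N 1 (C i j) = C i.castSucc j.castSucc := above_C 1 i j

theorem above_one_X {N : ℕ} (i : Fin N) : above N 1 (X i) = X i.castSucc := by
  rw [above_eq_place, place_X (Fin.castAdd_injective N 1)]; rfl

theorem above_one_Q {N : ℕ} (b : Bool) (i : Fin N) : above N 1 (Q b i) = Q b i.castSucc := by
  rw [above_eq_place, place_Q (Fin.castAdd_injective N 1)]; rfl

theorem above_one_S {N : ℕ} (i j : Fin N) : above N 1 (S i j) = S i.castSucc j.castSucc := above_S 1 i j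

/-- `f` and `g` agree when the wire `i`, which `g` does not modify, carries `|b⟩`. -/
def AgreeOn {N : ℕ} (b : Bool) (i : Fin N) (f g : Diag N N) : Prop :=
  Q b i * f = Q b i * g ∧ Q b i * g = g * Q b i

/-- Commutation with `g` carries the projection across the first factor to the second. -/
theorem AgreeOn.mul {N : ℕ} {b : Bool} {i : Fin N} {f g f' g' : Diag N N} (h : AgreeOn b i f g)
    (h' : AgreeOn b i f' g') : AgreeOn b i (f * f') (g * g') := by
  refine ⟨?_, ?_⟩
  · rw [← mul_assoc, h.1, h.2, mul_assoc, h'.1, ← mul_assoc, ← h.2, mul_assoc]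
  · rw [← mul_assoc, h.2, mul_assoc, h'.2, mul_assoc]

theorem AgreeOn.above_mul {N : ℕ} {b : Bool} {i : Fin (N + 1)} {f f' : Diag (N + 1) (N + 1)}
    {g g' : Diag N N} (h : AgreeOn b i f (above N 1 g)) (h' : AgreeOn b i f' (above N 1 g')) :
    AgreeOn b i (f * f') (above N 1 (g * g')) := by
  rw [map_mul]; exact h.mul h'

/-- A relation between gates using an extra wire specialises, once that wire is fixed to `|b⟩`, to
the relation without it. Thus each Toffoli relation yields a controlled-not relation, and each of
those a relation with a plain not. -/
theorem AgreeOn.cancel {N : ℕ} {b : Bool} {f f' : Diag (N + 1) (N + 1)} {g g' : Diag N N}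
    (h : f = f') (hg : AgreeOn b (Fin.last N) f (above N 1 g))
    (hg' : AgreeOn b (Fin.last N) f' (above N 1 g')) : g = g' :=
  cancel_ancilla b (by rw [← hg.1, h, hg'.1])

theorem last_ne {N : ℕ} (a : Fin N) : Fin.last N ≠ a.castSucc := (Fin.castSucc_lt_last a).ne'

theorem agreeOn_C {N : ℕ} (i j : Fin N) (h : i ≠ j) :
    AgreeOn true (Fin.last N) (T (Fin.last N) i.castSucc j.castSucc) (above N 1 (C i j)) := by
  rw [above_one_C]
  exact ⟨Q_true_T _ _ _ (by simp [h, last_ne]), Q_comm_C _ _ _ _ (last_ne j)⟩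

theorem agreeOn_X {N : ℕ} (i : Fin N) :
    AgreeOn true (Fin.last N) (C (Fin.last N) i.castSucc) (above N 1 (X i)) := by
  rw [above_one_X]
  exact ⟨Q_true_C _ _ (last_ne i), Q_comm_X _ _ _ (last_ne i)⟩

theorem agreeOn_T {N : ℕ} (b : Bool) (i j k : Fin N) :
    AgreeOn b (Fin.last N) (T i.castSucc j.castSucc k.castSucc) (above N 1 (T i j k)) := by
  rw [above_one_T]
  exact ⟨rfl, Q_comm_T _ _ _ _ _ (last_ne k)⟩

theorem agreeOn_castSucc_C {N : ℕ} (b : Bool) (i j : Fin N) :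
    AgreeOn b (Fin.last N) (C i.castSucc j.castSucc) (above N 1 (C i j)) := by
  rw [above_one_C]
  exact ⟨rfl, Q_comm_C _ _ _ _ (last_ne j)⟩

/-- A controlled not is a Toffoli gate whose other control is a new wire carrying `|1⟩`. -/
theorem T_comm_C {N : ℕ} (i j k l m : Fin N) (hkl : k ≠ l) (hmi : m ≠ i) (hmj : m ≠ j) :
    T i j k * C l m = C l m * T i j k := by
  by_cases h : l = m
  · subst h; rw [C_eq_one, one_mul, mul_one]
  have h1 := agreeOn_C l m h
  have h2 := agreeOn_T true i j k
  refine AgreeOn.cancel (b := true) ?_ (h2.above_mul h1)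
    (h1.above_mul h2)
  exact T_comm _ _ _ _ _ _ (last_ne k).symm (by simpa using hkl) (by simpa using hmi) (by simpa using hmj)

theorem C_comm_C {N : ℕ} (i j l m : Fin N) (hjl : j ≠ l) (hmi : m ≠ i) :
    C i j * C l m = C l m * C i j := by
  by_cases h : l = m
  · subst h; rw [C_eq_one, one_mul, mul_one]
  have h1 := agreeOn_C l m h
  have h2 := agreeOn_castSucc_C true i j
  refine AgreeOn.cancel (b := true) ?_ (h2.above_mul h1)
    (h1.above_mul h2)
  exact (T_comm_C _ _ _ _ _ (by simpa using hmi) (last_ne j).symm (by simpa using hjl)).symm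

theorem cnot_conj_cnot {N : ℕ} (i j k : Fin N) (h : [i, j, k].Nodup) :
    C i j * C j k * C i j = C i k * C j k := by
  have h0 : i ≠ j ∧ i ≠ k ∧ j ≠ k := by simpa [and_assoc] using h
  have h1 := agreeOn_C i j h0.1
  have h2 := agreeOn_C i k h0.2.1
  have h3 := agreeOn_castSucc_C true j k
  refine AgreeOn.cancel (b := true) ?_ ((h1.above_mul h3).above_mul h1)
    (h2.above_mul h3)
  exact tof_cnot_tof _ _ _ _ (by simp [h0, last_ne])

/-- `cnot_tof_cnot` with its first control fixed to `|1⟩`. -/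
theorem not_conj_tof {N : ℕ} (j k l : Fin N) (h : [j, k, l].Nodup) :
    X j * T j k l * X j = C k l * T j k l := by
  have h0 : j ≠ k ∧ j ≠ l ∧ k ≠ l := by simpa [and_assoc] using h
  have h1 := agreeOn_X j
  have h2 := agreeOn_C k l h0.2.2
  have h3 := agreeOn_T true j k l
  refine AgreeOn.cancel (b := true) ?_ ((h1.above_mul h3).above_mul h1)
    (h2.above_mul h3)
  exact cnot_tof_cnot _ _ _ _ (by simp [h0, last_ne])

theorem not_conj_cnot {N : ℕ} (j l : Fin N) (h : j ≠ l) :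
    X j * C j l * X j = X l * C j l := by
  have h1 : AgreeOn true (Fin.last N) (X j.castSucc) (above N 1 (X j)) := by
    rw [above_one_X]; exact ⟨rfl, Q_comm_X _ _ _ (last_ne j)⟩
  have h2 := agreeOn_C j l h
  have h3 := agreeOn_X l
  refine AgreeOn.cancel (b := true) ?_ ((h1.above_mul h2).above_mul h1)
    (h3.above_mul h2)
  rw [T_symm]
  exact not_conj_tof _ _ _ (by simp [h, last_ne, (last_ne _).symm])

/-! ### Moving wire permutations past gates -/

theorem perm_mul_X {N : ℕ} (π : Equiv.Perm (Fin N)) (i : Fin N) :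
    perm π * X i = X (π i) * perm π := by
  rw [← perm_conj_X, mul_assoc, perm_inv_mul_perm, mul_one]

theorem perm_mul_Q {N : ℕ} (π : Equiv.Perm (Fin N)) (b : Bool) (i : Fin N) :
    perm π * Q b i = Q b (π i) * perm π := by
  rw [← perm_conj_Q, mul_assoc, perm_inv_mul_perm, mul_one]

theorem perm_mul_C {N : ℕ} (π : Equiv.Perm (Fin N)) (i j : Fin N) :
    perm π * C i j = C (π i) (π j) * perm π := by
  rw [← perm_conj_C, mul_assoc, perm_inv_mul_perm, mul_one]

theorem perm_mul_T {N : ℕ} (π : Equiv.Perm (Fin N)) (i j k : Fin N) :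
    perm π * T i j k = T (π i) (π j) (π k) * perm π := by
  rw [← perm_conj_T, mul_assoc, perm_inv_mul_perm, mul_one]

theorem S_mul_X {N : ℕ} (i j : Fin N) : S i j * X j = X i * S i j := by
  rw [S_eq_perm, perm_mul_X, Equiv.swap_apply_right]

theorem S_mul_Q {N : ℕ} (b : Bool) (i j : Fin N) : S i j * Q b j = Q b i * S i j := by
  rw [S_eq_perm, perm_mul_Q, Equiv.swap_apply_right]

/-! Controlled gates meeting ancillas on their targets. -/

theorem X_mul_Q {N : ℕ} (b : Bool) (i : Fin N) : X i * Q b i = Q (!b) i * X i := by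
  cases b
  · rw [Bool.not_false, ← X_Q_X, mul_assoc, X_sq, mul_one]
  · rw [Bool.not_true, ← X_Q_X, ← mul_assoc, ← mul_assoc, X_sq, one_mul]

/-- A target carrying 0 before and after forces the control to be 0. By `cnot_cnot_cnot` the gate is
a swap between two controlled nots with control `x`; the projections erase these, and the swap
carries the projection from `x` to `a`. -/
theorem Q_C_Q_false {N : ℕ} (x a : Fin N) (h : a ≠ x) :
    Q false x * C a x * Q false x = Q false a * Q false x := by
  have h1 : C a x = C x a * S x a * C x a := by
    rw [← cnot_cnot_cnot x a h.symm]
    calc C a x = (C x a * C x a) * C a x * (C x a * C x a) := by rw [C_sq, one_mul, mul_one]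
      _ = _ := by simp only [mul_assoc]
  calc Q false x * C a x * Q false x
      = (Q false x * C x a) * S x a * (C x a * Q false x) := by rw [h1]; simp only [mul_assoc]
    _ = Q false x * (S a x * Q false x) := by
        rw [Q_false_C _ _ h.symm, C_Q_false _ _ h.symm, S_comm, mul_assoc]
    _ = _ := by rw [S_mul_Q, ← mul_assoc, S_comm, Q_Q_S _ _ _ h.symm, Q_comm_Q _ _ _ _ h.symm]

/-- A target flipping from `|1⟩` to `|0⟩` forces the control to carry `|1⟩`. -/
theorem Q_true_C_Q_false {N : ℕ} (x a : Fin N) (h : a ≠ x) :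
    Q true x * C a x * Q false x = Q true a * Q true x * X x := by
  have hxa : ∀ b, Q b x * X a = X a * Q b x := fun b => Q_comm_X b x a h.symm
  have hax : ∀ b, Q b a * X x = X x * Q b a := fun b => Q_comm_X b a x h
  calc Q true x * C a x * Q false x = X x * Q false x * (X x * C a x) * Q false x := by
        rw [← X_Q_X]; simp only [mul_assoc]
    -- Negating the target amounts to negating the control before and after.
    _ = X x * (Q false x * X a) * C a x * (X a * Q false x) := by
        rw [← not_conj_cnot a x h]; simp only [mul_assoc]
    _ = X x * X a * (Q false x * C a x * Q false x) * X a := by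
        rw [← hxa]; simp only [mul_assoc]
        rw [← mul_assoc (Q false x) (X a), hxa, mul_assoc]
    _ = X x * (X a * Q false a * X a) * Q false x := by
        rw [Q_C_Q_false x a h]
        simp only [mul_assoc]; rw [hxa]
    _ = Q true a * (X x * Q false x) := by rw [X_Q_X, ← hax, mul_assoc]
    _ = _ := by rw [X_mul_Q, mul_assoc]; rfl

/-- A target flipping from `|0⟩` to `|1⟩` forces the control to carry `|1⟩`. -/
theorem Q_false_C_Q_true {N : ℕ} (x a : Fin N) (h : a ≠ x) :
    Q false x * C a x * Q true x = Q true a * Q false x * X x := by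
  have h1 := congrArg dagger (Q_true_C_Q_false x a h)
  simp only [dagger_mul, dagger_Q, dagger_C, dagger_X] at h1
  calc _ = X x * Q true x * Q true a := by rw [mul_assoc, h1, mul_assoc]
    _ = Q false x * (X x * Q true a) := by rw [X_mul_Q, mul_assoc]; rfl
    _ = _ := by rw [← Q_comm_X _ _ _ h, ← mul_assoc, Q_comm_Q _ _ _ _ h]

/-- Moving `|1⟩` from `y` to `a` by a swap. -/
theorem Q_true_Q_false_S {N : ℕ} (y a : Fin N) (h : y ≠ a) :
    Q true y * Q false a * S y a = Q true y * Q false a * X y * X a := by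
  have hay : ∀ b, Q b a * X y = X y * Q b a := fun b => Q_comm_X b a y h.symm
  calc _ = X y * Q false y * (X y * Q false a) * S y a := by rw [← X_Q_X]; simp only [mul_assoc]
    _ = X y * Q false y * Q false a * (X y * S y a) := by rw [← hay]; simp only [mul_assoc]
    _ = X y * (Q false y * Q false a * S y a) * X a := by rw [← S_mul_X]; simp only [mul_assoc]
    _ = Q true y * (X y * Q false a) * X a := by
        rw [Q_Q_S _ _ _ h, ← mul_assoc, X_mul_Q]; simp only [mul_assoc]; rfl
    _ = _ := by rw [← hay]; simp only [mul_assoc]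

/-! ### The not gate with three controls -/

/-- The not gate with controls `i`, `j`, `k` and target `l`, borrowing the wire `e`. -/
noncomputable def K {N : ℕ} (e i j k l : Fin N) : Diag N N := T i j e * T e k l * T i j e * T e k l

theorem eq_mul_of_sq {M : Type*} [Monoid M] {a b c : M} (ha : a * a = 1) (h : a * b = c) : b = a * c := by
  rw [← h, ← mul_assoc, ha, one_mul]

/-- The commutator with the borrowed wire `e` is rewritten as the computation with a clean ancilla
`d`, inserted by factoring `T i j e` through `d`. The result neither mentions `e` nor changes under
the flip, which yields `K_borrow` and `dagger_K`. -/
theorem K_ancilla {N : ℕ} (d e i j k l : Fin N) (h : [d, e, i, j, k, l].Nodup) :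
    Q false d * K e i j k l = Q false d * (T i j d * T d k l * T i j d) * Q false d := by
  have hh : d ≠ e ∧ d ≠ i ∧ d ≠ j ∧ d ≠ k ∧ d ≠ l ∧ e ≠ i ∧ e ≠ j ∧ e ≠ k ∧ e ≠ l ∧ i ≠ j ∧ i ≠ k ∧ i ≠ l ∧
    j ≠ k ∧ j ≠ l ∧ k ≠ l := by simpa [and_assoc] using h
  obtain ⟨hde, hdi, hdj, hdk, hdl, hei, hej, hek, hel, hij, hik, hil, hjk, hjl, hkl⟩ := hh
  have t13 : T i j d * C d e * T i j d = T i j e * C d e := tof_cnot_tof i j d e (by simp; grind)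
  have c1 : T i j e * C d e = C d e * T i j e := T_comm_C _ _ _ _ _ (by grind) (by grind) (by grind)
  have c2 : T i j d * T e k l = T e k l * T i j d := T_comm _ _ _ _ _ _ (by grind) (by grind) (by grind) (by grind)
  have c3 : T i j d * T i j e = T i j e * T i j d := T_comm _ _ _ _ _ _ (by grind) (by grind) (by grind) (by grind)
  have q1 : Q false d * T i j e = T i j e * Q false d := Q_comm_T _ _ _ _ _ hde
  have q2 : Q false d * T e k l = T e k l * Q false d := Q_comm_T _ _ _ _ _ hdl
  have s1 : Q false d * T i j e = Q false d * (T i j d * C d e * T i j d) := by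
    rw [t13, ← mul_assoc, q1, mul_assoc, Q_false_C _ _ hde]
  have s2 : T i j d * T i j e = C d e * T i j d * C d e := by
    have h1 : T i j e = C d e * (T i j d * C d e * T i j d) :=
      eq_mul_of_sq (C_sq d e) (by rw [t13, c1])
    rw [c3, h1]
    simp only [mul_assoc]; rw [T_sq, mul_one]
  have s3 : C d e * T e k l * C d e = T d k l * T e k l := cnot_tof_cnot d e k l (by simp; grind)
  have s4 : Q false d * (T i j e * T e k l * T i j e) =
      Q false d * (T i j d * T d k l * T i j d) * T e k l * C d e := by
    calc _ = Q false d * T i j e * (T e k l * T i j e) := by simp only [mul_assoc]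
      _ = Q false d * T i j d * C d e * (T i j d * T e k l) * T i j e := by
          rw [s1]; simp only [mul_assoc]
      _ = Q false d * T i j d * C d e * T e k l * (T i j d * T i j e) := by
          rw [c2]; simp only [mul_assoc]
      _ = Q false d * T i j d * (C d e * T e k l * C d e) * T i j d * C d e := by
          rw [s2]; simp only [mul_assoc]
      _ = Q false d * T i j d * T d k l * (T e k l * T i j d) * C d e := by
          rw [s3]; simp only [mul_assoc]
      _ = _ := by rw [← c2]; simp only [mul_assoc]
  -- These gates do not modify `d`, so the projection may be repeated on the right, where it erases
  -- the remaining `C d e`.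
  have s5 : Q false d * (T i j e * T e k l * T i j e) =
      Q false d * (T i j e * T e k l * T i j e) * Q false d := by
    have hc : Commute (Q false d) (T i j e * T e k l * T i j e) :=
      (Commute.mul_right (show Commute (Q false d) (T i j e) from q1) q2).mul_right q1
    rw [mul_assoc (Q false d) _ (Q false d), ← hc.eq, ← mul_assoc (Q false d) (Q false d), Q_sq]
  calc Q false d * K e i j k l = Q false d * (T i j e * T e k l * T i j e) * T e k l := by
        rw [K]; simp only [mul_assoc]
    _ = Q false d * (T i j d * T d k l * T i j d) * T e k l * (C d e * Q false d) * T e k l := by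
        rw [s5, s4]; simp only [mul_assoc]
    _ = Q false d * (T i j d * T d k l * T i j d) * (T e k l * Q false d) * T e k l := by
        rw [C_Q_false _ _ hde]; simp only [mul_assoc]
    _ = Q false d * (T i j d * T d k l * T i j d) * Q false d * (T e k l * T e k l) := by
        rw [← q2]; simp only [mul_assoc]
    _ = _ := by rw [T_sq, mul_one]

theorem nodup_castSucc {N : ℕ} {l : List (Fin N)} (h : l.Nodup) :
    (Fin.last N :: l.map Fin.castSucc).Nodup := by
  refine List.nodup_cons.2 ⟨?_, h.map (Fin.castSucc_injective N)⟩
  simp [Fin.castSucc_ne_last]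

theorem above_one_K {N : ℕ} (e i j k l : Fin N) : above N 1 (K e i j k l) =
    K e.castSucc i.castSucc j.castSucc k.castSucc l.castSucc := by
  simp only [K, map_mul, above_one_T]

theorem Q_comm_K {N : ℕ} (b : Bool) (d e i j k l : Fin N) (hde : d ≠ e) (hdl : d ≠ l) :
    Q b d * K e i j k l = K e i j k l * Q b d := by
  have q1 : Q b d * T i j e = T i j e * Q b d := Q_comm_T _ _ _ _ _ hde
  have q2 : Q b d * T e k l = T e k l * Q b d := Q_comm_T _ _ _ _ _ hdl
  have q1' := Commute.mul_right (show Commute (Q b d) (T i j e) from q1) q2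
  have := (q1'.mul_right q1).mul_right q2
  exact this

/-- The ancilla form of the gate is a palindrome of self-adjoint gates. -/
theorem dagger_K {N : ℕ} (e i j k l : Fin N) (h : [e, i, j, k, l].Nodup) :
    dagger (K e i j k l) = K e i j k l := by
  refine cancel_ancilla false ?_
  have h1 := nodup_castSucc h
  have h2 := K_ancilla _ _ _ _ _ _ h1
  have h3 := congrArg dagger h2
  have hc := Q_comm_K false (Fin.last N) e.castSucc i.castSucc j.castSucc k.castSucc l.castSucc
    (last_ne _) (last_ne _)
  have hc' := congrArg dagger hc
  simp only [dagger_mul, dagger_Q, dagger_T] at h3 hc'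
  rw [← dagger_above, above_one_K, ← hc', h3, h2]
  simp only [mul_assoc]

/-- Both sides have the same ancilla form, in which the borrowed wire no longer occurs. -/
theorem K_borrow {N : ℕ} (e e' i j k l : Fin N) (h : [e, i, j, k, l].Nodup) (h' : [e', i, j, k, l].Nodup) :
    K e i j k l = K e' i j k l := by
  refine cancel_ancilla false ?_
  rw [above_one_K, above_one_K, K_ancilla _ _ _ _ _ _ (nodup_castSucc h),
    K_ancilla _ _ _ _ _ _ (nodup_castSucc h')]

theorem K_eq_rev {N : ℕ} (e i j k l : Fin N) (h : [e, i, j, k, l].Nodup) :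
    K e i j k l = T e k l * T i j e * T e k l * T i j e := by
  rw [← dagger_K e i j k l h, K]
  simp only [dagger_mul, dagger_T, mul_assoc]

/-- The three controls computed with an ancilla. -/
theorem Q_false_K {N : ℕ} (e i j k l : Fin N) (h : [e, i, j, k, l].Nodup) :
    Q false e * K e i j k l = Q false e * (T i j e * T e k l * T i j e) := by
  have : [e, k, l].Nodup := by simp at h ⊢; grind
  rw [K_eq_rev e i j k l h]
  simp only [← mul_assoc]
  rw [Q_false_T _ _ _ this]

theorem K_symm_left {N : ℕ} (e i j k l : Fin N) : K e i j k l = K e j i k l := by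
  rw [K, K, T_symm i j]

/-- The ancilla in the middle of five wires. -/
theorem ket_middle (b : Bool) : (one 2 ⊛ bit b ⊛ one 2 : Diag 4 5) =
    addKet 4 b ⊚ (S 3 4 * S 2 3) := by
  have e1 : (S 3 4 : Diag 5 5) = below 3 2 (mk (.swap 1 1)) := by rw [mk_swap_eq, below_S]; rfl
  have e2 : (S 2 3 : Diag 5 5) = below 2 2 (mk (.swap 1 1)) ⊛ one 1 := by
    
    rw [mk_swap_eq, below_S]; exact (above_S 1 (2 : Fin 4) 3).symm
  have h1 : addKet 4 b ⊚ below 3 2 (mk (.swap 1 1)) = (one 3 ⊛ (bit b ⊛ one 1) : Diag 4 5) := by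
    rw [← ket_swap]
    refine Eq.trans ?_ (one_tens_comp (one 1 ⊛ bit b) (mk (.swap 1 1)) 3).symm
    refine congrArg (fun x : Diag 4 5 => x ⊚ (one 3 ⊛ mk (.swap 1 1) : Diag 5 5)) ?_
    show (one 4 ⊛ bit b : Diag 4 5) = _
    rw [← one_tens_one 3 1]
    exact tens_assoc (one 3) (one 1) (bit b)
  have h2 : (one 3 ⊛ (bit b ⊛ one 1) : Diag 4 5) = ((one 2 ⊛ (one 1 ⊛ bit b)) ⊛ one 1 : Diag 4 5) := by
    refine (tens_assoc (one 3) (bit b) (one 1)).symm.trans ?_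
    refine congrArg (fun x : Diag 3 4 => (x ⊛ one 1 : Diag 4 5)) ?_
    rw [← one_tens_one 2 1]
    exact tens_assoc (one 2) (one 1) (bit b)
  rw [e1, e2, mul_def, ← assoc, h1, h2]
  refine Eq.trans ?_ (tens_one_comp (one 2 ⊛ (one 1 ⊛ bit b)) (below 2 2 (mk (.swap 1 1))) 1)
  have h3 : (one 2 ⊛ (one 1 ⊛ bit b) : Diag 3 4) ⊚ below 2 2 (mk (.swap 1 1)) =
      (one 2 ⊛ (bit b ⊛ one 1) : Diag 3 4) :=
    (one_tens_comp (one 1 ⊛ bit b) (mk (.swap 1 1)) 2).symm.trans (by rw [ket_swap])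
  rw [h3]
  refine Eq.trans ?_ (congrArg (fun x : Diag 3 4 => (x ⊛ one 1 : Diag 4 5)) (tens_assoc (one 2) (bit b) (one 1)))
  refine Eq.trans ?_ (tens_assoc (one 2 ⊛ bit b) (one 1) (one 1)).symm
  rw [one_tens_one 1 1]

/-- `Identity.tof16` enclosed between `⟨0|` and `|0⟩` on the ancilla: the compressed circuit becomes
one on five wires between projections. The swap of wires 1 and 2 becomes a swap of 1 and 3, because
the ancilla stands between them. -/
theorem K_ancilla_symm :
    Q false (2 : Fin 5) * (T 0 1 2 * T 2 3 4 * T 0 1 2) * Q false 2 =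
      Q false (2 : Fin 5) * (T 0 3 2 * T 2 1 4 * T 0 3 2) * Q false 2 := by
  let A : Diag 4 5 := one 2 ⊛ bit false ⊛ one 2
  let L : Diag 5 5 := T 0 1 2 * T 2 3 4 * T 0 1 2
  have hA : A = addKet 4 false ⊚ (S 3 4 * S 2 3) := ket_middle false
  have hBA : dagger A ⊚ A = Q false 2 := by
    rw [hA, dagger_comp, dagger_mul, dagger_S, dagger_S, dagger_addKet, assoc, ← assoc (addBra 4 false),
      addBra_addKet]
    show (S 2 3 * S 3 4) * (Q false 4 * (S 3 4 * S 2 3)) = _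
    have h1 : (S 3 4 : Diag 5 5) * Q false 4 = Q false 3 * S 3 4 := S_mul_Q _ _ _
    have h2 : (S 2 3 : Diag 5 5) * Q false 3 = Q false 2 * S 2 3 := S_mul_Q _ _ _
    rw [mul_assoc, ← mul_assoc (S 3 4), h1, mul_assoc, ← mul_assoc (S 3 4), S_sq, one_mul, ← mul_assoc, h2,
      mul_assoc, S_sq, mul_one]
  have hs : S 1 2 ⊚ A = A ⊚ S 1 3 := by
    have h1 : (S 1 2 : Diag 5 5) * (S 3 4 * S 2 3) = S 3 4 * S 2 3 * S 1 3 := by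
      simp only [S_eq_perm, ← map_mul]
      exact congrArg perm (by decide)
    rw [hA, ← assoc, comp_addKet, above_one_S, assoc]
    exact (congrArg (fun x => addKet 4 false ⊚ x) h1).trans (assoc _ _ _).symm
  have hs' : dagger A ⊚ S 1 2 = S 1 3 ⊚ dagger A := by
    have := congrArg dagger hs
    rwa [dagger_comp, dagger_comp, dagger_S, dagger_S] at this
  have h := mk_eq (.ofIdentity .tof16)
  have hκ : mk Circ.threeControl = A ⊚ L ⊚ dagger A := by
    have hB : dagger A = (one 2 ⊛ mk Circ.bra0 ⊛ one 2 : Diag 5 4) := by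
      show (one 2 ⊛ mk (Circ.dagger Circ.ket0) ⊛ one 2 : Diag 5 4) = _
      rw [dagger_ket0]
    have hL : L = above 3 2 (mk Circ.tof) * below 2 3 (mk Circ.tof) * above 3 2 (mk Circ.tof) := by
      rw [mk_tof_eq, above_T, below_T]; rfl
    rw [hB, hL]
    refine Eq.trans (b := A ⊚ above 3 2 (mk Circ.tof) ⊚ below 2 3 (mk Circ.tof) ⊚ above 3 2 (mk Circ.tof) ⊚
      (one 2 ⊛ mk Circ.bra0 ⊛ one 2 : Diag 5 4)) rfl ?_
    simp only [mul_def, assoc]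
  have hsw : mk (Circ.tensor (Circ.tensor (.id 1) (.swap 1 1)) (.id 1)) = S (1 : Fin 4) 2 := by
    show above 3 1 (below 1 2 (mk (.swap 1 1))) = _
    rw [mk_swap_eq, below_S, above_S]; rfl
  replace h : mk Circ.threeControl = S 1 2 ⊚ mk Circ.threeControl ⊚ S 1 2 := by
    rw [← hsw]; exact h
  rw [hκ] at h
  have h2 := congrArg (fun x => dagger A ⊚ x ⊚ A) h
  have e1 : dagger A ⊚ (A ⊚ L ⊚ dagger A) ⊚ A = Q false 2 * L * Q false 2 := by
    rw [mul_def, mul_def, ← hBA]; simp only [assoc]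
  have e2 : dagger A ⊚ (S 1 2 ⊚ (A ⊚ L ⊚ dagger A) ⊚ S 1 2) ⊚ A =
      S 1 3 * (Q false 2 * L * Q false 2) * S 1 3 := by
    calc _ = (dagger A ⊚ S 1 2) ⊚ (A ⊚ L ⊚ dagger A) ⊚ (S 1 2 ⊚ A) := by simp only [assoc]
      _ = _ := by rw [hs, hs', ← e1]; simp only [mul_def, assoc]
  have e3 : Q false 2 * L * Q false 2 = S 1 3 * (Q false 2 * L * Q false 2) * S 1 3 :=
    e1.symm.trans (h2.trans e2)
  refine e3.trans ?_
  have hp : S (1 : Fin 5) 3 = perm (Equiv.swap 1 3) := S_eq_perm _ _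
  have hQ : S (1 : Fin 5) 3 * Q false 2 = Q false 2 * S 1 3 := by rw [hp, perm_mul_Q]; rfl
  have hL' : S (1 : Fin 5) 3 * L = T 0 3 2 * T 2 1 4 * T 0 3 2 * S 1 3 := by
    have t1 : S (1 : Fin 5) 3 * T 0 1 2 = T 0 3 2 * S 1 3 := by rw [hp, perm_mul_T]; rfl
    have t2 : S (1 : Fin 5) 3 * T 2 3 4 = T 2 1 4 * S 1 3 := by rw [hp, perm_mul_T]; rfl
    show S (1 : Fin 5) 3 * (T 0 1 2 * T 2 3 4 * T 0 1 2) = _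
    rw [← mul_assoc, ← mul_assoc, t1, mul_assoc (T 0 3 2), t2, ← mul_assoc, mul_assoc _ (S 1 3), t1, ← mul_assoc]
  rw [← mul_assoc, ← mul_assoc, hQ, mul_assoc (Q false 2) (S 1 3), hL', mul_assoc _ (Q false 2), ← hQ,
    mul_assoc, mul_assoc _ (S 1 3), ← mul_assoc (S 1 3), S_sq, one_mul, ← mul_assoc]

/-- In ancilla form this is `K_ancilla_symm` placed with a new wire as the middle one. -/
theorem K_symm_right {N : ℕ} (e i j k l : Fin N) (h : [e, i, j, k, l].Nodup) : K e i j k l = K e i k j l := by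
  have h' : [e, i, k, j, l].Nodup := by simp at h ⊢; grind
  refine cancel_ancilla false ?_
  rw [above_one_K, above_one_K, K_ancilla _ _ _ _ _ _ (nodup_castSucc h),
    K_ancilla _ _ _ _ _ _ (nodup_castSucc h')]
  have hσ : Function.Injective ![i.castSucc, j.castSucc, Fin.last N, k.castSucc, l.castSucc] := by
    refine injective_of_nodup ?_
    have := nodup_castSucc h
    simp at this ⊢; grind
  have := congrArg (place ![i.castSucc, j.castSucc, Fin.last N, k.castSucc, l.castSucc]) K_ancilla_symm
  simp only [map_mul, place_Q hσ, place_T hσ] at this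
  exact this

/-! ### Commutation with the not gate with three controls -/

theorem above_one_injective {N : ℕ} {f g : Diag N N} (h : above N 1 f = above N 1 g) : f = g :=
  cancel_ancilla false (by rw [h])

theorem above_one_K_last {N : ℕ} (e i j k l : Fin N) (h : [e, i, j, k, l].Nodup) : above N 1 (K e i j k l) =
    K (Fin.last N) i.castSucc j.castSucc k.castSucc l.castSucc := by
  rw [above_one_K]
  refine K_borrow _ _ _ _ _ _ ?_ ?_
  · simpa using h.map (Fin.castSucc_injective N)
  · have := nodup_castSucc h
    simp at this ⊢; grind

/-- The borrowed wire may be replaced by a new one that `f` cannot touch, so conditions relating `f`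
to `e` disappear. -/
theorem commute_K {N : ℕ} (e i j k l : Fin N) (h : [e, i, j, k, l].Nodup) (f : Diag N N)
    (h1 : Commute (above N 1 f) (T i.castSucc j.castSucc (Fin.last N)))
    (h2 : Commute (above N 1 f) (T (Fin.last N) k.castSucc l.castSucc)) : Commute f (K e i j k l) := by
  refine above_one_injective ?_
  rw [map_mul, map_mul, above_one_K_last _ _ _ _ _ h]
  exact ((h1.mul_right h2).mul_right h1).mul_right h2

theorem Q_comm_K' {N : ℕ} (b : Bool) (d e i j k l : Fin N) (h : [e, i, j, k, l].Nodup) (hdl : d ≠ l) :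
    Q b d * K e i j k l = K e i j k l * Q b d := by
  refine commute_K _ _ _ _ _ h _ ?_ ?_ <;> rw [above_one_Q]
  · exact Q_comm_T _ _ _ _ _ (last_ne _).symm
  · exact Q_comm_T _ _ _ _ _ ((Fin.castSucc_injective N).ne hdl)

theorem T_comm_K {N : ℕ} (a b c e i j k l : Fin N) (h : [e, i, j, k, l].Nodup) (hci : c ≠ i) (hcj : c ≠ j)
    (hck : c ≠ k) (hla : l ≠ a) (hlb : l ≠ b) : T a b c * K e i j k l = K e i j k l * T a b c := by
  have hs := Fin.castSucc_injective N
  refine commute_K _ _ _ _ _ h _ ?_ ?_ <;> rw [above_one_T]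
  · exact T_comm _ _ _ _ _ _ (hs.ne hci) (hs.ne hcj) (last_ne _) (last_ne _)
  · exact T_comm _ _ _ _ _ _ (last_ne _).symm (hs.ne hck) (hs.ne hla) (hs.ne hlb)

theorem C_comm_K {N : ℕ} (a c e i j k l : Fin N) (h : [e, i, j, k, l].Nodup) (hci : c ≠ i) (hcj : c ≠ j)
    (hck : c ≠ k) (hla : l ≠ a) : C a c * K e i j k l = K e i j k l * C a c := by
  have hs := Fin.castSucc_injective N
  refine commute_K _ _ _ _ _ h _ ?_ ?_ <;> rw [above_one_C]
  · exact (T_comm_C _ _ _ _ _ (last_ne _) (hs.ne hci) (hs.ne hcj)).symm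
  · exact (T_comm_C _ _ _ _ _ (hs.ne hla) (last_ne _).symm (hs.ne hck)).symm

theorem K_comm_K {N : ℕ} (a b c d m e i j k l : Fin N) (h' : [a, b, c, d, m].Nodup) (h : [e, i, j, k, l].Nodup)
    (hmi : m ≠ i) (hmj : m ≠ j) (hmk : m ≠ k) (hlb : l ≠ b) (hlc : l ≠ c) (hld : l ≠ d) :
    K a b c d m * K e i j k l = K e i j k l * K a b c d m := by
  have hs := Fin.castSucc_injective N
  have h'' := nodup_castSucc h'
  have h3 : [Fin.last N, b.castSucc, c.castSucc, d.castSucc, m.castSucc].Nodup := by simp at h'' ⊢; grind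
  refine commute_K _ _ _ _ _ h _ ?_ ?_ <;> rw [above_one_K]
  · exact (T_comm_K _ _ _ _ _ _ _ _ (by simpa using h'.map hs) (last_ne _) (last_ne _) (last_ne _)
      (hs.ne hmi) (hs.ne hmj)).symm
  · exact (T_comm_K _ _ _ _ _ _ _ _ (by simpa using h'.map hs) (hs.ne hlb) (hs.ne hlc) (hs.ne hld)
      (last_ne _).symm (hs.ne hmk)).symm

/-- With `e` clean, `K` is one Toffoli gate conjugated by another. Moving `C l a` through copies the
inner gate onto the target `a`, and the two inner gates separate into two three-control gates. -/
theorem Q_false_K_mul_C {N : ℕ} (e i j k l a : Fin N) (h : [e, i, j, k, l, a].Nodup) :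
    Q false e * (K e i j k l * C l a) = Q false e * (C l a * (K e i j k a * K e i j k l)) := by
  have h1 : [e, i, j, k, l].Nodup := by simp at h ⊢; grind
  have h2 : [e, i, j, k, a].Nodup := by simp at h ⊢; grind
  have hh : e ≠ i ∧ e ≠ j ∧ e ≠ k ∧ e ≠ l ∧ e ≠ a ∧ i ≠ j ∧ i ≠ k ∧ i ≠ l ∧ i ≠ a ∧
    j ≠ k ∧ j ≠ l ∧ j ≠ a ∧ k ≠ l ∧ k ≠ a ∧ l ≠ a := by simpa [and_assoc] using h
  obtain ⟨hei, hej, hek, hel, hea, hij, hik, hil, hia, hjk, hjl, hja, hkl, hka, hla⟩ := hh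
  have t1 : T e k l * C l a * T e k l = T e k a * C l a := tof_cnot_tof e k l a (by simp; grind)
  have t2 : T e k a * C l a = C l a * T e k a := T_comm_C _ _ _ _ _ (by grind) (by grind) (by grind)
  have t3 : T i j e * C l a = C l a * T i j e := T_comm_C _ _ _ _ _ (by grind) (by grind) (by grind)
  have t4 : T e k l * C l a = C l a * T e k a * T e k l := by
    rw [← t2, ← t1, mul_assoc _ (T e k l), T_sq, mul_one]
  have q1 : Q false e * C l a = C l a * Q false e := Q_comm_C _ _ _ _ hea
  have q2 : Q false e * K e i j k a = K e i j k a * Q false e := Q_comm_K' _ _ _ _ _ _ _ h2 hea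
  calc _ = Q false e * T i j e * T e k l * (T i j e * C l a) := by
        rw [← mul_assoc, Q_false_K _ _ _ _ _ h1]; simp only [mul_assoc]
    _ = Q false e * T i j e * (T e k l * C l a) * T i j e := by rw [t3]; simp only [mul_assoc]
    _ = Q false e * (T i j e * C l a) * T e k a * T e k l * T i j e := by rw [t4]; simp only [mul_assoc]
    -- The factor 1 is to be replaced by `T i j e * T i j e`, which completes both gates.
    _ = C l a * (Q false e * (T i j e * T e k a * 1 * T e k l * T i j e)) := by
        rw [t3, ← mul_assoc (Q false e), q1]; simp only [mul_assoc, one_mul]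
    _ = C l a * (Q false e * K e i j k a * (T i j e * T e k l * T i j e)) := by
        rw [Q_false_K _ _ _ _ _ h2, ← T_sq i j e]; simp only [mul_assoc]
    _ = C l a * (K e i j k a * (Q false e * K e i j k l)) := by
        rw [q2, Q_false_K _ _ _ _ _ h1]; simp only [mul_assoc]
    _ = _ := by
        rw [← mul_assoc (K _ _ _ _ a), ← q2, ← mul_assoc (Q false e) (C l a), q1]; simp only [mul_assoc]

/-- If wire `l` is an ancilla, adding it to wire `a` after the computation amounts to a computation on `a`. -/
theorem Q_false_K_C {N : ℕ} (e i j k l a : Fin N) (h : [e, i, j, k, l, a].Nodup) :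
    Q false l * K e i j k l * C l a = Q false l * K e i j k l * K e i j k a := by
  have h1 : [e, i, j, k, l].Nodup := by simp at h ⊢; grind
  have h2 : [e, i, j, k, a].Nodup := by simp at h ⊢; grind
  -- Borrowing a new clean wire instead of `e` removes the assumption that `e` is clean.
  have hc : K e i j k l * C l a = C l a * (K e i j k a * K e i j k l) := by
    refine cancel_ancilla false ?_
    simp only [map_mul, above_one_K_last _ _ _ _ _ h1, above_one_K_last _ _ _ _ _ h2, above_one_C]
    have := nodup_castSucc h
    exact Q_false_K_mul_C _ _ _ _ _ _ (by simp at this ⊢; grind)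
  have hc' : K e i j k a * K e i j k l = K e i j k l * K e i j k a := by
    refine K_comm_K _ _ _ _ _ _ _ _ _ _ h2 h1 ?_ ?_ ?_ ?_ ?_ ?_ <;> · simp at h; grind
  rw [mul_assoc, hc, ← mul_assoc, Q_false_C _ _ (by simp at h; grind), hc', mul_assoc]

/-- The word computation of `U_U_U_aux` in a bare monoid: Toffoli gates are collected before
controlled nots, and the corrections created on the way are three-control gates, moved to the front.
-/
theorem S1_aux {M : Type*} [Monoid M] {r q ta tb tc t' ca cb cc Ka Kb Kc d : M} (f1 : ca * tb = t' * tb * ca)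
    (g1 : tc * cb = cb * tc) (g2 : tc * ca = ca * tc) (g3 : tc * tb = tb * tc) (g4 : tc * t' = t' * tc)
    (f2 : ta * tc = Kc * tc * ta) (f3 : ta * t' = Kb * t' * ta) (q1 : q * tc = q) (q2 : q * t' = q)
    (h1 : q * Kb = Kb * q) (h2 : q * Kc = Kc * q) (h3 : r * q = q * r)
    (k1 : cb * cc = cc * cb) (k2 : ca * cc = cc * ca * d) (k3 : cc * tb = tb * cc) (k4 : cc * ta = ta * cc)
    (k5 : cc * Kb = Kb * cc) (k9 : r * Kc * cc = r * Kc * Ka) (k10 : d * cb = cb * d) :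
    r * q * (ta * ca) * (tb * cb) * (tc * cc) = r * q * (Kc * Ka * Kb) * (ta * tb) * (ca * cb) * d := by
  have s1 : ta * ca * (tb * cb) * (tc * cc) = (ta * tc * t') * (tb * ca * cb * cc) := by
    calc _ = ta * (ca * tb) * cb * tc * cc := by simp only [mul_assoc]
      _ = ta * t' * tb * ca * (tc * cb) * cc := by rw [f1, g1]; simp only [mul_assoc]
      _ = ta * t' * tb * (tc * ca) * cb * cc := by rw [g2]; simp only [mul_assoc]
      _ = ta * t' * (tc * tb) * ca * cb * cc := by rw [g3]; simp only [mul_assoc]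
      _ = ta * (tc * t') * tb * ca * cb * cc := by rw [g4]; simp only [mul_assoc]
      _ = _ := by simp only [mul_assoc]
  have s2 : q * (ta * tc * t') = q * Kc * Kb * ta := by
    calc q * (ta * tc * t') = q * Kc * tc * (ta * t') := by rw [f2]; simp only [mul_assoc]
      _ = Kc * (q * tc) * Kb * t' * ta := by rw [f3, h2]; simp only [mul_assoc]
      _ = Kc * Kb * (q * t') * ta := by rw [q1, mul_assoc Kc, h1]; simp only [mul_assoc]
      _ = _ := by rw [q2, h2, mul_assoc Kc q, h1]; simp only [mul_assoc]
  have s3 : ca * cb * cc = cc * (ca * cb * d) := by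
    rw [mul_assoc, k1, ← mul_assoc, k2, mul_assoc _ d, k10]; simp only [mul_assoc]
  calc _ = r * q * (ta * ca * (tb * cb) * (tc * cc)) := by simp only [mul_assoc]
    _ = r * (q * (ta * tc * t')) * (tb * ca * cb * cc) := by rw [s1]; simp only [mul_assoc]
    _ = r * q * Kc * Kb * ta * tb * (ca * cb * cc) := by rw [s2]; simp only [mul_assoc]
    _ = q * r * Kc * Kb * ta * tb * cc * (ca * cb * d) := by rw [s3, h3]; simp only [mul_assoc]
    _ = q * (r * Kc * cc) * Kb * ta * tb * (ca * cb * d) := by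
        simp only [mul_assoc]
        rw [← mul_assoc tb cc, ← k3, mul_assoc, ← mul_assoc ta cc, ← k4, mul_assoc, ← mul_assoc Kb cc, ← k5,
          mul_assoc]
    _ = _ := by rw [k9, h3]; simp only [mul_assoc]

/-! ### Splitting a flag -/

/-- The gate moving the flag `y` to the wire `a` when wire `x` carries `|1⟩`, if `a` carries `|0⟩`. -/
noncomputable def U {N : ℕ} (y x a : Fin N) : Diag N N := T y x a * C a y

theorem T_mul_T {N : ℕ} (y x a d : Fin N) (h : [y, x, a, d].Nodup) :
    T y x a * T a x d = T a x d * T y x d * T y x a := by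
  have hh : y ≠ x ∧ y ≠ a ∧ y ≠ d ∧ x ≠ a ∧ x ≠ d ∧ a ≠ d := by simpa [and_assoc] using h
  obtain ⟨hyx, hya, hyd, hxa, hxd, had⟩ := hh
  have e1 : T y x a * T x a d * T y x a = T y x d * T x a d := tof_tof_tof y x a d h
  have e2 : T y x d * T a x d = T a x d * T y x d := T_comm _ _ _ _ _ _ (by grind) (by grind) (by grind) (by grind)
  rw [T_symm x a] at e1
  rw [← e2, ← e1, mul_assoc, T_sq, mul_one]

/-- A split flag: `y` then implies that wire `x` carries `|0⟩`. -/
theorem Q_false_U_T {N : ℕ} (y x a d : Fin N) (h : [y, x, a, d].Nodup) :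
    Q false a * U y x a * T y x d = Q false a * U y x a := by
  have hh : y ≠ x ∧ y ≠ a ∧ y ≠ d ∧ x ≠ a ∧ x ≠ d ∧ a ≠ d := by simpa [and_assoc] using h
  obtain ⟨hyx, hya, hyd, hxa, hxd, had⟩ := hh
  have e1 : C a y * T y x d * C a y = T a x d * T y x d := cnot_tof_cnot a y x d (by simp; grind)
  have e2 := T_mul_T y x a d h
  have e3 : T y x a * T y x d = T y x d * T y x a := T_comm _ _ _ _ _ _ (by grind) (by grind) (by grind) (by grind)
  have e4 : Q false a * T a x d = Q false a := Q_false_T _ _ _ (by simp; grind)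
  have e5 : C a y * T y x d = T a x d * T y x d * C a y := by rw [← e1, mul_assoc, C_sq, mul_one]
  calc _ = Q false a * T y x a * (C a y * T y x d) := by rw [U]; simp only [mul_assoc]
    _ = Q false a * (T y x a * T a x d) * T y x d * C a y := by rw [e5]; simp only [mul_assoc]
    _ = (Q false a * T a x d) * T y x d * (T y x a * T y x d) * C a y := by rw [e2]; simp only [mul_assoc]
    _ = Q false a * (T y x d * T y x d) * T y x a * C a y := by rw [e3, e4]; simp only [mul_assoc]
    _ = _ := by rw [T_sq, mul_one, U, mul_assoc]

/-- A split flag: `a` then implies that wire `x` carries `|1⟩`. -/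
theorem Q_false_U_T' {N : ℕ} (y x a d : Fin N) (h : [y, x, a, d].Nodup) :
    Q false a * U y x a * T a x d = Q false a * U y x a * C a d := by
  have hh : y ≠ x ∧ y ≠ a ∧ y ≠ d ∧ x ≠ a ∧ x ≠ d ∧ a ≠ d := by simpa [and_assoc] using h
  obtain ⟨hyx, hya, hyd, hxa, hxd, had⟩ := hh
  have e2 := T_mul_T y x a d h
  have e4 : Q false a * T a x d = Q false a := Q_false_T _ _ _ (by simp; grind)
  have e6 : C a y * T a x d = T a x d * C a y :=
    (T_comm_C _ _ _ _ _ (by grind) (by grind) (by grind)).symm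
  have e7 : C a y * C a d = C a d * C a y := C_comm_C _ _ _ _ (by grind) (by grind)
  have e8 : T y x a * C a d * T y x a = T y x d * C a d := tof_cnot_tof y x a d h
  have e9 : T y x d * C a d = C a d * T y x d := T_comm_C _ _ _ _ _ (by grind) (by grind) (by grind)
  have e10 : T y x a * C a d = C a d * T y x d * T y x a := by rw [← e9, ← e8, mul_assoc, T_sq, mul_one]
  have e11 : Q false a * C a d = Q false a := Q_false_C _ _ had
  calc _ = Q false a * (T y x a * T a x d) * C a y := by
        rw [U, mul_assoc, mul_assoc, e6]; simp only [mul_assoc]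
    _ = Q false a * (C a d * T y x d * T y x a) * C a y := by
        rw [e2]; simp only [← mul_assoc]; rw [e4, e11]
    _ = Q false a * T y x a * (C a d * C a y) := by rw [← e10]; simp only [mul_assoc]
    _ = _ := by rw [← e7, U]; simp only [mul_assoc]

/-- A normal form of the double splitting in which `i, a` and `j, b` play the same role: the
conjunction of `y`, `i`, `j` is added to `a`, `b`, `c`, the two single conjunctions to `a` and `b`,
and finally all three new flags to `y`. -/
theorem U_U_U_aux {N : ℕ} (y i j a b c : Fin N) (h : [y, i, j, a, b, c].Nodup) :
    Q false c * Q false a * U y i a * U y j b * U a j c =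
      Q false c * Q false a * (K b y i j c * K b y i j a * K c y i j b) * (T y i a * T y j b) *
        (C a y * C b y) * C c y := by
  have hh : y ≠ i ∧ y ≠ j ∧ y ≠ a ∧ y ≠ b ∧ y ≠ c ∧ i ≠ j ∧ i ≠ a ∧ i ≠ b ∧ i ≠ c ∧
    j ≠ a ∧ j ≠ b ∧ j ≠ c ∧ a ≠ b ∧ a ≠ c ∧ b ≠ c := by simpa [and_assoc] using h
  obtain ⟨hyi, hyj, hya, hyb, hyc, hij, hia, hib, hic, hja, hjb, hjc, hab, hac, hbc⟩ := hh
  have n1 : [b, y, i, j, c].Nodup := by simp; grind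
  have n2 : [c, y, i, j, b].Nodup := by simp; grind
  have n3 : [a, y, i, j, c].Nodup := by simp; grind
  have n4 : [a, y, i, j, b].Nodup := by simp; grind
  -- Exchanging the two Toffoli gates leaves their commutator, a three-control gate borrowing `a`;
  -- the borrowed wire is then changed to `e`.
  have key (d e : Fin N) (n : [a, y, i, j, d].Nodup) (n' : [e, y, i, j, d].Nodup) :
      T y i a * T a j d = K e y i j d * T a j d * T y i a := by
    rw [K_borrow e a _ _ _ _ n' n, K]
    simp only [mul_assoc]
    rw [← mul_assoc (T a j d) (T a j d), T_sq, one_mul, T_sq, mul_one]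
  simp only [U]
  refine S1_aux (t' := T a j b) ?_ ?_ ?_ ?_ ?_ (key c b n3 n1) (key b c n4 n2) ?_ ?_ ?_ ?_ ?_ ?_ ?_ ?_ ?_ ?_ ?_ ?_
  · rw [← cnot_tof_cnot a y j b (by simp; grind), mul_assoc, C_sq, mul_one]
  · exact T_comm_C _ _ _ _ _ (by grind) (by grind) (by grind)
  · exact T_comm_C _ _ _ _ _ (by grind) (by grind) (by grind)
  · exact T_comm _ _ _ _ _ _ (by grind) (by grind) (by grind) (by grind)
  · exact T_comm _ _ _ _ _ _ (by grind) (by grind) (by grind) (by grind)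
  · exact Q_false_T _ _ _ (by simp; grind)
  · exact Q_false_T _ _ _ (by simp; grind)
  · exact Q_comm_K' _ _ _ _ _ _ _ n2 (by grind)
  · exact Q_comm_K' _ _ _ _ _ _ _ n1 (by grind)
  · exact Q_comm_Q _ _ _ _ (by grind)
  · exact C_comm_C _ _ _ _ (by grind) (by grind)
  · have e1 : C c a * C a y * C c a = C c y * C a y := cnot_conj_cnot c a y (by simp; grind)
    have e2 : C c y * C a y = C a y * C c y := C_comm_C _ _ _ _ (by grind) (by grind)
    rw [mul_assoc, ← e2, ← e1, ← mul_assoc, ← mul_assoc, C_sq, one_mul]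
  · exact (T_comm_C _ _ _ _ _ (by grind) (by grind) (by grind)).symm
  · exact (T_comm_C _ _ _ _ _ (by grind) (by grind) (by grind)).symm
  · exact C_comm_K _ _ _ _ _ _ _ n2 (by grind) (by grind) (by grind) (by grind)
  · exact Q_false_K_C _ _ _ _ _ _ (by simp; grind)
  · exact C_comm_C _ _ _ _ (by grind) (by grind)

/-- Splitting a flag by two wires, in either order. -/
theorem U_U_U {N : ℕ} (y i j a b c : Fin N) (h : [y, i, j, a, b, c].Nodup) :
    Q false a * Q false b * Q false c * U y i a * U y j b * U a j c =
      Q false a * Q false b * Q false c * U y j b * U y i a * U b i c := by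
  have hh : y ≠ i ∧ y ≠ j ∧ y ≠ a ∧ y ≠ b ∧ y ≠ c ∧ i ≠ j ∧ i ≠ a ∧ i ≠ b ∧ i ≠ c ∧
    j ≠ a ∧ j ≠ b ∧ j ≠ c ∧ a ≠ b ∧ a ≠ c ∧ b ≠ c := by simpa [and_assoc] using h
  obtain ⟨hyi, hyj, hya, hyb, hyc, hij, hia, hib, hic, hja, hjb, hjc, hab, hac, hbc⟩ := hh
  have qab : Q false a * Q false b = Q false b * Q false a := Q_comm_Q _ _ _ _ hab
  have qac : Q false a * Q false c = Q false c * Q false a := Q_comm_Q _ _ _ _ hac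
  have qbc : Q false b * Q false c = Q false c * Q false b := Q_comm_Q _ _ _ _ hbc
  have z1 : Q false a * Q false b * Q false c = Q false b * (Q false c * Q false a) := by
    rw [qab, mul_assoc, qac]
  have z2 : Q false a * Q false b * Q false c = Q false a * (Q false c * Q false b) := by
    rw [mul_assoc, qbc]
  have r1 := U_U_U_aux y i j a b c h
  have r2 := U_U_U_aux y j i b a c (by simp; grind)
  -- Symmetry in the controls and freedom of the borrowed wire identify the two normal forms.
  have k1 : K a y j i c = K b y i j c := by
    rw [K_symm_right _ _ _ _ _ (by simp; grind)]
    exact K_borrow _ _ _ _ _ _ (by simp; grind) (by simp; grind)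
  have k2 : K a y j i b = K c y i j b := by
    rw [K_symm_right _ _ _ _ _ (by simp; grind)]
    exact K_borrow _ _ _ _ _ _ (by simp; grind) (by simp; grind)
  have k3 : K c y j i a = K b y i j a := by
    rw [K_symm_right _ _ _ _ _ (by simp; grind)]
    exact K_borrow _ _ _ _ _ _ (by simp; grind) (by simp; grind)
  have k4 : K b y i j a * K c y i j b = K c y i j b * K b y i j a :=
    K_comm_K _ _ _ _ _ _ _ _ _ _ (by simp; grind) (by simp; grind) (by grind) (by grind) (by grind) (by grind)
      (by grind) (by grind)
  have k5 : T y j b * T y i a = T y i a * T y j b := T_comm _ _ _ _ _ _ (by grind) (by grind) (by grind) (by grind)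
  have k6 : C b y * C a y = C a y * C b y := C_comm_C _ _ _ _ (by grind) (by grind)
  rw [k1, k2, k3, k5, k6] at r2
  calc _ = Q false b * (Q false c * Q false a * U y i a * U y j b * U a j c) := by
        rw [z1]; simp only [mul_assoc]
    _ = Q false a * Q false b * Q false c * (K b y i j c * (K b y i j a * K c y i j b)) * (T y i a * T y j b) *
        (C a y * C b y) * C c y := by rw [r1, z1]; simp only [mul_assoc]
    _ = Q false a * (Q false c * Q false b * U y j b * U y i a * U b i c) := by
        rw [r2, k4, z2]; simp only [mul_assoc]
    _ = _ := by rw [z2]; simp only [mul_assoc]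

theorem Q_comm_U {N : ℕ} (b : Bool) (c y x a : Fin N) (hcy : c ≠ y) (hca : c ≠ a) :
    Q b c * U y x a = U y x a * Q b c :=
  Commute.mul_right (show Commute _ _ from Q_comm_T _ _ _ _ _ hca) (Q_comm_C _ _ _ _ hcy)

theorem T_comm_U {N : ℕ} (i j k y x a : Fin N) (hky : k ≠ y) (hkx : k ≠ x) (hka : k ≠ a) (hai : a ≠ i)
    (haj : a ≠ j) (hyi : y ≠ i) (hyj : y ≠ j) : T i j k * U y x a = U y x a * T i j k :=
  Commute.mul_right (show Commute _ _ from T_comm _ _ _ _ _ _ hky hkx hai haj) (T_comm_C _ _ _ _ _ hka hyi hyj)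

theorem C_comm_U {N : ℕ} (i k y x a : Fin N) (hky : k ≠ y) (hkx : k ≠ x) (hka : k ≠ a) (hai : a ≠ i)
    (hyi : y ≠ i) : C i k * U y x a = U y x a * C i k :=
  Commute.mul_right (show Commute _ _ from (T_comm_C _ _ _ _ _ hai hky hkx).symm) (C_comm_C _ _ _ _ hka hyi)

theorem K_comm_U {N : ℕ} (e i j k l y x a : Fin N) (h : [e, i, j, k, l].Nodup) (hly : l ≠ y) (hlx : l ≠ x)
    (hla : l ≠ a) (hai : a ≠ i) (haj : a ≠ j) (hak : a ≠ k) (hyi : y ≠ i) (hyj : y ≠ j) (hyk : y ≠ k) :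
    K e i j k l * U y x a = U y x a * K e i j k l :=
  Commute.mul_right (show Commute _ _ from (T_comm_K _ _ _ _ _ _ _ _ h hai haj hak hly hlx).symm)
    (C_comm_K _ _ _ _ _ _ _ h hyi hyj hyk hla).symm

/-- If the first two controls cannot be active together then the gate has no effect. -/
theorem mul_K_of_mul_T {N : ℕ} {P : Diag N N} (e i j k l : Fin N) (h1 : P * T i j e = P)
    (h2 : T e k l * P = P * T e k l) : P * K e i j k l = P := by
  have h3 : P * T e k l * T i j e = P * T e k l := by rw [← h2, mul_assoc, h1]
  rw [K, ← mul_assoc, ← mul_assoc, ← mul_assoc, h1, h3, mul_assoc, T_sq, mul_one]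

/-- If the control `i` implies the controls `j` and `k` then the gate is a controlled not. -/
theorem mul_K_of_mul_C {N : ℕ} {P : Diag N N} (e i j k l : Fin N) (h : [e, i, j, k, l].Nodup)
    (h1 : P * T i j e = P * C i e) (h2 : T e k l * P = P * T e k l) (h3 : P * T i k l = P * C i l) :
    P * K e i j k l = P * C i l := by
  have hh : e ≠ i ∧ e ≠ j ∧ e ≠ k ∧ e ≠ l ∧ i ≠ j ∧ i ≠ k ∧ i ≠ l ∧ j ≠ k ∧ j ≠ l ∧ k ≠ l := by
    simpa [and_assoc] using h
  obtain ⟨hei, hej, hek, hel, hij, hik, hil, hjk, hjl, hkl⟩ := hh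
  have e1 : C i e * T e k l * C i e = T i k l * T e k l := cnot_tof_cnot i e k l (by simp; grind)
  have e2 : C i e * T i j e = T i j e * C i e := (T_comm_C _ _ _ _ _ (by grind) (by grind) (by grind)).symm
  have e3 : C i l * T e k l = T e k l * C i l := (T_comm_C _ _ _ _ _ (by grind) (by grind) (by grind)).symm
  have e4 : C i l * C i e = C i e * C i l := C_comm_C _ _ _ _ (by grind) (by grind)
  have e5 : C i l * T i j e = T i j e * C i l := (T_comm_C _ _ _ _ _ (by grind) (by grind) (by grind)).symm
  have e6 : C i e * T e k l = T i k l * T e k l * C i e := by rw [← e1, mul_assoc, C_sq, mul_one]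
  calc P * K e i j k l = T e k l * (P * T i j e) * T e k l * T i j e := by
        rw [K_eq_rev _ _ _ _ _ h, ← mul_assoc, ← mul_assoc, ← mul_assoc, ← h2]; simp only [mul_assoc]
    _ = T e k l * P * (C i e * T e k l) * T i j e := by rw [h1]; simp only [mul_assoc]
    _ = T e k l * (P * T i k l) * T e k l * (C i e * T i j e) := by rw [e6]; simp only [mul_assoc]
    _ = (T e k l * P) * (C i l * T e k l) * T i j e * C i e := by rw [h3, e2]; simp only [mul_assoc]
    _ = P * (T e k l * T e k l) * C i l * T i j e * C i e := by rw [h2, e3]; simp only [mul_assoc]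
    _ = P * T i j e * (C i l * C i e) := by rw [T_sq, mul_one, mul_assoc P, e5]; simp only [mul_assoc]
    _ = _ := by rw [h1, e4, ← mul_assoc, mul_assoc P, C_sq, mul_one]

/-- The splitting of the flag `y` by the wires `i`, `j` into four flags `y`, `b`, `a`, `c`. -/
noncomputable def split {N : ℕ} (y i j a b c : Fin N) : Diag N N :=
  -- The original flag stays on `y` if `i = j = 0`, and moves to `b` if `i = 0, j = 1`, to `a` if `i
  -- = 1, j = 0`, to `c` if `i = j = 1`.
  Q false a * Q false b * Q false c * U y i a * U y j b * U a j c

theorem split_symm {N : ℕ} (y i j a b c : Fin N) (h : [y, i, j, a, b, c].Nodup) :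
    split y i j a b c = split y j i b a c := by
  have hab : a ≠ b := by simp at h; grind
  rw [split, U_U_U y i j a b c h, split, show Q false a * Q false b = Q false b * Q false a from Q_comm_Q _ _ _ _ hab]

theorem T_comm_split {N : ℕ} (k l m y i j a b c : Fin N) (hm : m ∉ [y, i, j, a, b, c]) (hk : k ∉ [y, a, b, c])
    (hl : l ∉ [y, a, b, c]) : T k l m * split y i j a b c = split y i j a b c * T k l m := by
  have hm' : m ≠ y ∧ m ≠ i ∧ m ≠ j ∧ m ≠ a ∧ m ≠ b ∧ m ≠ c := by simpa using hm
  have hk' : k ≠ y ∧ k ≠ a ∧ k ≠ b ∧ k ≠ c := by simpa using hk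
  have hl' : l ≠ y ∧ l ≠ a ∧ l ≠ b ∧ l ≠ c := by simpa using hl
  have q (d : Fin N) (hd : m ≠ d) : Commute (T k l m) (Q false d) := (Q_comm_T _ _ _ _ _ hd.symm).symm
  refine Commute.mul_right (Commute.mul_right (Commute.mul_right (((q a ?_).mul_right (q b ?_)).mul_right (q c ?_))
    (T_comm_U _ _ _ _ _ _ ?_ ?_ ?_ ?_ ?_ ?_ ?_)) (T_comm_U _ _ _ _ _ _ ?_ ?_ ?_ ?_ ?_ ?_ ?_))
    (T_comm_U _ _ _ _ _ _ ?_ ?_ ?_ ?_ ?_ ?_ ?_) <;> grind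

/-- The last splitting, of `a` by `j`, leaves on `a` a flag implying that `j` carries 0, so the two
controls are never both active. -/
theorem split_mul_T {N : ℕ} (y i j a b c d : Fin N) (h : [y, i, j, a, b, c, d].Nodup) :
    split y i j a b c * T a j d = split y i j a b c := by
  have hh : [y, a, b, c].Nodup ∧ [a, j, c, d].Nodup := by simp at h ⊢; grind
  have hh' : y ≠ a ∧ y ≠ b ∧ y ≠ c ∧ a ≠ b ∧ a ≠ c ∧ b ≠ c := by simpa [and_assoc] using hh.1
  obtain ⟨h1, h2, h3, h4, h5, h6⟩ := hh'
  have q1 : Q false c * U y i a = U y i a * Q false c := Q_comm_U _ _ _ _ _ h3.symm h5.symm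
  have q2 : Q false c * U y j b = U y j b * Q false c := Q_comm_U _ _ _ _ _ h3.symm h6.symm
  have e : split y i j a b c = Q false a * Q false b * U y i a * U y j b * (Q false c * U a j c) := by
    rw [split, mul_assoc (Q false a * Q false b), q1]
    simp only [mul_assoc]
    rw [← mul_assoc (Q false c), q2]
    simp only [mul_assoc]
  rw [e, mul_assoc _ _ (T a j d), Q_false_U_T _ _ _ _ hh.2]

/-- The flag `c` implies that `j` carries 1, so this control is redundant. -/
theorem split_mul_T' {N : ℕ} (y i j a b c d : Fin N) (h : [y, i, j, a, b, c, d].Nodup) :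
    split y i j a b c * T c j d = split y i j a b c * C c d := by
  have hh : [y, a, b, c].Nodup ∧ [a, j, c, d].Nodup := by simp at h ⊢; grind
  have hh' : y ≠ a ∧ y ≠ b ∧ y ≠ c ∧ a ≠ b ∧ a ≠ c ∧ b ≠ c := by simpa [and_assoc] using hh.1
  obtain ⟨h1, h2, h3, h4, h5, h6⟩ := hh'
  have q1 : Q false c * U y i a = U y i a * Q false c := Q_comm_U _ _ _ _ _ h3.symm h5.symm
  have q2 : Q false c * U y j b = U y j b * Q false c := Q_comm_U _ _ _ _ _ h3.symm h6.symm
  have e : split y i j a b c = Q false a * Q false b * U y i a * U y j b * (Q false c * U a j c) := by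
    rw [split, mul_assoc (Q false a * Q false b), q1]
    simp only [mul_assoc]
    rw [← mul_assoc (Q false c), q2]
    simp only [mul_assoc]
  rw [e, mul_assoc _ _ (T c j d), Q_false_U_T' _ _ _ _ hh.2, ← mul_assoc]

theorem split_mul_T'' {N : ℕ} (y i j a b c d : Fin N) (h : [y, i, j, a, b, c, d].Nodup) :
    split y i j a b c * T y j d = split y i j a b c := by
  have hh : [y, a, b, c].Nodup ∧ [y, j, b, d].Nodup ∧ [d, a, j, c].Nodup := by simp at h ⊢; grind
  have hh' : y ≠ a ∧ y ≠ b ∧ y ≠ c ∧ a ≠ b ∧ a ≠ c ∧ b ≠ c := by simpa [and_assoc] using hh.1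
  obtain ⟨h1, h2, h3, h4, h5, h6⟩ := hh'
  have hh'' : d ≠ a ∧ d ≠ j ∧ d ≠ c ∧ a ≠ j ∧ a ≠ c ∧ j ≠ c := by simpa [and_assoc] using hh.2.2
  have q1 : Q false b * U y i a = U y i a * Q false b := Q_comm_U _ _ _ _ _ h2.symm h4.symm
  have q3 : Q false b * Q false c = Q false c * Q false b := Q_comm_Q _ _ _ _ h6
  have e : split y i j a b c = Q false a * Q false c * U y i a * (Q false b * U y j b) * U a j c := by
    rw [split, mul_assoc (Q false a), q3]
    simp only [mul_assoc]
    rw [← mul_assoc (Q false b) (U _ _ _), q1]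
    simp only [mul_assoc]
  have e2 : T y j d * U a j c = U a j c * T y j d := T_comm_U _ _ _ _ _ _ (by grind) (by grind) (by grind)
    (by grind) (by grind) (by grind) (by grind)
  rw [e, mul_assoc _ _ (T y j d), ← e2, ← mul_assoc, mul_assoc _ _ (T y j d), Q_false_U_T _ _ _ _ hh.2.1]

/-- Changing the split wire `k` by the conjunction of `i` and `j` changes the new flag by the
conjunction of `z`, `i` and `j`; the correction is the commutator of the two Toffoli gates meeting
at `k`. -/
theorem T_mul_U {N : ℕ} (i j k z z' : Fin N) (h : [i, j, k, z, z'].Nodup) :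
    T i j k * U z k z' = K k z i j z' * U z k z' * T i j k := by
  have hh : i ≠ j ∧ i ≠ k ∧ i ≠ z ∧ i ≠ z' ∧ j ≠ k ∧ j ≠ z ∧ j ≠ z' ∧ k ≠ z ∧ k ≠ z' ∧ z ≠ z' := by
    simpa [and_assoc] using h
  obtain ⟨hij, hik, hiz, hiz', hjk, hjz, hjz', hkz, hkz', hzz'⟩ := hh
  have e1 : K k z i j z' = K k i j z z' := by
    rw [K_symm_left, K_symm_right _ _ _ _ _ (by simp; grind)]
  have e2 : T i j k * C z' z = C z' z * T i j k := T_comm_C _ _ _ _ _ (by grind) (by grind) (by grind)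
  rw [e1, K, U, T_symm z k, mul_assoc _ (T k z z' * _) (T i j k), mul_assoc _ (C z' z) (T i j k), ← e2]
  simp only [← mul_assoc]
  rw [mul_assoc _ (T k z z') (T k z z'), T_sq, mul_one, mul_assoc _ (T i j k) (T i j k), T_sq, mul_one]

/-- Only the flag `c` is compatible with `i = j = 1`. The correction therefore disappears for the
other flags and, for `c`, becomes a controlled not. -/
theorem split_mul_K_left {N : ℕ} (y i j k a b c d : Fin N) (h : [y, i, j, k, a, b, c, d].Nodup) :
    split y i j a b c * K k y i j d = split y i j a b c := by
  have h' : [y, j, i, b, a, c, k].Nodup ∧ [y, i, j, a, b, c].Nodup := by simp at h ⊢; grind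
  refine mul_K_of_mul_T _ _ _ _ _ ?_ (T_comm_split _ _ _ _ _ _ _ _ _ ?_ ?_ ?_)
  · rw [split_symm _ _ _ _ _ _ h'.2]
    exact split_mul_T'' _ _ _ _ _ _ _ h'.1
  all_goals simp at h ⊢; grind

theorem split_mul_K_middle {N : ℕ} (y i j k a b c d : Fin N) (h : [y, i, j, k, a, b, c, d].Nodup) :
    split y i j a b c * K k a i j d = split y i j a b c := by
  have h' : [y, i, j, a, b, c, k].Nodup ∧ [k, a, i, j, d].Nodup := by simp at h ⊢; grind
  rw [K_symm_right _ _ _ _ _ h'.2]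
  refine mul_K_of_mul_T _ _ _ _ _ (split_mul_T _ _ _ _ _ _ _ h'.1) (T_comm_split _ _ _ _ _ _ _ _ _ ?_ ?_ ?_)
  all_goals simp at h ⊢; grind

theorem split_mul_K_right {N : ℕ} (y i j k a b c d : Fin N) (h : [y, i, j, k, a, b, c, d].Nodup) :
    split y i j a b c * K k c i j d = split y i j a b c * C c d := by
  have h' : [y, i, j, a, b, c, d].Nodup ∧ [k, c, i, j, d].Nodup ∧ [y, j, i, b, a, c, k].Nodup ∧
    [y, i, j, a, b, c].Nodup := by simp at h ⊢; grind
  refine mul_K_of_mul_C _ _ _ _ _ h'.2.1 ?_ (T_comm_split _ _ _ _ _ _ _ _ _ ?_ ?_ ?_)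
    (split_mul_T' _ _ _ _ _ _ _ h'.1)
  · rw [split_symm _ _ _ _ _ _ h'.2.2.2]
    exact split_mul_T' _ _ _ _ _ _ _ h'.2.2.1
  all_goals simp at h ⊢; grind

/-- Copying the flag onto the new wire before splitting it exchanges the two resulting flags. -/
theorem C_mul_U {N : ℕ} (c k c' : Fin N) (h : [c, k, c'].Nodup) : C c c' * U c k c' = U c k c' * S c c' := by
  have hh : c ≠ k ∧ c ≠ c' ∧ k ≠ c' := by simpa [and_assoc] using h
  obtain ⟨hck, hcc, hkc⟩ := hh
  have e1 : T c k c' * C c c' = C c c' * T c k c' := T_comm_C _ _ _ _ _ (by grind) (by grind) (by grind)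
  rw [S_comm, ← cnot_cnot_cnot c' c (by grind), U, ← mul_assoc, ← e1]
  simp only [mul_assoc]
  rw [← mul_assoc (C c' c) (C c' c), C_sq, one_mul]

theorem place_U {k N : ℕ} {σ : Fin k → Fin N} (hσ : Function.Injective σ) (y x a : Fin k) :
    place σ (U y x a) = U (σ y) (σ x) (σ a) := by
  simp only [U, map_mul, place_T hσ, place_C hσ]

theorem place_split {k N : ℕ} {σ : Fin k → Fin N} (hσ : Function.Injective σ) (y i j a b c : Fin k) :
    place σ (split y i j a b c) = split (σ y) (σ i) (σ j) (σ a) (σ b) (σ c) := by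
  simp only [split, map_mul, place_Q hσ, place_U hσ]

/-- The word computation of `T_mul_split`: the Toffoli gate passes the four splittings in turn, each
correction travels back to the double splitting `P`, and only the controlled not of the last flag
survives. -/
theorem T_mul_split_aux {M : Type*} [Monoid M] {t P uy ub ua uc ky kb ka kc s cc : M} (ht : t * P = P * t)
    (hy : t * uy = ky * uy * t) (hb : t * ub = kb * ub * t) (ha : t * ua = ka * ua * t) (hc : t * uc = kc * uc * t)
    (py : P * ky = P) (pb : P * kb = P) (pa : P * ka = P) (pc : P * kc = P * cc)
    (c1 : kb * uy = uy * kb) (c2 : ka * uy = uy * ka) (c3 : ka * ub = ub * ka) (c4 : kc * uy = uy * kc)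
    (c5 : kc * ub = ub * kc) (c6 : kc * ua = ua * kc) (d1 : cc * uy = uy * cc) (d2 : cc * ub = ub * cc)
    (d3 : cc * ua = ua * cc) (hs : cc * uc = uc * s) :
    t * (P * (uy * ub * ua * uc)) = P * (uy * ub * ua * uc) * (s * t) := by
  calc _ = P * (t * uy) * ub * ua * uc := by rw [← mul_assoc, ht]; simp only [mul_assoc]
    _ = P * ky * uy * (t * ub) * ua * uc := by rw [hy]; simp only [mul_assoc]
    _ = P * (kb * uy) * ub * (t * ua) * uc := by rw [hb, py, c1]; simp only [mul_assoc]
    _ = P * kb * uy * ub * ka * ua * (t * uc) := by rw [ha]; simp only [mul_assoc]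
    _ = P * uy * (ka * ub) * ua * kc * uc * t := by rw [hc, pb, c3]; simp only [mul_assoc]
    _ = P * (ka * uy) * ub * (kc * ua) * uc * t := by rw [c2, c6]; simp only [mul_assoc]
    _ = P * ka * uy * (kc * ub) * ua * uc * t := by rw [c5]; simp only [mul_assoc]
    _ = P * (kc * uy) * ub * ua * uc * t := by rw [pa, c4]; simp only [mul_assoc]
    _ = P * kc * uy * ub * ua * uc * t := by simp only [mul_assoc]
    _ = P * (cc * uy) * ub * ua * uc * t := by rw [pc]; simp only [mul_assoc]
    _ = P * uy * (cc * ub) * ua * uc * t := by rw [d1]; simp only [mul_assoc]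
    _ = P * uy * ub * (cc * ua) * uc * t := by rw [d2]; simp only [mul_assoc]
    _ = P * uy * ub * ua * (cc * uc) * t := by rw [d3]; simp only [mul_assoc]
    _ = _ := by rw [hs]; simp only [mul_assoc]

/-- Effect of the Toffoli gate on the splitting of a flag by its three wires. -/
theorem T_mul_split {N : ℕ} (y i j k a b c y' b' a' c' : Fin N) (h : [y, i, j, k, a, b, c, y', b', a', c'].Nodup) :
    T i j k * (split y i j a b c * (U y k y' * U b k b' * U a k a' * U c k c')) =
      split y i j a b c * (U y k y' * U b k b' * U a k a' * U c k c') * (S c c' * T i j k) := by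
  have hσ : Function.Injective ![y, i, j, k, a, b, c, y', b', a', c'] := injective_of_nodup h
  -- On eleven numbered wires all distinctness conditions are decidable.
  have key : T (1 : Fin 11) 2 3 * (split 0 1 2 4 5 6 * (U 0 3 7 * U 5 3 8 * U 4 3 9 * U 6 3 10)) =
      split 0 1 2 4 5 6 * (U 0 3 7 * U 5 3 8 * U 4 3 9 * U 6 3 10) * (S 6 10 * T 1 2 3) := by
    refine T_mul_split_aux (T_comm_split _ _ _ _ _ _ _ _ _ ?_ ?_ ?_)
      (T_mul_U _ _ _ _ _ ?_) (T_mul_U _ _ _ _ _ ?_) (T_mul_U _ _ _ _ _ ?_) (T_mul_U _ _ _ _ _ ?_)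
      (split_mul_K_left _ _ _ _ _ _ _ _ ?_) ?_ (split_mul_K_middle _ _ _ _ _ _ _ _ ?_)
      (split_mul_K_right _ _ _ _ _ _ _ _ ?_) (K_comm_U _ _ _ _ _ _ _ _ ?_ ?_ ?_ ?_ ?_ ?_ ?_ ?_ ?_ ?_)
      (K_comm_U _ _ _ _ _ _ _ _ ?_ ?_ ?_ ?_ ?_ ?_ ?_ ?_ ?_ ?_)
      (K_comm_U _ _ _ _ _ _ _ _ ?_ ?_ ?_ ?_ ?_ ?_ ?_ ?_ ?_ ?_)
      (K_comm_U _ _ _ _ _ _ _ _ ?_ ?_ ?_ ?_ ?_ ?_ ?_ ?_ ?_ ?_)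
      (K_comm_U _ _ _ _ _ _ _ _ ?_ ?_ ?_ ?_ ?_ ?_ ?_ ?_ ?_ ?_)
      (K_comm_U _ _ _ _ _ _ _ _ ?_ ?_ ?_ ?_ ?_ ?_ ?_ ?_ ?_ ?_)
      (C_comm_U _ _ _ _ _ ?_ ?_ ?_ ?_ ?_) (C_comm_U _ _ _ _ _ ?_ ?_ ?_ ?_ ?_) (C_comm_U _ _ _ _ _ ?_ ?_ ?_ ?_ ?_)
      (C_mul_U _ _ _ ?_) 
    all_goals first | decide | skip
    -- The flag of `i = 0, j = 1` is the middle case after exchanging the roles of the controls.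
    rw [split_symm _ _ _ _ _ _ (by decide), K_symm_right _ _ _ _ _ (by decide)]
    exact split_mul_K_middle _ _ _ _ _ _ _ _ (by decide)
  have := congrArg (place ![y, i, j, k, a, b, c, y', b', a', c']) key
  simp only [map_mul, place_T hσ, place_U hσ, place_S hσ, place_split hσ] at this
  exact this

/-! ### Working with an ancilla -/

/-- `g` with the last wire turned into an ancilla `|b⟩`, `⟨b|`. -/
def ancilla {N : ℕ} (b : Bool) (g : Diag (N + 1) (N + 1)) : Diag N N := addKet N b ⊚ g ⊚ addBra N b

/-- A gate on the other wires slides past both ends of the ancilla; intertwining relations therefore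
pass from the inner circuit to the compressed one. -/
theorem ancilla_conj {N : ℕ} (b : Bool) {f f' : Diag N N} {g g' : Diag (N + 1) (N + 1)}
    (h : above N 1 f * g = g' * above N 1 f') : f * ancilla b g = ancilla b g' * f' := by
  rw [ancilla, ancilla, mul_def, mul_def, ← assoc, ← assoc, comp_addKet, assoc (addKet N b), ← mul_def, h,
    assoc (_ ⊚ _) (addBra N b), addBra_comp, mul_def]
  simp only [assoc]

theorem ancilla_comm {N : ℕ} {b : Bool} {f : Diag N N} {g : Diag (N + 1) (N + 1)} (h : Commute (above N 1 f) g) :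
    Commute f (ancilla b g) := ancilla_conj b h

theorem ancilla_above {N : ℕ} (b : Bool) (f : Diag N N) : ancilla b (above N 1 f) = f := addKet_above_addBra b f

theorem ancilla_Q_mul {N : ℕ} (b : Bool) (g : Diag (N + 1) (N + 1)) :
    ancilla b (Q b (Fin.last N) * g) = ancilla b g := by
  rw [ancilla, mul_def, ← assoc, addKet_Q, ancilla]

theorem ancilla_mul_Q {N : ℕ} (b : Bool) (g : Diag (N + 1) (N + 1)) :
    ancilla b (g * Q b (Fin.last N)) = ancilla b g := by
  rw [ancilla, mul_def, ← assoc, assoc, Q_addBra, ancilla]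

theorem mul_ancilla {N : ℕ} (b : Bool) (f : Diag N N) (g : Diag (N + 1) (N + 1)) :
    f * ancilla b g = ancilla b (above N 1 f * g) := by
  rw [ancilla, ancilla, mul_def, ← assoc, ← assoc, comp_addKet, assoc (addKet N b)]; rfl

theorem above_ancilla_mul_Q {N : ℕ} (b : Bool) (g : Diag (N + 1) (N + 1)) :
    above N 1 (ancilla b g) * Q b (Fin.last N) = Q b (Fin.last N) * g * Q b (Fin.last N) :=
  addBra_comp_addKet b g

theorem Q_last_comm_above {N : ℕ} (b : Bool) (f : Diag N N) :
    Q b (Fin.last N) * above N 1 f = above N 1 f * Q b (Fin.last N) := by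
  rw [above_eq_place]
  exact place_comm (fun _ j => by
    simp only [Matrix.cons_val_fin_one]; exact last_ne j) _ _

theorem Q_mul_above_ancilla {N : ℕ} (b : Bool) (g : Diag (N + 1) (N + 1)) :
    Q b (Fin.last N) * above N 1 (ancilla b g) = Q b (Fin.last N) * g * Q b (Fin.last N) := by
  rw [Q_last_comm_above, above_ancilla_mul_Q]

/-- Cancelling an ancilla on the right. -/
theorem cancel_ancilla_right {N : ℕ} (b : Bool) {f g : Diag N N}
    (h : above N 1 f * Q b (Fin.last N) = above N 1 g * Q b (Fin.last N)) : f = g :=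
  cancel_ancilla b (by rw [Q_last_comm_above, h, Q_last_comm_above])

theorem S_comm_above_above {N : ℕ} (f : Diag N N) :
    S (Fin.last N).castSucc (Fin.last (N + 1)) * above (N + 1) 1 (above N 1 f) =
      above (N + 1) 1 (above N 1 f) * S (Fin.last N).castSucc (Fin.last (N + 1)) := by
  rw [above_eq_place (k := N), ← place_castSucc, S_eq_perm, perm_mul_place]
  refine congrArg (fun σ => place σ f * _) (funext fun i => ?_)
  exact Equiv.swap_apply_of_ne_of_ne ((Fin.castSucc_injective _).ne (last_ne i).symm) (last_ne _).symm

/-- A further wire arrives below the ancilla; the swap makes the ancilla the last wire again. -/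
theorem above_ancilla {N : ℕ} (b : Bool) (g : Diag (N + 1) (N + 1)) :
    above N 1 (ancilla b g) = ancilla b (S (Fin.last N).castSucc (Fin.last (N + 1)) * above (N + 1) 1 g *
      S (Fin.last N).castSucc (Fin.last (N + 1))) := by
  refine cancel_ancilla_right b ?_
  rw [above_ancilla_mul_Q]
  have h1 := congrArg (above (N + 1) 1) (above_ancilla_mul_Q b g)
  simp only [map_mul, above_one_Q] at h1
  set s := S (Fin.last N).castSucc (Fin.last (N + 1)) with hs
  have h2 : s * Q b (Fin.last (N + 1)) = Q b (Fin.last N).castSucc * s := S_mul_Q _ _ _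
  have h3 : Q b (Fin.last (N + 1)) * s = s * Q b (Fin.last N).castSucc := by
    have := S_mul_Q b (Fin.last (N + 1)) (Fin.last N).castSucc
    rw [S_comm, ← hs] at this
    exact this.symm
  have h4 : s * s = 1 := S_sq _ _
  have h5 : s * above (N + 1) 1 (above N 1 (ancilla b g)) = above (N + 1) 1 (above N 1 (ancilla b g)) * s :=
    S_comm_above_above _
  calc _ = s * s * above (N + 1) 1 (above N 1 (ancilla b g)) * Q b (Fin.last (N + 1)) := by rw [h4, one_mul]
    _ = s * (above (N + 1) 1 (above N 1 (ancilla b g)) * Q b (Fin.last N).castSucc) * s := by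
        rw [mul_assoc s, h5]; simp only [mul_assoc]; rw [h2]
    _ = _ := by
        rw [h1]; simp only [mul_assoc]; rw [← h2, ← mul_assoc s, ← h3]; simp only [mul_assoc]

/-! ### Conditional filters -/

theorem above_one_U {N : ℕ} (y x a : Fin N) : above N 1 (U y x a) = U y.castSucc x.castSucc a.castSucc := by
  simp only [U, map_mul, above_one_T, above_one_C]

theorem perm_mul_U {N : ℕ} (π : Equiv.Perm (Fin N)) (y x a : Fin N) :
    perm π * U y x a = U (π y) (π x) (π a) * perm π := by
  rw [U, ← mul_assoc, perm_mul_T, mul_assoc, perm_mul_C, ← mul_assoc]; rfl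

theorem dagger_U {N : ℕ} (y x a : Fin N) : dagger (U y x a) = C a y * T y x a := by
  rw [U, dagger_mul, dagger_C, dagger_T]

theorem U_mul_dagger {N : ℕ} (y x a : Fin N) : U y x a * dagger (U y x a) = 1 := by
  rw [dagger_U, U, mul_assoc, ← mul_assoc (C a y), C_sq, one_mul, T_sq]

theorem perm_mul_dagger_U {N : ℕ} (π : Equiv.Perm (Fin N)) (y x a : Fin N) :
    perm π * dagger (U y x a) = dagger (U (π y) (π x) (π a)) * perm π := by
  rw [dagger_U, dagger_U, ← mul_assoc, perm_mul_C, mul_assoc, perm_mul_T, ← mul_assoc]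

/-- The splitting gate is invertible with inverse its flip. -/
theorem commute_dagger_U {N : ℕ} {f : Diag N N} {y x a : Fin N} (h : Commute f (U y x a)) :
    Commute f (dagger (U y x a)) := by
  have h' : dagger (U y x a) * U y x a = 1 := by
    rw [dagger_U, U, mul_assoc, ← mul_assoc (T y x a), T_sq, one_mul, C_sq]
  have : f * dagger (U y x a) = dagger (U y x a) * (U y x a * f) * dagger (U y x a) := by
    rw [← mul_assoc, h', one_mul]
  rw [Commute, SemiconjBy, this, ← h.eq, mul_assoc, mul_assoc, U_mul_dagger, mul_one]

/-- The partial identity defined on the states in which, if wire `y` carries `|1⟩`, the wires `φ x` for `x ∈ l`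
carry a word in `S`. -/
noncomputable def E {α : Type} : List α → (List Bool → Bool) → {N : ℕ} → (α → Fin N) → Fin N → Diag N N
  -- A leaf outside `S` is forbidden by forcing its flag to be 0.
  | [], S, _, _, y => if S [] then 1 else Q false y
  | x :: l, S, N, φ, y =>
    -- One decision: the flag splits between `y` and a new ancilla, each subtree acts on its own
    -- flag, and the splitting is undone. Naming wires through `φ` lets the recursion add a wire
    -- without altering the list.
    ancilla false (U y.castSucc (φ x).castSucc (Fin.last N) *
      E l (fun w => S (false :: w)) (fun z => (φ z).castSucc) y.castSucc *
      E l (fun w => S (true :: w)) (fun z => (φ z).castSucc) (Fin.last N) *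
      dagger (U y.castSucc (φ x).castSucc (Fin.last N)))

theorem E_congr {α : Type} (l : List α) (S : List Bool → Bool) {N : ℕ} {φ ψ : α → Fin N} (y : Fin N)
    (h : ∀ z ∈ l, φ z = ψ z) : E l S φ y = E l S ψ y := by
  induction l generalizing S N with
  | nil => rfl
  | cons x l ih =>
    have h' : ∀ z ∈ l, (φ z).castSucc = (ψ z).castSucc := fun z hz => by rw [h z (List.mem_cons_of_mem _ hz)]
    rw [E, E, ih _ _ h', ih _ _ h', h x List.mem_cons_self]

theorem perm_mul_E {α : Type} (l : List α) (S : List Bool → Bool) {N : ℕ} (φ : α → Fin N) (y : Fin N)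
    (π : Equiv.Perm (Fin N)) : perm π * E l S φ y = E l S (fun z => π (φ z)) (π y) * perm π := by
  induction l generalizing S N with
  | nil =>
    rw [E, E]
    split
    · rw [mul_one, one_mul]
    · exact perm_mul_Q _ _ _
  | cons x l ih =>
    refine ancilla_conj false ?_
    have h1 (i : Fin N) : sumPerm π 1 i.castSucc = (π i).castSucc := sumPerm_castAdd _ _ _
    have h2 : sumPerm π 1 (Fin.last N) = Fin.last N := sumPerm_natAdd _ _ (0 : Fin 1)
    have e1 := perm_mul_U (sumPerm π 1) y.castSucc (φ x).castSucc (Fin.last N)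
    have e2 := ih (fun w => S (false :: w)) (fun z => (φ z).castSucc) y.castSucc (sumPerm π 1)
    have e3 := ih (fun w => S (true :: w)) (fun z => (φ z).castSucc) (Fin.last N) (sumPerm π 1)
    have e4 := perm_mul_dagger_U (sumPerm π 1) y.castSucc (φ x).castSucc (Fin.last N)
    simp only [h1, h2] at e1 e2 e3 e4
    rw [perm_above]
    simp only [mul_assoc]
    rw [← e4]
    simp only [← mul_assoc]
    rw [e1, mul_assoc _ (perm _), e2, ← mul_assoc, mul_assoc _ (perm _), e3, ← mul_assoc]

theorem above_one_dagger_U {N : ℕ} (y x a : Fin N) :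
    above N 1 (dagger (U y x a)) = dagger (U y.castSucc x.castSucc a.castSucc) := by
  rw [← dagger_above, above_one_U]

theorem above_one_E {α : Type} (l : List α) (S : List Bool → Bool) {N : ℕ} (φ : α → Fin N) (y : Fin N) :
    above N 1 (E l S φ y) = E l S (fun z => (φ z).castSucc) y.castSucc := by
  induction l generalizing S N with
  | nil =>
    rw [E, E]
    split
    · exact map_one _
    · exact above_one_Q _ _
  | cons x l ih =>
    rw [E, above_ancilla, E]
    have h0 (i : Fin N) : Equiv.swap (Fin.last N).castSucc (Fin.last (N + 1)) i.castSucc.castSucc =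
        i.castSucc.castSucc :=
      Equiv.swap_apply_of_ne_of_ne ((Fin.castSucc_injective _).ne (last_ne i).symm) (last_ne _).symm
    have h1 : Equiv.swap (Fin.last N).castSucc (Fin.last (N + 1)) (Fin.last N).castSucc = Fin.last (N + 1) :=
      Equiv.swap_apply_left _ _
    simp only [map_mul, ih, above_one_U, above_one_dagger_U]
    rw [S_eq_perm]
    simp only [← mul_assoc]
    rw [perm_mul_U, mul_assoc _ (perm _), perm_mul_E, ← mul_assoc, mul_assoc _ (perm _), perm_mul_E,
      ← mul_assoc, mul_assoc _ (perm _), perm_mul_dagger_U, ← mul_assoc, mul_assoc _ (perm _), ← S_eq_perm, S_sq,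
      mul_one]
    simp only [h0, h1]

/-- A filter only reads the tested wires, so `d` may be one of them; only the flag is excluded. -/
theorem Q_comm_E {α : Type} (l : List α) (S : List Bool → Bool) {N : ℕ} (φ : α → Fin N) (y d : Fin N) (b : Bool)
    (h : d ≠ y) : Commute (Q b d) (E l S φ y) := by
  induction l generalizing S N with
  | nil =>
    rw [E]
    split
    · exact Commute.one_right _
    · exact Q_comm_Q _ _ _ _ h
  | cons x l ih =>
    refine ancilla_comm ?_
    rw [above_one_Q]
    have h1 := (Fin.castSucc_injective N).ne h
    have h2 : Commute (Q b d.castSucc) (U y.castSucc (φ x).castSucc (Fin.last N)) :=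
      Q_comm_U _ _ _ _ _ h1 (last_ne d).symm
    exact ((h2.mul_right (ih _ _ _ _ h1)).mul_right (ih _ _ _ _ (last_ne d).symm)).mul_right (commute_dagger_U h2)

/-- The gate may be controlled by tested wires, provided its target is not tested and it avoids the
flag. -/
theorem T_comm_E {α : Type} (l : List α) (S : List Bool → Bool) {N : ℕ} (φ : α → Fin N) (y i j k : Fin N)
    (hl : ∀ z ∈ l, k ≠ φ z) (hk : k ≠ y) (hi : y ≠ i) (hj : y ≠ j) : Commute (T i j k) (E l S φ y) := by
  induction l generalizing S N with
  | nil =>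
    rw [E]
    split
    · exact Commute.one_right _
    · exact (Q_comm_T _ _ _ _ _ hk.symm).symm
  | cons x l ih =>
    refine ancilla_comm ?_
    rw [above_one_T]
    have hs := Fin.castSucc_injective N
    have hl' : ∀ z ∈ l, k.castSucc ≠ (φ z).castSucc := fun z hz => hs.ne (hl z (List.mem_cons_of_mem _ hz))
    have h2 : Commute (T i.castSucc j.castSucc k.castSucc) (U y.castSucc (φ x).castSucc (Fin.last N)) :=
      T_comm_U _ _ _ _ _ _ (hs.ne hk) (hs.ne (hl x List.mem_cons_self)) (last_ne k).symm (last_ne i) (last_ne j)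
        (hs.ne hi) (hs.ne hj)
    exact ((h2.mul_right (ih _ _ _ _ _ _ hl' (hs.ne hk) (hs.ne hi) (hs.ne hj))).mul_right
      (ih _ _ _ _ _ _ hl' (last_ne k).symm (last_ne i) (last_ne j))).mul_right (commute_dagger_U h2)

theorem C_comm_E {α : Type} (l : List α) (S : List Bool → Bool) {N : ℕ} (φ : α → Fin N) (y i k : Fin N)
    (hl : ∀ z ∈ l, k ≠ φ z) (hk : k ≠ y) (hi : y ≠ i) : Commute (C i k) (E l S φ y) := by
  induction l generalizing S N with
  | nil =>
    rw [E]
    split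
    · exact Commute.one_right _
    · exact (Q_comm_C _ _ _ _ hk.symm).symm
  | cons x l ih =>
    refine ancilla_comm ?_
    rw [above_one_C]
    have hs := Fin.castSucc_injective N
    have hl' : ∀ z ∈ l, k.castSucc ≠ (φ z).castSucc := fun z hz => hs.ne (hl z (List.mem_cons_of_mem _ hz))
    have h2 : Commute (C i.castSucc k.castSucc) (U y.castSucc (φ x).castSucc (Fin.last N)) :=
      C_comm_U _ _ _ _ _ (hs.ne hk) (hs.ne (hl x List.mem_cons_self)) (last_ne k).symm (last_ne i) (hs.ne hi)
    exact ((h2.mul_right (ih _ _ _ _ _ hl' (hs.ne hk) (hs.ne hi))).mul_right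
      (ih _ _ _ _ _ hl' (last_ne k).symm (last_ne i))).mul_right (commute_dagger_U h2)

theorem U_comm_E {α : Type} (l : List α) (S : List Bool → Bool) {N : ℕ} (φ : α → Fin N) (z y x a : Fin N)
    (hy : ∀ w ∈ l, y ≠ φ w) (ha : ∀ w ∈ l, a ≠ φ w) (hzy : z ≠ y) (hza : z ≠ a) (hzx : z ≠ x) :
    Commute (U y x a) (E l S φ z) :=
  (T_comm_E _ _ _ _ _ _ _ ha hza.symm hzy hzx).mul_left (C_comm_E _ _ _ _ _ _ hy hzy.symm hza)

/-- Two filters may read the same wires; it is enough that the flags differ and that neither filter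
tests the flag of the other. -/
theorem E_comm_E {α β : Type} (l : List α) (S : List Bool → Bool) (l' : List β) (S' : List Bool → Bool) {N : ℕ}
    (φ : α → Fin N) (ψ : β → Fin N) (y z : Fin N) (hyz : y ≠ z) (hy : ∀ w ∈ l', y ≠ ψ w) (hz : ∀ w ∈ l, z ≠ φ w) :
    Commute (E l S φ y) (E l' S' ψ z) := by
  induction l' generalizing S' N with
  | nil =>
    rw [E.eq_def [] S']
    dsimp only
    split
    · exact Commute.one_right _
    · exact (Q_comm_E _ _ _ _ _ _ hyz.symm).symm
  | cons x l' ih =>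
    refine ancilla_comm ?_
    rw [above_one_E]
    have hs := Fin.castSucc_injective N
    have hz' : ∀ w ∈ l, z.castSucc ≠ (φ w).castSucc := fun w hw => hs.ne (hz w hw)
    have hy' : ∀ w ∈ l', y.castSucc ≠ (ψ w).castSucc := fun w hw => hs.ne (hy w (List.mem_cons_of_mem _ hw))
    have hl : ∀ w ∈ l, Fin.last N ≠ (φ w).castSucc := fun w _ => last_ne _
    have h2 := (U_comm_E l S (fun w => (φ w).castSucc) y.castSucc z.castSucc (ψ x).castSucc (Fin.last N) hz' hl
      (hs.ne hyz) (last_ne y).symm (hs.ne (hy x List.mem_cons_self))).symm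
    exact ((h2.mul_right (ih _ _ _ _ _ (hs.ne hyz) hy' hz')).mul_right
      (ih _ _ _ _ _ (last_ne y).symm hy' hl)).mul_right (commute_dagger_U h2)

/-- Any clean wire may serve as the ancilla. -/
theorem Q_mul_E_cons {α : Type} (x : α) (l : List α) (S : List Bool → Bool) {N : ℕ} (φ : α → Fin N) (y a : Fin N)
    (hay : a ≠ y) (hx : a ≠ φ x) (hl : ∀ w ∈ l, a ≠ φ w) :
    Q false a * E (x :: l) S φ y = Q false a * (U y (φ x) a * E l (fun w => S (false :: w)) φ y *
      E l (fun w => S (true :: w)) φ a * dagger (U y (φ x) a)) * Q false a := by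
  set F := U y (φ x) a * E l (fun w => S (false :: w)) φ y *
      E l (fun w => S (true :: w)) φ a * dagger (U y (φ x) a) with hF
  have hs := Fin.castSucc_injective N
  set G := U y.castSucc (φ x).castSucc (Fin.last N) *
      E l (fun w => S (false :: w)) (fun z => (φ z).castSucc) y.castSucc *
      E l (fun w => S (true :: w)) (fun z => (φ z).castSucc) (Fin.last N) *
      dagger (U y.castSucc (φ x).castSucc (Fin.last N)) with hG
  have hEG : E (x :: l) S φ y = ancilla false G := rfl
  set s := Diag.S a.castSucc (Fin.last N)
  -- Exchanging `a` with the internal ancilla renames that ancilla throughout.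
  have hsG : s * G = above N 1 F * s := by
    have h0 {i : Fin N} (hi : a ≠ i) : Equiv.swap a.castSucc (Fin.last N) i.castSucc = i.castSucc :=
      Equiv.swap_apply_of_ne_of_ne (hs.ne hi.symm) (last_ne _).symm
    have h1 : Equiv.swap a.castSucc (Fin.last N) (Fin.last N) = a.castSucc := Equiv.swap_apply_right _ _
    have hc (S : List Bool → Bool) (z : Fin (N + 1)) :
        E l S (fun z => Equiv.swap a.castSucc (Fin.last N) (φ z).castSucc) z = E l S (fun z => (φ z).castSucc) z :=
      E_congr _ _ _ fun w hw => h0 (hl w hw)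
    rw [hF, hG]
    simp only [map_mul, above_one_E, above_one_U, above_one_dagger_U, s, S_eq_perm]
    simp only [← mul_assoc]
    rw [perm_mul_U, mul_assoc _ (perm _), perm_mul_E, ← mul_assoc, mul_assoc _ (perm _), perm_mul_E,
      ← mul_assoc, mul_assoc _ (perm _), perm_mul_dagger_U, ← mul_assoc, h0 hay, h0 hx, h1, hc, hc]
  have hQG : Commute (Q false a.castSucc) G := by
    have h2 : Commute (Q false a.castSucc) (U y.castSucc (φ x).castSucc (Fin.last N)) :=
      Q_comm_U _ _ _ _ _ (hs.ne hay) (last_ne a).symm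
    exact ((h2.mul_right (Q_comm_E _ _ _ _ _ _ (hs.ne hay))).mul_right
      (Q_comm_E _ _ _ _ _ _ (last_ne a).symm)).mul_right (commute_dagger_U h2)
  -- Both wires carry 0, so their exchange is absorbed.
  have hqs : Q false a.castSucc * Q false (Fin.last N) * s = Q false a.castSucc * Q false (Fin.last N) :=
    Q_Q_S _ _ _ (last_ne a).symm
  have hsq : s * (Q false a.castSucc * Q false (Fin.last N)) = Q false a.castSucc * Q false (Fin.last N) := by
    have := congrArg dagger hqs
    simp only [dagger_mul, dagger_Q, s, dagger_S] at this
    rw [← Q_comm_Q _ _ _ _ (last_ne a).symm] at this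
    exact this
  have hq : Q false (Fin.last N) * Q false a.castSucc = Q false a.castSucc * Q false (Fin.last N) :=
    Q_comm_Q _ _ _ _ (last_ne a)
  refine cancel_ancilla false ?_
  rw [hEG]
  simp only [map_mul, above_one_Q]
  set p := Q false a.castSucc
  set q := Q false (Fin.last N)
  have hqF : q * above N 1 F = above N 1 F * q := Q_last_comm_above _ _
  have hp : p * p = p := Q_sq _ _
  have hqq : q * q = q := Q_sq _ _
  have hpqp : p * q * p = p * q := by rw [mul_assoc, hq, ← mul_assoc, hp]
  calc _ = p * (q * G * q) := by rw [← mul_assoc, hq, mul_assoc, Q_mul_above_ancilla]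
    _ = p * q * p * G * q := by rw [hpqp]; simp only [mul_assoc]
    _ = p * q * (s * G) * (p * q) := by
        rw [mul_assoc _ p G, hQG.eq, ← mul_assoc _ s G, hqs]; simp only [mul_assoc]
    _ = p * q * above N 1 F * (s * (p * q)) := by rw [hsG]; simp only [mul_assoc]
    _ = q * p * above N 1 F * (q * p) := by rw [hsq, hq]
    _ = q * (p * (q * above N 1 F) * p) := by rw [hqF]; simp only [mul_assoc]
    _ = q * q * p * above N 1 F * p := by rw [← mul_assoc p q, ← hq]; simp only [mul_assoc]
    _ = _ := by rw [hqq]; simp only [mul_assoc]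

/-- An inactive flag splits into two inactive flags. -/
theorem Q_Q_U {N : ℕ} (y x a : Fin N) (h : a ≠ y) : Q false y * Q false a * U y x a = Q false y * Q false a := by
  have h1 : Q false y * T y x a = Q false y := by
    by_cases hn : [y, x, a].Nodup
    · exact Q_false_T _ _ _ hn
    · rw [T_eq_one _ _ _ hn, mul_one]
  have h2 : Q false y * Q false a = Q false a * Q false y := Q_comm_Q _ _ _ _ h.symm
  rw [U, h2, mul_assoc, ← mul_assoc (Q false y), h1, ← mul_assoc, ← h2, mul_assoc, Q_false_C _ _ h]

theorem Q_Q_dagger_U {N : ℕ} (y x a : Fin N) (h : a ≠ y) :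
    Q false y * Q false a * dagger (U y x a) = Q false y * Q false a := by
  conv_lhs => rw [← Q_Q_U y x a h]
  rw [mul_assoc, U_mul_dagger, mul_one]

theorem U_Q_Q {N : ℕ} (y x a : Fin N) (h : a ≠ y) : U y x a * (Q false y * Q false a) = Q false y * Q false a := by
  have := congrArg dagger (Q_Q_dagger_U y x a h)
  simp only [dagger_mul, dagger_dagger, dagger_Q] at this
  rwa [Q_comm_Q _ _ _ _ h] at this

theorem mul_ancilla_eq {N : ℕ} {b : Bool} {f f' : Diag N N} {g : Diag (N + 1) (N + 1)}
    (h : Q b (Fin.last N) * (above N 1 f * g) = Q b (Fin.last N) * above N 1 f') : f * ancilla b g = f' := by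
  rw [mul_ancilla, ← ancilla_Q_mul, h, ancilla_Q_mul, ancilla_above]

/-- With an inactive flag every splitting is trivial and every leaf condition holds. -/
theorem Q_mul_E_self {α : Type} (l : List α) (S : List Bool → Bool) {N : ℕ} (φ : α → Fin N) (y : Fin N) :
    Q false y * E l S φ y = Q false y := by
  induction l generalizing S N with
  | nil =>
    rw [E]
    split
    · exact mul_one _
    · exact Q_sq _ _
  | cons x l ih =>
    have hl := last_ne y
    refine mul_ancilla_eq ?_
    rw [above_one_Q]
    have hqp : Q false (Fin.last N) * Q false y.castSucc = Q false y.castSucc * Q false (Fin.last N) :=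
      Q_comm_Q _ _ _ _ hl
    have e1 := Q_Q_U y.castSucc (φ x).castSucc (Fin.last N) hl
    have e2 := Q_Q_dagger_U y.castSucc (φ x).castSucc (Fin.last N) hl
    have e3 := ih (fun w => S (false :: w)) (fun z => (φ z).castSucc) y.castSucc
    have e4 := ih (fun w => S (true :: w)) (fun z => (φ z).castSucc) (Fin.last N)
    set p := Q false y.castSucc
    set q := Q false (Fin.last N)
    set u := U y.castSucc (φ x).castSucc (Fin.last N)
    set f := E l (fun w => S (false :: w)) (fun z => (φ z).castSucc) y.castSucc
    set g := E l (fun w => S (true :: w)) (fun z => (φ z).castSucc) (Fin.last N)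
    calc _ = (p * q * u) * f * g * dagger u := by rw [← hqp]; simp only [mul_assoc]
      _ = q * (p * f) * g * dagger u := by rw [e1, ← hqp]; simp only [mul_assoc]
      _ = p * (q * g) * dagger u := by rw [e3, hqp]; simp only [mul_assoc]
      _ = _ := by rw [e4, e2, hqp]

theorem E_congr_table {α : Type} (l : List α) {S S' : List Bool → Bool} {N : ℕ} (φ : α → Fin N) (y : Fin N)
    (h : ∀ w, w.length = l.length → S w = S' w) : E l S φ y = E l S' φ y := by
  induction l generalizing S S' N with
  | nil => rw [E, E, h [] rfl]
  | cons x l ih =>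
    rw [E, E, ih (S' := fun w => S' (false :: w)) _ _ fun w hw => h _ (by simp [hw]),
      ih (S' := fun w => S' (true :: w)) _ _ fun w hw => h _ (by simp [hw])]

/-- Both branches force their flags to 0, and on inactive flags the splitting is the identity. -/
theorem E_false {α : Type} (l : List α) {N : ℕ} (φ : α → Fin N) (y : Fin N) :
    E l (fun _ => false) φ y = Q false y := by
  induction l generalizing N with
  | nil => rfl
  | cons x l ih =>
    have hl := last_ne y
    rw [E, ih, ih, mul_assoc (U _ _ _), U_Q_Q _ _ _ hl, Q_Q_dagger_U _ _ _ hl, ancilla_mul_Q, ← above_one_Q,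
      ancilla_above]

theorem E_true {α : Type} (l : List α) {N : ℕ} (φ : α → Fin N) (y : Fin N) :
    E l (fun _ => true) φ y = 1 := by
  induction l generalizing N with
  | nil => rfl
  | cons x l ih =>
    rw [E, ih, ih, mul_one, mul_one, U_mul_dagger, ← map_one (above N 1), ancilla_above]

/-! Fixing the value of a wire. -/

/-- If the tested wire carries 1, the flag moves entirely to the clean wire, which is a swap. -/
theorem Q_Q_U_true {N : ℕ} (y x a : Fin N) (h : [y, x, a].Nodup) :
    Q true x * Q false a * U y x a = Q true x * Q false a * S y a := by
  have hh : y ≠ x ∧ y ≠ a ∧ x ≠ a := by simpa [and_assoc] using h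
  obtain ⟨hyx, hya, hxa⟩ := hh
  have e1 : Q true x * T y x a = Q true x * C y a := by
    rw [T_symm]; exact Q_true_T _ _ _ (by simp; grind)
  have e2 : Q true x * Q false a = Q false a * Q true x := Q_comm_Q _ _ _ _ hxa
  have e3 : C a y * C y a * C a y = S y a := by rw [S_comm]; exact cnot_cnot_cnot _ _ hya.symm
  have e4 : Q false a * C a y = Q false a := Q_false_C _ _ hya.symm
  calc _ = Q false a * (Q true x * T y x a) * C a y := by rw [e2, U]; simp only [mul_assoc]
    _ = Q true x * (Q false a * C a y) * C y a * C a y := by rw [e1, e4, e2]; simp only [mul_assoc]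
    _ = _ := by rw [← e3]; simp only [mul_assoc]

theorem Q_Q_S_dagger_U {N : ℕ} (y x a : Fin N) (h : [y, x, a].Nodup) :
    Q true x * Q false a * S y a * dagger (U y x a) = Q true x * Q false a := by
  rw [← Q_Q_U_true y x a h, mul_assoc, U_mul_dagger, mul_one]

theorem Q_mul_U_false {N : ℕ} (y x a : Fin N) (h : [y, x, a].Nodup) :
    Q false x * Q false a * U y x a = Q false x * Q false a := by
  have hh : y ≠ x ∧ y ≠ a ∧ x ≠ a := by simpa [and_assoc] using h
  obtain ⟨hyx, hya, hxa⟩ := hh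
  have e1 : Q false x * T y x a = Q false x := by
    rw [T_symm]; exact Q_false_T _ _ _ (by simp; grind)
  have e2 : Q false x * Q false a = Q false a * Q false x := Q_comm_Q _ _ _ _ hxa
  rw [U, ← mul_assoc, e2, mul_assoc (Q false a), e1, ← e2, mul_assoc, Q_false_C _ _ hya.symm]

theorem S_mul_E {α : Type} (l : List α) (S : List Bool → Bool) {N : ℕ} (φ : α → Fin N) (y a : Fin N)
    (hy : ∀ w ∈ l, y ≠ φ w) (ha : ∀ w ∈ l, a ≠ φ w) : Diag.S y a * E l S φ y = E l S φ a * Diag.S y a := by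
  rw [S_eq_perm, perm_mul_E, Equiv.swap_apply_left]
  refine congrArg (· * _) (E_congr _ _ _ fun w hw => ?_)
  exact Equiv.swap_apply_of_ne_of_ne (hy w hw).symm (ha w hw).symm

/-- The flag stays on `y`; the other branch sees an inactive flag and does nothing. -/
theorem Q_false_mul_E_cons {α : Type} (x : α) (l : List α) (S : List Bool → Bool) {N : ℕ} (φ : α → Fin N)
    (y : Fin N) (hx : y ≠ φ x) :
    Q false (φ x) * E (x :: l) S φ y = Q false (φ x) * E l (fun w => S (false :: w)) φ y := by
  refine mul_ancilla_eq ?_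
  have hs := Fin.castSucc_injective N
  have hn : [y.castSucc, (φ x).castSucc, Fin.last N].Nodup := by
    simp [hx, Fin.castSucc_ne_last]
  rw [map_mul, above_one_Q, above_one_E]
  have e1 := Q_mul_U_false _ _ _ hn
  have e3 := U_mul_dagger y.castSucc (φ x).castSucc (Fin.last N)
  have c0 : Q false (Fin.last N) * Q false (φ x).castSucc = Q false (φ x).castSucc * Q false (Fin.last N) :=
    Q_comm_Q _ _ _ _ (last_ne _)
  have c1 := (Q_comm_E l (fun w => S (false :: w)) (fun z => (φ z).castSucc) y.castSucc (Fin.last N) false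
    (last_ne _)).eq
  have c2 := (Q_comm_E l (fun w => S (false :: w)) (fun z => (φ z).castSucc) y.castSucc (φ x).castSucc false
    (hs.ne hx.symm)).eq
  have c3 := Q_mul_E_self l (fun w => S (true :: w)) (fun z => (φ z).castSucc) (Fin.last N)
  set p := Q false (φ x).castSucc
  set q := Q false (Fin.last N)
  set u := U y.castSucc (φ x).castSucc (Fin.last N)
  set f := E l (fun w => S (false :: w)) (fun z => (φ z).castSucc) y.castSucc
  set g := E l (fun w => S (true :: w)) (fun z => (φ z).castSucc) (Fin.last N)
  calc _ = p * q * u * f * g * dagger u := by rw [← c0]; simp only [mul_assoc]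
    _ = p * f * (q * g) * dagger u := by rw [e1, mul_assoc p, c1]; simp only [mul_assoc]
    _ = f * (p * q * dagger u) := by rw [c3, c2]; simp only [mul_assoc]
    _ = f * (p * q * u * dagger u) := by rw [e1]
    _ = f * q * p := by rw [mul_assoc (p * q), e3, mul_one, ← c0, ← mul_assoc]
    _ = q * (p * f) := by rw [← c1, c2, mul_assoc]

/-- The flag is swapped onto the ancilla. Undoing the swap brings the active branch back to `y`,
while the other one keeps an inactive flag. -/
theorem Q_true_mul_E_cons {α : Type} (x : α) (l : List α) (S : List Bool → Bool) {N : ℕ} (φ : α → Fin N)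
    (y : Fin N) (hx : y ≠ φ x) (hl : ∀ w ∈ l, y ≠ φ w) :
    Q true (φ x) * E (x :: l) S φ y = Q true (φ x) * E l (fun w => S (true :: w)) φ y := by
  refine mul_ancilla_eq ?_
  have hs := Fin.castSucc_injective N
  have hn : [y.castSucc, (φ x).castSucc, Fin.last N].Nodup := by
    simp [hx, Fin.castSucc_ne_last]
  have hy' : ∀ w ∈ l, y.castSucc ≠ (φ w).castSucc := fun w hw => hs.ne (hl w hw)
  have ha' : ∀ w ∈ l, Fin.last N ≠ (φ w).castSucc := fun w hw => last_ne _
  rw [map_mul, above_one_Q, above_one_E]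
  have e1 := Q_Q_U_true _ _ _ hn
  have e2 := Q_Q_S_dagger_U _ _ _ hn
  have c0 : Q false (Fin.last N) * Q true (φ x).castSucc = Q true (φ x).castSucc * Q false (Fin.last N) :=
    Q_comm_Q _ _ _ _ (last_ne _)
  have c1 := (Q_comm_E l (fun w => S (true :: w)) (fun z => (φ z).castSucc) y.castSucc (Fin.last N) false
    (last_ne _)).eq
  have c2 := (Q_comm_E l (fun w => S (true :: w)) (fun z => (φ z).castSucc) y.castSucc (φ x).castSucc true
    (hs.ne hx.symm)).eq
  have c3 := Q_mul_E_self l (fun w => S (false :: w)) (fun z => (φ z).castSucc) (Fin.last N)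
  have s1 := S_mul_E l (fun w => S (false :: w)) _ _ _ hy' ha'
  have s2 := S_mul_E l (fun w => S (true :: w)) _ _ _ ha' hy'
  rw [S_comm] at s2
  set p := Q true (φ x).castSucc
  set q := Q false (Fin.last N)
  set u := U y.castSucc (φ x).castSucc (Fin.last N)
  set f := E l (fun w => S (true :: w)) (fun z => (φ z).castSucc) y.castSucc
  set s := Diag.S y.castSucc (Fin.last N)
  calc _ = p * q * u * E l (fun w => S (false :: w)) (fun z => (φ z).castSucc) y.castSucc *
        E l (fun w => S (true :: w)) (fun z => (φ z).castSucc) (Fin.last N) * dagger u := by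
        rw [← c0]; simp only [mul_assoc]
    _ = p * (q * E l (fun w => S (false :: w)) (fun z => (φ z).castSucc) (Fin.last N)) *
        (s * E l (fun w => S (true :: w)) (fun z => (φ z).castSucc) (Fin.last N)) * dagger u := by
        rw [e1, mul_assoc _ s, s1]; simp only [mul_assoc]
    _ = p * (q * f) * s * dagger u := by rw [c3, s2]; simp only [mul_assoc]
    _ = f * (p * q * s * dagger u) := by rw [c1, ← mul_assoc, c2]; simp only [mul_assoc]
    _ = f * q * p := by rw [e2, ← c0, ← mul_assoc]
    _ = q * (p * f) := by rw [← c1, c2, mul_assoc]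

/-- An active flag that has left `y` can only have done so because `x` carries 1. -/
theorem Q_Q_U_Q {N : ℕ} (y x a : Fin N) (h : [y, x, a].Nodup) :
    Q false a * Q true y * U y x a * Q false y = Q true y * (Q true x * Q false a * S y a) := by
  have hh : y ≠ x ∧ y ≠ a ∧ x ≠ a := by simpa [and_assoc] using h
  obtain ⟨hyx, hya, hxa⟩ := hh
  have e1 : Q true y * T y x a = C x a * Q true y := by
    rw [Q_true_T _ _ _ h]; exact Q_comm_C _ _ _ _ hya
  have e2 : Q true y * C a y * Q false y = Q true a * Q true y * X y := Q_true_C_Q_false y a hya.symm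
  have e3 : Q false a * C x a * Q true a = Q true x * Q false a * X a := Q_false_C_Q_true a x hxa
  have e4 : Q true y * Q false a * S y a = Q true y * Q false a * X y * X a := Q_true_Q_false_S y a hya
  have c1 : Q true y * X a = X a * Q true y := Q_comm_X _ _ _ hya
  have c2 : X y * X a = X a * X y := X_comm_X _ _
  have c3 : Q true y * Q true x = Q true x * Q true y := Q_comm_Q _ _ _ _ hyx
  have c4 : Q true y * Q false a = Q false a * Q true y := Q_comm_Q _ _ _ _ hya
  calc _ = Q false a * (Q true y * T y x a) * C a y * Q false y := by rw [U]; simp only [mul_assoc]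
    _ = Q false a * C x a * (Q true y * C a y * Q false y) := by rw [e1]; simp only [mul_assoc]
    _ = Q true x * Q false a * (X a * Q true y) * X y := by
        rw [e2, ← mul_assoc, ← mul_assoc, e3]; simp only [mul_assoc]
    _ = Q true x * (Q false a * Q true y) * (X a * X y) := by rw [← c1]; simp only [mul_assoc]
    _ = Q true x * (Q true y * Q false a * S y a) := by rw [e4, ← c4, ← c2]; simp only [mul_assoc]
    _ = _ := by rw [← mul_assoc, ← mul_assoc, ← c3]; simp only [mul_assoc]

/-- Adding a condition on one wire. -/
theorem Q_true_mul_E_cons' {α : Type} (x : α) (l : List α) (S : List Bool → Bool) {N : ℕ} (φ : α → Fin N)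
    (y : Fin N) (hx : y ≠ φ x) (hl : ∀ w ∈ l, y ≠ φ w) (h0 : ∀ w, S (false :: w) = false) :
    Q true y * E (x :: l) S φ y = Q true y * (Q true (φ x) * E l (fun w => S (true :: w)) φ y) := by
  refine mul_ancilla_eq ?_
  have hs := Fin.castSucc_injective N
  have hn : [y.castSucc, (φ x).castSucc, Fin.last N].Nodup := by
    simp [hx, Fin.castSucc_ne_last]
  have hy' : ∀ w ∈ l, y.castSucc ≠ (φ w).castSucc := fun w hw => hs.ne (hl w hw)
  have ha' : ∀ w ∈ l, Fin.last N ≠ (φ w).castSucc := fun w hw => last_ne _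
  -- The branch `x = 0` rejects every word, so it is the projection of its flag onto 0.
  rw [map_mul, map_mul, above_one_Q, above_one_Q, above_one_E, show (fun w => S (false :: w)) = fun _ => false from
    funext h0, E_false]
  have e1 := Q_Q_U_Q _ _ _ hn
  have e2 := Q_Q_S_dagger_U _ _ _ hn
  have c0 : Q false (Fin.last N) * Q true (φ x).castSucc = Q true (φ x).castSucc * Q false (Fin.last N) :=
    Q_comm_Q _ _ _ _ (last_ne _)
  have c1 := (Q_comm_E l (fun w => S (true :: w)) (fun z => (φ z).castSucc) y.castSucc (Fin.last N) false
    (last_ne _)).eq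
  have c2 := (Q_comm_E l (fun w => S (true :: w)) (fun z => (φ z).castSucc) y.castSucc (φ x).castSucc true
    (hs.ne hx.symm)).eq
  have c3 : Q false (Fin.last N) * Q true y.castSucc = Q true y.castSucc * Q false (Fin.last N) :=
    Q_comm_Q _ _ _ _ (last_ne _)
  have s2 := S_mul_E l (fun w => S (true :: w)) _ _ _ ha' hy'
  rw [S_comm] at s2
  set p := Q true (φ x).castSucc
  set q := Q false (Fin.last N)
  set r := Q true y.castSucc
  set u := U y.castSucc (φ x).castSucc (Fin.last N)
  set f := E l (fun w => S (true :: w)) (fun z => (φ z).castSucc) y.castSucc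
  set s := Diag.S y.castSucc (Fin.last N)
  calc _ = q * r * u * Q false y.castSucc *
        E l (fun w => S (true :: w)) (fun z => (φ z).castSucc) (Fin.last N) * dagger u := by
        simp only [mul_assoc]
    _ = r * p * q * (s * E l (fun w => S (true :: w)) (fun z => (φ z).castSucc) (Fin.last N)) * dagger u := by
        rw [e1]; simp only [mul_assoc]
    _ = r * p * (q * f) * s * dagger u := by rw [s2]; simp only [mul_assoc]
    _ = r * (p * f) * q * s * dagger u := by rw [c1]; simp only [mul_assoc]
    _ = r * f * (p * q * s * dagger u) := by rw [c2]; simp only [mul_assoc]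
    _ = r * (f * q) * p := by rw [e2, ← c0]; simp only [mul_assoc]
    _ = r * q * (f * p) := by rw [← c1]; simp only [mul_assoc]
    _ = q * (r * (p * f)) := by rw [← c2, ← c3]; simp only [mul_assoc]

/-! ### Reordering the wires of a filter -/

/-- The wires in `L` are distinct and different from the wires of `l`. -/
def Fresh {α : Type} {N : ℕ} (l : List α) (φ : α → Fin N) (L : List (Fin N)) : Prop :=
  L.Nodup ∧ ∀ w ∈ l, ∀ v ∈ L, v ≠ φ w

theorem Fresh.succ {α : Type} {N : ℕ} {l : List α} {φ : α → Fin N} {L : List (Fin N)} (h : Fresh l φ L) :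
    Fresh l (fun z => (φ z).castSucc) (Fin.last N :: L.map Fin.castSucc) := by
  refine ⟨nodup_castSucc h.1, fun w hw v hv => ?_⟩
  rcases List.mem_cons.1 hv with rfl | hv
  · exact last_ne _
  · obtain ⟨u, hu, rfl⟩ := List.mem_map.1 hv
    exact (Fin.castSucc_injective N).ne (h.2 w hw u hu)

/-- Expanding both branches of an expansion in a bare monoid: the projections of the clean wires
move to the two ends, and the four subtrees `e0`, …, `e3` gather between the combined splittings. -/
theorem expand_aux {M : Type*} [Monoid M] {qa qb qc A u X0 X1 u' v e0 e1 v' w e2 e3 w' : M}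
    (hA : qa * A = qa * (u * X0 * X1 * u') * qa) (h0 : qb * X0 = qb * (v * e0 * e1 * v') * qb)
    (h1 : qc * X1 = qc * (w * e2 * e3 * w') * qc) (hab : Commute qa qb) (hac : Commute qa qc) (hbc : Commute qb qc)
    (hbu : Commute qb u) (hcu : Commute qc u) (hcX : Commute qc X0) (hbu' : Commute qb u') (hcu' : Commute qc u')
    (hcv : Commute qc (v * e0 * e1 * v')) (hbw : Commute qb (w * e2 * e3 * w'))
    (hw0 : Commute w e0) (hw1 : Commute w e1) (hv2 : Commute v' e2) (hv3 : Commute v' e3) (hvw : Commute v' w)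
    (hvw' : Commute v' w') :
    qa * qb * qc * A = qa * qb * qc * u * v * w * (e0 * e1 * e2 * e3) * (w' * v' * u' * qc * qb * qa) := by
  have s : v * e0 * e1 * v' * (w * e2 * e3 * w') = v * w * (e0 * e1 * e2 * e3) * (w' * v') := by
    calc _ = v * e0 * e1 * (v' * w) * e2 * e3 * w' := by simp only [mul_assoc]
      _ = v * e0 * (e1 * w) * (v' * e2) * e3 * w' := by rw [hvw.eq]; simp only [mul_assoc]
      _ = v * (e0 * w) * e1 * e2 * (v' * e3) * w' := by rw [← hw1.eq, hv2.eq]; simp only [mul_assoc]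
      _ = v * w * e0 * e1 * e2 * e3 * (v' * w') := by rw [← hw0.eq, hv3.eq]; simp only [mul_assoc]
      _ = _ := by rw [hvw'.eq]; simp only [mul_assoc]
  set x := v * e0 * e1 * v'
  set z := w * e2 * e3 * w'
  have hbcu : qb * qc * u = u * (qb * qc) := (hbu.mul_left hcu).eq
  calc _ = qb * qc * (qa * A) := by rw [mul_assoc qa, (hab.mul_right hac).eq]; simp only [mul_assoc]
    _ = qa * (qb * qc * u) * X0 * X1 * u' * qa := by
        rw [hA, ← mul_assoc, ← mul_assoc, ← (hab.mul_right hac).eq]; simp only [mul_assoc]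
    _ = qa * u * qb * (qc * X0) * X1 * u' * qa := by rw [hbcu]; simp only [mul_assoc]
    _ = qa * u * (qb * X0) * (qc * X1) * u' * qa := by rw [hcX.eq]; simp only [mul_assoc]
    _ = qa * u * qb * x * (qb * qc) * z * qc * u' * qa := by rw [h0, h1]; simp only [mul_assoc]
    _ = qa * u * qb * (x * qc) * (qb * z) * qc * u' * qa := by rw [hbc.eq]; simp only [mul_assoc]
    _ = qa * (u * (qb * qc)) * x * z * (qb * qc * u') * qa := by rw [← hcv.eq, hbw.eq]; simp only [mul_assoc]
    _ = qa * qb * qc * u * (x * z) * u' * (qb * qc) * qa := by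
        rw [← hbcu, (hbu'.mul_left hcu').eq]; simp only [mul_assoc]
    _ = _ := by rw [s, hbc.eq]; simp only [mul_assoc]

theorem U_comm_U {N : ℕ} (y x a y' x' a' : Fin N) (h1 : y ≠ y') (h2 : y ≠ x') (h3 : y ≠ a') (h4 : a ≠ y')
    (h5 : a ≠ x') (h6 : a ≠ a') (h7 : y' ≠ x) (h8 : a' ≠ x) : Commute (U y x a) (U y' x' a') :=
  Commute.mul_left (T_comm_U _ _ _ _ _ _ h4 h5 h6 h3.symm h8 h1.symm h7)
    (C_comm_U _ _ _ _ _ h1 h2 h3 h6.symm h4.symm)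

theorem commute_dagger_dagger {N : ℕ} {f g : Diag N N} (h : Commute f g) : Commute (dagger f) (dagger g) := by
  have := congrArg dagger h.eq
  rw [dagger_mul, dagger_mul] at this
  exact this.symm

/-- Expansion of a filter on its first two wires. -/
theorem Q_mul_E_cons_cons {α : Type} (i j : α) (l : List α) (S : List Bool → Bool) {N : ℕ} (φ : α → Fin N)
    (y a b c : Fin N) (h : Fresh l φ [c, b, a, y, φ i, φ j]) :
    Q false a * Q false b * Q false c * E (i :: j :: l) S φ y = split y (φ i) (φ j) a b c *
      (E l (fun w => S (false :: false :: w)) φ y * E l (fun w => S (false :: true :: w)) φ b *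
        E l (fun w => S (true :: false :: w)) φ a * E l (fun w => S (true :: true :: w)) φ c) *
      dagger (split y (φ i) (φ j) a b c) := by
  have hh := h.1
  have hl := h.2
  simp at hh
  simp at hl
  have hy : ∀ w ∈ l, y ≠ φ w := fun w hw => (hl w hw).2.2.2.1
  have ha : ∀ w ∈ l, a ≠ φ w := fun w hw => (hl w hw).2.2.1
  have hb : ∀ w ∈ l, b ≠ φ w := fun w hw => (hl w hw).2.1
  have hc : ∀ w ∈ l, c ≠ φ w := fun w hw => (hl w hw).1
  have r1 := Q_mul_E_cons i (j :: l) S φ y a (by grind) (by grind) (fun w hw => by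
    rcases List.mem_cons.1 hw with rfl | hw
    · grind
    · exact ha w hw)
  have r2 := Q_mul_E_cons j l (fun w => S (false :: w)) φ y b (by grind) (by grind) hb
  have r3 := Q_mul_E_cons j l (fun w => S (true :: w)) φ a c (by grind) (by grind) hc
  have qU (d y x a : Fin N) (h1 : d ≠ y) (h2 : d ≠ a) : Commute (Q false d) (U y x a) := Q_comm_U _ _ _ _ _ h1 h2
  have qE (d y : Fin N) (S) (h1 : d ≠ y) : Commute (Q false d) (E l S φ y) := Q_comm_E _ _ _ _ _ _ h1
  have qQ (d y : Fin N) (h1 : d ≠ y) : Commute (Q false d) (Q false y) := Q_comm_Q _ _ _ _ h1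
  have uu : Commute (U y (φ j) b) (U a (φ j) c) :=
    U_comm_U _ _ _ _ _ _ (by grind) (by grind) (by grind) (by grind) (by grind) (by grind) (by grind) (by grind)
  have key := expand_aux r1 r2 r3 (qQ _ _ (by grind)) (qQ _ _ (by grind)) (qQ _ _ (by grind))
    (qU _ _ _ _ (by grind) (by grind)) (qU _ _ _ _ (by grind) (by grind)) (Q_comm_E _ _ _ _ _ _ (by grind))
    (commute_dagger_U (qU _ _ _ _ (by grind) (by grind)))
    (commute_dagger_U (qU _ _ _ _ (by grind) (by grind)))
    ((((qU _ _ _ _ (by grind) (by grind)).mul_right (qE _ _ _ (by grind))).mul_right (qE _ _ _ (by grind))).mul_right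
      (commute_dagger_U (qU _ _ _ _ (by grind) (by grind))))
    ((((qU _ _ _ _ (by grind) (by grind)).mul_right (qE _ _ _ (by grind))).mul_right (qE _ _ _ (by grind))).mul_right
      (commute_dagger_U (qU _ _ _ _ (by grind) (by grind))))
    (U_comm_E _ _ _ _ _ _ _ ha hc (by grind) (by grind) (by grind))
    (U_comm_E _ _ _ _ _ _ _ ha hc (by grind) (by grind) (by grind))
    (commute_dagger_U (U_comm_E _ _ _ _ _ _ _ hy hb (by grind) (by grind) (by grind)).symm).symm
    (commute_dagger_U (U_comm_E _ _ _ _ _ _ _ hy hb (by grind) (by grind) (by grind)).symm).symm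
    (commute_dagger_U uu.symm).symm (commute_dagger_dagger uu)
  rw [key]
  simp only [split, dagger_mul, dagger_Q, mul_assoc]

/-- After expansion on two wires, `split_symm` exchanges the order of the tests; the subtrees stay
attached to their flags, and the two mixed ones commute. -/
theorem E_swap {α : Type} (i j : α) (l : List α) {S S' : List Bool → Bool} {N : ℕ} (φ : α → Fin N) (y : Fin N)
    (h : Fresh l φ [y, φ i, φ j]) (hS : ∀ p q w, S' (p :: q :: w) = S (q :: p :: w)) :
    E (i :: j :: l) S φ y = E (j :: i :: l) S' φ y := by
  -- Three new clean wires are adjoined, one for each splitting.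
  refine cancel_ancilla false ?_
  rw [above_one_E, above_one_E]
  refine cancel_ancilla false ?_
  simp only [map_mul, above_one_E, above_one_Q]
  refine cancel_ancilla false ?_
  simp only [map_mul, above_one_E, above_one_Q]
  simp only [← mul_assoc]
  have h1 := h.succ.succ.succ
  simp only [List.map] at h1
  set φ' := fun z => (φ z).castSucc.castSucc.castSucc
  set a := Fin.last (N + 2) with ha
  set b := (Fin.last (N + 1)).castSucc with hb
  set c := (Fin.last N).castSucc.castSucc with hc
  set y' := y.castSucc.castSucc.castSucc with hy
  have hh := h1.1
  have hl := h1.2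
  simp at hh
  simp at hl
  have h2 : Fresh l φ' [c, b, a, y', φ' i, φ' j] := ⟨by simp; grind, by simp; grind⟩
  have h3 : Fresh l φ' [c, a, b, y', φ' j, φ' i] := ⟨by simp; grind, by simp; grind⟩
  have r1 := Q_mul_E_cons_cons i j l S φ' _ _ _ _ h2
  have r2 := Q_mul_E_cons_cons j i l S' φ' _ _ _ _ h3
  have e1 : Q false b * Q false a = Q false a * Q false b := Q_comm_Q _ _ _ _ (by grind)
  have e2 := (E_comm_E l (fun w => S (true :: false :: w)) l (fun w => S (false :: true :: w)) φ' φ' a b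
    (by grind) (by grind) (by grind)).eq
  rw [r1, ← e1, r2, split_symm y' (φ' j) (φ' i) b a c (by simp; grind)]
  simp only [hS]
  rw [mul_assoc (E _ _ _ y') (E _ _ _ a), e2]
  simp only [mul_assoc]

/-- The new table is chosen before the number of wires, the wire names and the flag, since the
recursion uses it with one more wire and with two different flags. -/
theorem E_perm {α : Type} {l l' : List α} (h : l.Perm l') (S : List Bool → Bool) :
    ∃ S', ∀ {N : ℕ} (φ : α → Fin N) (y : Fin N), (y :: l.map φ).Nodup → E l S φ y = E l' S' φ y := by
  induction h generalizing S with
  | nil => exact ⟨S, fun _ _ _ => rfl⟩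
  | @cons x l l' hl ih =>
    obtain ⟨S0, h0⟩ := ih (fun w => S (false :: w))
    obtain ⟨S1, h1⟩ := ih (fun w => S (true :: w))
    -- The tables of the two branches are joined along the first letter.
    refine ⟨fun w => if w.headD false then S1 w.tail else S0 w.tail, fun {N} φ y hn => ?_⟩
    have hn' := nodup_castSucc hn
    simp only [List.map, List.map_map] at hn'
    have n1 : (y.castSucc :: l.map fun z => (φ z).castSucc).Nodup := by
      have := (List.nodup_cons.1 hn').2
      refine (List.Perm.nodup_iff (List.Perm.swap _ _ _)).1 this |>.of_cons
    have n2 : (Fin.last N :: l.map fun z => (φ z).castSucc).Nodup := by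
      refine (hn'.sublist ?_)
      exact List.Sublist.cons_cons _ (List.Sublist.cons _ (List.sublist_cons_self _ _))
    rw [E, E, h0 _ _ n1, h1 _ _ n2]
    rfl
  | swap i j l =>
    refine ⟨fun w => S (w.tail.headD false :: w.headD false :: w.tail.tail), fun φ y hn => ?_⟩
    refine E_swap j i l φ y ⟨?_, ?_⟩ fun _ _ _ => rfl
    · simp at hn ⊢; grind
    · simp at hn ⊢; grind
  | trans hl hl' ih ih' =>
    obtain ⟨S1, h1⟩ := ih S
    obtain ⟨S2, h2⟩ := ih' S1
    refine ⟨S2, fun φ y hn => (h1 φ y hn).trans (h2 φ y ?_)⟩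
    exact ((hl.map φ).cons y).nodup_iff.1 hn

/-! ### Filters and Toffoli gates -/

/-- The product of two independently expanded filters is again of the shape splitting, core, inverse
splitting; iterating it expands all four subtrees at once. -/
theorem expand_mul {M : Type*} [Monoid M] {p q A B u d u' v e v' : M} (hA : p * A = p * (u * d * u') * p)
    (hB : q * B = q * (v * e * v') * q) (hpq : Commute p q) (hpv : Commute p v) (hpe : Commute p e)
    (hpv' : Commute p v') (hqu : Commute q u) (hqd : Commute q d) (hqu' : Commute q u') (huv : Commute u' v)
    (hue : Commute u' e) (huv' : Commute u' v') (hdv : Commute d v) :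
    p * q * (A * B) = p * q * (u * v * (d * e) * (v' * u')) * (p * q) := by
  have h1 : Commute p (v * e * v') := (hpv.mul_right hpe).mul_right hpv'
  have h2 : Commute q (u * d * u') := (hqu.mul_right hqd).mul_right hqu'
  have h3 : u * d * u' * (v * e * v') = u * v * (d * e) * (v' * u') := by
    calc _ = u * d * (u' * v) * e * v' := by simp only [mul_assoc]
      _ = u * (d * v) * (u' * e) * v' := by rw [huv.eq]; simp only [mul_assoc]
      _ = u * v * d * e * (u' * v') := by rw [hdv.eq, hue.eq]; simp only [mul_assoc]
      _ = _ := by rw [huv'.eq]; simp only [mul_assoc]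
  calc p * q * (A * B) = q * (p * A) * B := by rw [hpq.eq]; simp only [mul_assoc]
    _ = q * p * (u * d * u') * p * B := by rw [hA]; simp only [mul_assoc]
    _ = p * (q * (u * d * u')) * p * B := by rw [← hpq.eq]; simp only [mul_assoc]
    _ = p * (u * d * u') * (q * p) * B := by rw [h2.eq]; simp only [mul_assoc]
    _ = p * (u * d * u') * p * (q * B) := by rw [← hpq.eq]; simp only [mul_assoc]
    _ = p * (u * d * u') * (p * q) * (v * e * v') * q := by rw [hB]; simp only [mul_assoc]
    _ = p * (u * d * u') * q * (p * (v * e * v')) * q := by rw [hpq.eq]; simp only [mul_assoc]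
    _ = p * ((u * d * u') * q) * (v * e * v') * (p * q) := by rw [h1.eq]; simp only [mul_assoc]
    _ = p * q * ((u * d * u') * (v * e * v')) * (p * q) := by rw [← h2.eq]; simp only [mul_assoc]
    _ = _ := by rw [h3]

theorem S_comm_E {α : Type} (l : List α) (S : List Bool → Bool) {N : ℕ} (φ : α → Fin N) (y i j : Fin N)
    (hi : ∀ w ∈ l, i ≠ φ w) (hj : ∀ w ∈ l, j ≠ φ w) (hyi : y ≠ i) (hyj : y ≠ j) :
    Commute (Diag.S i j) (E l S φ y) := by
  rw [Commute, SemiconjBy, S_eq_perm, perm_mul_E, Equiv.swap_apply_of_ne_of_ne hyi hyj]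
  refine congrArg (· * _) (E_congr _ _ _ fun w hw => ?_)
  exact Equiv.swap_apply_of_ne_of_ne (hi w hw).symm (hj w hw).symm

theorem expand_conj {M : Type*} [Monoid M] {p X m d m' s s' : M} (h : p * X = p * (m * d * m') * p)
    (hs : Commute p s) (hs' : Commute p s') : p * (s * X * s') = p * (s * m * d * (m' * s')) * p := by
  calc _ = p * s * X * s' := by simp only [mul_assoc]
    _ = s * (p * X) * s' := by rw [hs.eq]; simp only [mul_assoc]
    _ = s * p * (m * d * m') * (p * s') := by rw [h]; simp only [mul_assoc]
    _ = _ := by rw [hs'.eq, ← hs.eq]; simp only [mul_assoc]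

/-- Here `m` is the full splitting and `d` the product of the leaf filters. The gate `t` picks up a
swap `s` of flags on entering, loses it on leaving, and in between `s` replaces `d` by `d'`. -/
theorem T_mul_E_core {M : Type*} [Monoid M] {t s m m' v w e e' d d' : M} (hw : Commute t w) (hv : Commute t v)
    (he : w * (v * e) = w * (m * d * m') * w) (he' : w * (v * e') = w * (m * d' * m') * w) (hm : t * m = m * (s * t))
    (hm' : m' * t = s * t * m') (hd : Commute t d) (hsd : s * d = d' * s) :
    w * (v * (t * e)) = w * (v * (e' * t)) := by
  calc w * (v * (t * e)) = w * (v * t) * e := by simp only [mul_assoc]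
    _ = w * t * (v * e) := by rw [← hv.eq]; simp only [mul_assoc]
    _ = t * (w * (v * e)) := by rw [← hw.eq, mul_assoc]
    _ = t * w * (m * d * m') * w := by rw [he]; simp only [mul_assoc]
    _ = w * (t * m) * d * m' * w := by rw [hw.eq]; simp only [mul_assoc]
    _ = w * m * s * (t * d) * m' * w := by rw [hm]; simp only [mul_assoc]
    _ = w * m * (s * d) * t * m' * w := by rw [hd.eq]; simp only [mul_assoc]
    _ = w * m * d' * (s * t * m') * w := by rw [hsd]; simp only [mul_assoc]
    _ = w * m * d' * m' * (t * w) := by rw [← hm']; simp only [mul_assoc]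
    _ = w * (m * d' * m') * w * t := by rw [hw.eq]; simp only [mul_assoc]
    _ = w * (v * (e' * t)) := by rw [← he']; simp only [mul_assoc]

set_option maxHeartbeats 1000000 in
/-- Expansion of a filter on its first three wires. -/
theorem Q_mul_E_cons_cons_cons {α : Type} (i j k : α) (l : List α) (S : List Bool → Bool) {N : ℕ} (φ : α → Fin N)
    (y a b c y' b' a' c' : Fin N) (h : Fresh l φ [y, φ i, φ j, φ k, a, b, c, y', b', a', c']) :
    Q false y' * Q false b' * Q false a' * Q false c' * (Q false a * Q false b * Q false c * E (i :: j :: k :: l) S φ y) =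
      Q false y' * Q false b' * Q false a' * Q false c' * (split y (φ i) (φ j) a b c *
        (U y (φ k) y' * U b (φ k) b' * U a (φ k) a' * U c (φ k) c') *
        (E l (fun w => S (false :: false :: false :: w)) φ y * E l (fun w => S (false :: false :: true :: w)) φ y' *
          (E l (fun w => S (false :: true :: false :: w)) φ b * E l (fun w => S (false :: true :: true :: w)) φ b') *
          (E l (fun w => S (true :: false :: false :: w)) φ a * E l (fun w => S (true :: false :: true :: w)) φ a') *
          (E l (fun w => S (true :: true :: false :: w)) φ c * E l (fun w => S (true :: true :: true :: w)) φ c')) *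
        dagger (split y (φ i) (φ j) a b c * (U y (φ k) y' * U b (φ k) b' * U a (φ k) a' * U c (φ k) c'))) *
      (Q false y' * Q false b' * Q false a' * Q false c') := by
  have hh := h.1
  have hl := h.2
  simp at hh
  simp at hl
  have f1 : Fresh (k :: l) φ [c, b, a, y, φ i, φ j] := ⟨by simp; grind, by simp; grind⟩
  have qU (d y x a : Fin N) (h1 : d ≠ y) (h2 : d ≠ a) : Commute (Q false d) (U y x a) := Q_comm_U _ _ _ _ _ h1 h2
  have qE (d y : Fin N) (S) (h1 : d ≠ y) : Commute (Q false d) (E l S φ y) := Q_comm_E _ _ _ _ _ _ h1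
  have qQ (d y : Fin N) (h1 : d ≠ y) : Commute (Q false d) (Q false y) := Q_comm_Q _ _ _ _ h1
  have qU' (d y x a : Fin N) (h1 : d ≠ y) (h2 : d ≠ a) : Commute (Q false d) (dagger (U y x a)) :=
    commute_dagger_U (qU _ _ _ _ h1 h2)
  have uU (y a y' a' : Fin N) (h1 : [φ k, y, a, y', a'].Nodup) : Commute (U y (φ k) a) (U y' (φ k) a') := by
    simp at h1
    exact U_comm_U _ _ _ _ _ _ (by grind) (by grind) (by grind) (by grind) (by grind) (by grind) (by grind) (by grind)
  have uU' (y a y' a' : Fin N) (h1 : [φ k, y, a, y', a'].Nodup) : Commute (dagger (U y (φ k) a)) (U y' (φ k) a') := by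
    refine (commute_dagger_U (uU _ _ _ _ ?_)).symm
    simp at h1 ⊢
    grind
  have u'U' (y a y' a' : Fin N) (h1 : [φ k, y, a, y', a'].Nodup) :
      Commute (dagger (U y (φ k) a)) (dagger (U y' (φ k) a')) := commute_dagger_dagger (uU _ _ _ _ h1)
  have uE (y a z : Fin N) (S) (hy : ∀ w ∈ l, y ≠ φ w) (ha : ∀ w ∈ l, a ≠ φ w) (hzy : z ≠ y) (hza : z ≠ a)
      (hz : z ≠ φ k) : Commute (U y (φ k) a) (E l S φ z) := U_comm_E _ _ _ _ _ _ _ hy ha hzy hza hz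
  have u'E (y a z : Fin N) (S) (hy : ∀ w ∈ l, y ≠ φ w) (ha : ∀ w ∈ l, a ≠ φ w) (hzy : z ≠ y) (hza : z ≠ a)
      (hz : z ≠ φ k) : Commute (dagger (U y (φ k) a)) (E l S φ z) :=
    (commute_dagger_U (uE _ _ _ _ hy ha hzy hza hz).symm).symm
  have hy : ∀ w ∈ l, y ≠ φ w := fun w hw => (hl w hw).1
  have ha : ∀ w ∈ l, a ≠ φ w := fun w hw => (hl w hw).2.2.2.2.1
  have hb : ∀ w ∈ l, b ≠ φ w := fun w hw => (hl w hw).2.2.2.2.2.1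
  have hc : ∀ w ∈ l, c ≠ φ w := fun w hw => (hl w hw).2.2.2.2.2.2.1
  have hy' : ∀ w ∈ l, y' ≠ φ w := fun w hw => (hl w hw).2.2.2.2.2.2.2.1
  have hb' : ∀ w ∈ l, b' ≠ φ w := fun w hw => (hl w hw).2.2.2.2.2.2.2.2.1
  have ha' : ∀ w ∈ l, a' ≠ φ w := fun w hw => (hl w hw).2.2.2.2.2.2.2.2.2.1
  have hc' : ∀ w ∈ l, c' ≠ φ w := fun w hw => (hl w hw).2.2.2.2.2.2.2.2.2.2
  have main (u v : Fin N) (hu : ∀ w ∈ l, v ≠ φ w) (h1 : v ≠ u) (h2 : v ≠ φ k) (S : List Bool → Bool) :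
      Q false v * E (k :: l) S φ u = Q false v * (U u (φ k) v * (E l (fun w => S (false :: w)) φ u *
      E l (fun w => S (true :: w)) φ v) * dagger (U u (φ k) v)) * Q false v := by
    rw [Q_mul_E_cons k l S φ u v h1 h2 hu, mul_assoc (U u (φ k) v)]
  have ry := main y y' hy' (by grind) (by grind) (fun w => S (false :: false :: w))
  have rb := main b b' hb' (by grind) (by grind) (fun w => S (false :: true :: w))
  have ra := main a a' ha' (by grind) (by grind) (fun w => S (true :: false :: w))
  have rc := main c c' hc' (by grind) (by grind) (fun w => S (true :: true :: w))
  -- The flags `y`, `b`, `a`, `c` are split by the third wire one after another; the commutations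
  -- are left to the end.
  have e1 := expand_mul ry rb ?_ ?_ ?_ ?_ ?_ ?_ ?_ ?_ ?_ ?_ ?_
  have e2 := expand_mul e1 ra ?_ ?_ ?_ ?_ ?_ ?_ ?_ ?_ ?_ ?_ ?_
  have e3 := expand_mul e2 rc ?_ ?_ ?_ ?_ ?_ ?_ ?_ ?_ ?_ ?_ ?_
  · have qs (d : Fin N) (hd : d ∉ [y, φ i, φ j, a, b, c]) : Commute (Q false d) (split y (φ i) (φ j) a b c) := by
      simp at hd
      unfold split
      exact ((((((qQ _ _ (by grind)).mul_right (qQ _ _ (by grind))).mul_right (qQ _ _ (by grind))).mul_right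
        (qU _ _ _ _ (by grind) (by grind))).mul_right (qU _ _ _ _ (by grind) (by grind))).mul_right
        (qU _ _ _ _ (by grind) (by grind)))
    have qp : Commute (Q false y' * Q false b' * Q false a' * Q false c') (split y (φ i) (φ j) a b c) :=
      (((qs _ (by simp; grind)).mul_left (qs _ (by simp; grind))).mul_left (qs _ (by simp; grind))).mul_left
        (qs _ (by simp; grind))
    have qp' := commute_dagger_dagger qp
    have e : dagger (Q false y' * Q false b' * Q false a' * Q false c') =
        Q false y' * Q false b' * Q false a' * Q false c' := by
      simp only [dagger_mul, dagger_Q]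
      have q1 : Commute (Q false c') (Q false a') := qQ _ _ (by grind)
      have q2 : Commute (Q false c' * Q false a') (Q false b') := (qQ _ _ (by grind)).mul_left (qQ _ _ (by grind))
      have q3 : Commute (Q false b' * (Q false c' * Q false a')) (Q false y') :=
        (qQ _ _ (by grind)).mul_left ((qQ _ _ (by grind)).mul_left (qQ _ _ (by grind)))
      rw [← mul_assoc, ← mul_assoc, q2.eq, q3.eq, q1.eq]
      simp only [mul_assoc]
    rw [e] at qp'
    rw [Q_mul_E_cons_cons i j (k :: l) S φ y a b c f1, expand_conj e3 qp qp', dagger_mul (split y (φ i) (φ j) a b c)]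
    simp only [dagger_mul]

  all_goals repeat' first
    | with_reducible apply Commute.mul_left
    | with_reducible apply Commute.mul_right
    | ((with_reducible refine qQ _ _ ?_); grind)
    | ((with_reducible refine qU _ _ _ _ ?_ ?_) <;> grind)
    | ((with_reducible refine qE _ _ _ ?_); grind)
    | ((with_reducible refine qU' _ _ _ _ ?_ ?_) <;> grind)
    | ((with_reducible refine uU' _ _ _ _ ?_); simp; grind)
    | ((with_reducible refine u'U' _ _ _ _ ?_); simp; grind)
    | ((with_reducible refine u'E _ _ _ _ (by assumption) (by assumption) ?_ ?_ ?_) <;> grind)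
    | ((with_reducible refine (uE _ _ _ _ (by assumption) (by assumption) ?_ ?_ ?_).symm) <;> grind)

/-- The substitution in the table exchanges exactly the two leaves with both controls 1, whose flags
are `c` and `c'`; by `T_mul_split` the Toffoli gate exchanges exactly these flags. -/
theorem Q_mul_T_mul_E {α : Type} (i j k : α) (l : List α) {S S' : List Bool → Bool} {N : ℕ} (φ : α → Fin N)
    (y a b c y' b' a' c' : Fin N) (h' : Fresh l φ [y', b', a', c', a, b, c, y, φ i, φ j, φ k])
    (hS : ∀ p q r w, S' (p :: q :: r :: w) = S (p :: q :: (r ^^ (p && q)) :: w)) :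
    Q false y' * Q false b' * Q false a' * Q false c' * (Q false a * Q false b * Q false c *
      (T (φ i) (φ j) (φ k) * E (i :: j :: k :: l) S φ y)) =
    Q false y' * Q false b' * Q false a' * Q false c' * (Q false a * Q false b * Q false c *
      (E (i :: j :: k :: l) S' φ y * T (φ i) (φ j) (φ k))) := by
  have h : Fresh l φ [y, φ i, φ j, φ k, a, b, c, y', b', a', c'] := by
    have hp := (List.perm_append_comm (l₁ := [y, φ i, φ j, φ k])).trans
      ((List.perm_append_comm (l₁ := [a, b, c]) (l₂ := [y', b', a', c'])).append_right [y, φ i, φ j, φ k])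
    exact ⟨hp.nodup_iff.2 h'.1, fun w hw v hv => h'.2 w hw v (hp.mem_iff.1 hv)⟩
  have hl : ∀ v ∈ [y, a, b, c, y', b', a', c', φ k], ∀ w ∈ l, v ≠ φ w := fun v hv w hw => h.2 w hw v (by
    simp at hv ⊢
    grind)
  have hv : ∀ v ∈ [y, a, b, c, y', b', a', c'], v ≠ φ i ∧ v ≠ φ j ∧ v ≠ φ k := by
    have hh := h.1
    simp at hh ⊢
    grind
  have hc : ∀ v ∈ [φ i, φ j, φ k, y, a, b, y', b', a'], v ≠ c ∧ v ≠ c' := by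
    have hh := h.1
    simp at hh ⊢
    grind
  have hcc : c ≠ c' := by
    have hh := h.1
    simp at hh
    grind
  have r := fun S => Q_mul_E_cons_cons_cons i j k l S φ y a b c y' b' a' c' h
  have hm := T_mul_split y (φ i) (φ j) (φ k) a b c y' b' a' c' h.1
  have tq : ∀ d ∈ [y, a, b, c, y', b', a', c'], Commute (T (φ i) (φ j) (φ k)) (Q false d) := fun d hd =>
    (show Commute _ _ from Q_comm_T false d (φ i) (φ j) (φ k) (hv d hd).2.2).symm
  have te : ∀ (S), ∀ d ∈ [y, a, b, c, y', b', a', c'], Commute (T (φ i) (φ j) (φ k)) (E l S φ d) :=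
    fun S d hd => T_comm_E _ _ _ _ _ _ _ (hl _ (by simp)) (hv d hd).2.2.symm (hv d hd).1 (hv d hd).2.1
  have ts : Diag.S c c' * T (φ i) (φ j) (φ k) = T (φ i) (φ j) (φ k) * Diag.S c c' := by
    have h1 := hc (φ i) (by simp)
    have h2 := hc (φ j) (by simp)
    have h3 := hc (φ k) (by simp)
    rw [S_eq_perm, perm_mul_T, Equiv.swap_apply_of_ne_of_ne h1.1 h1.2, Equiv.swap_apply_of_ne_of_ne h2.1 h2.2,
      Equiv.swap_apply_of_ne_of_ne h3.1 h3.2]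
  -- The flipped relation governs the inverse splitting.
  have hm' := congrArg dagger hm
  rw [dagger_mul, dagger_T, dagger_mul _ (Diag.S _ _ * _), dagger_mul (Diag.S _ _), dagger_S, dagger_T, ← ts] at hm'
  have se : ∀ (S), ∀ d ∈ [y, a, b, y', b', a'], Commute (Diag.S c c') (E l S φ d) := fun S d hd =>
    S_comm_E _ _ _ _ _ _ (hl _ (by simp)) (hl _ (by simp)) (hc d (by simp at hd ⊢; tauto)).1
      (hc d (by simp at hd ⊢; tauto)).2
  refine T_mul_E_core ?_ ?_ (r S) (r S') hm hm' ?_ ?_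
  · exact (((tq _ (by simp)).mul_right (tq _ (by simp))).mul_right (tq _ (by simp))).mul_right (tq _ (by simp))
  · exact ((tq _ (by simp)).mul_right (tq _ (by simp))).mul_right (tq _ (by simp))
  · repeat' first | with_reducible apply Commute.mul_right | exact te _ _ (by simp)
  -- In the six other leaves the tables agree, and the swap of `c` and `c'` commutes with them.
  · simp only [hS, Bool.and_false, Bool.and_true, Bool.xor_false, Bool.xor_true, Bool.not_false, Bool.not_true]
    have e1 : Diag.S c c' * (E l (fun w => S (true :: true :: false :: w)) φ c *
        E l (fun w => S (true :: true :: true :: w)) φ c') = E l (fun w => S (true :: true :: true :: w)) φ c *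
        E l (fun w => S (true :: true :: false :: w)) φ c' * Diag.S c c' := by
      rw [← mul_assoc, S_mul_E _ _ _ _ _ (hl _ (by simp)) (hl _ (by simp)), mul_assoc, S_comm,
        S_mul_E _ _ _ _ _ (hl _ (by simp)) (hl _ (by simp)), ← mul_assoc,
        (E_comm_E _ _ _ _ _ _ _ _ hcc.symm (hl _ (by simp)) (hl _ (by simp))).eq]
    rw [← mul_assoc, Commute.eq (a := Diag.S c c'), mul_assoc, e1, ← mul_assoc]
    repeat' first | with_reducible apply Commute.mul_right | exact se _ _ (by simp)

theorem T_mul_E_cons_cons_cons {α : Type} (i j k : α) (l : List α) {S S' : List Bool → Bool} {N : ℕ} (φ : α → Fin N)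
    (y : Fin N) (h : Fresh l φ [y, φ i, φ j, φ k])
    (hS : ∀ p q r w, S' (p :: q :: r :: w) = S (p :: q :: (r ^^ (p && q)) :: w)) :
    T (φ i) (φ j) (φ k) * E (i :: j :: k :: l) S φ y = E (i :: j :: k :: l) S' φ y * T (φ i) (φ j) (φ k) := by
  -- Seven clean wires: three for splitting by the controls and four for splitting each resulting
  -- flag by the target.
  iterate 7
    refine cancel_ancilla false ?_
    simp only [map_mul, above_one_E, above_one_Q, above_one_T]
  have h1 := h.succ.succ.succ.succ.succ.succ.succ
  have h2 := Q_mul_T_mul_E i j k l _ _ _ _ _ _ _ _ _ h1 hS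
  simpa only [mul_assoc] using h2

/-! ### Filters without a condition -/

theorem E_map {α β : Type} (f : β → α) (l : List β) (S : List Bool → Bool) {N : ℕ} (φ : α → Fin N) (y : Fin N) :
    E (l.map f) S φ y = E l S (fun z => φ (f z)) y := by
  induction l generalizing S N with
  | nil => rfl
  | cons x l ih => rw [List.map_cons, E, E, ih, ih]

/-- The partial identity defined on the states in which the wires `l` carry a word in `S`. -/
noncomputable def pfilter {N : ℕ} (l : List (Fin N)) (S : List Bool → Bool) : Diag N N :=
  -- A flag prepared as `|1⟩` is always active and makes the condition unconditional; `⟨1|` rejects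
  -- the states whose flag would have to be 0.
  ancilla true (E l S Fin.castSucc (Fin.last N))

theorem pfilter_true {N : ℕ} (l : List (Fin N)) : pfilter l (fun _ => true) = 1 := by
  rw [pfilter, E_true, ← map_one (above N 1), ancilla_above]

theorem perm_mul_pfilter {N : ℕ} (π : Equiv.Perm (Fin N)) (l : List (Fin N)) (S : List Bool → Bool) :
    perm π * pfilter l S = pfilter (l.map π) S * perm π := by
  refine ancilla_conj true ?_
  rw [perm_above, perm_mul_E, E_map]
  have h1 (i : Fin N) : sumPerm π 1 i.castSucc = (π i).castSucc := sumPerm_castAdd _ _ _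
  have h2 : sumPerm π 1 (Fin.last N) = Fin.last N := sumPerm_natAdd _ _ (0 : Fin 1)
  simp only [h1, h2]

theorem pfilter_perm {N : ℕ} {l l' : List (Fin N)} (h : l.Perm l') (hl : l.Nodup) (S : List Bool → Bool) :
    ∃ S', pfilter l S = pfilter l' S' := by
  obtain ⟨S', h'⟩ := E_perm h S
  exact ⟨S', congrArg (ancilla true) (h' _ _ (nodup_castSucc hl))⟩

theorem T_mul_pfilter {N : ℕ} {i j k : Fin N} {l : List (Fin N)} (h : (i :: j :: k :: l).Nodup)
    (S : List Bool → Bool) : ∃ S', T i j k * pfilter (i :: j :: k :: l) S =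
      pfilter (i :: j :: k :: l) S' * T i j k := by
  -- The new table tests the word obtained after the Toffoli gate has acted on its first three
  -- letters.
  refine ⟨fun w => S (w.getD 0 false :: w.getD 1 false ::
    (w.getD 2 false ^^ (w.getD 0 false && w.getD 1 false)) :: w.drop 3), ancilla_conj true ?_⟩
  rw [above_one_T]
  have h' := nodup_castSucc h
  refine T_mul_E_cons_cons_cons i j k l Fin.castSucc (Fin.last N) ⟨?_, ?_⟩ fun _ _ _ _ => rfl
  · simp at h' ⊢
    tauto
  · intro w hw v hv
    rcases List.mem_cons.1 hv with rfl | hv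
    · exact last_ne w
    · simp at h hv
      rcases hv with rfl | rfl | rfl <;> refine (Fin.castSucc_injective N).ne ?_ <;> rintro rfl <;> tauto

theorem ancilla_E_map_castSucc {N : ℕ} (l : List (Fin N)) (S : List Bool → Bool) :
    ancilla true (E (l.map Fin.castSucc) S Fin.castSucc (Fin.last (N + 1))) = above N 1 (pfilter l S) := by
  rw [pfilter, above_ancilla, above_one_E, E_map, S_mul_E, mul_assoc, S_sq, mul_one]
  · exact fun w _ => (Fin.castSucc_injective (N + 1)).ne (last_ne w)
  · exact fun w _ => last_ne _

/-- Fixing a tested wire to `|1⟩` selects the branch of the decision tree in which that letter is 1.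
-/
theorem ancilla_pfilter {N : ℕ} (l : List (Fin N)) (S : List Bool → Bool) :
    ancilla true (pfilter (Fin.last N :: l.map Fin.castSucc) S) = pfilter l (fun w => S (true :: w)) := by
  rw [← ancilla_Q_mul, pfilter, mul_ancilla, above_one_Q,
    Q_true_mul_E_cons _ _ _ _ _ (last_ne _) fun w _ => last_ne w, ← above_one_Q, ← mul_ancilla,
    ancilla_E_map_castSucc, ancilla_Q_mul, ancilla_above]

/-- A projection onto `|1⟩` is one more decision whose branch 0 rejects everything. This is where an
active flag is used to make a condition hold outright. -/
theorem Q_mul_above_pfilter {N : ℕ} (l : List (Fin N)) (S : List Bool → Bool) :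
    Q true (Fin.last N) * above N 1 (pfilter l S) =
      pfilter (Fin.last N :: l.map Fin.castSucc) (fun w => w.headD false && S w.tail) := by
  have h := Q_true_mul_E_cons' (Fin.last N) (l.map Fin.castSucc) (fun w => w.headD false && S w.tail) Fin.castSucc
    (Fin.last (N + 1)) (last_ne _) (fun w _ => last_ne w) fun _ => rfl
  refine Eq.trans ?_ (ancilla_Q_mul true _)
  rw [h, ancilla_Q_mul, ← above_one_Q, ← mul_ancilla]
  exact congrArg _ (ancilla_E_map_castSucc l S).symm

/-! ### Evaluation of filters -/

theorem ket_comp_addKet {N : ℕ} (v : Fin N → Bool) (b : Bool) :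
    ket v ⊚ addKet N b = ket (Fin.snoc v b : Fin (N + 1) → Bool) := by
  have h : ket (Fin.snoc v b : Fin (N + 1) → Bool) = ket v ⊛ bit b := by
    rw [ket]
    simp only [Fin.snoc_castSucc, Fin.snoc_last]
  rw [h, tens_split, tens_one_zero]
  rfl

theorem eval_addKet {N : ℕ} (v : Fin N → Bool) (b : Bool) :
    eval (addKet N b) (List.ofFn v) = some (List.ofFn (Fin.snoc v b : Fin (N + 1) → Bool)) :=
  (ket_comp_iff _ _ _).1 (ket_comp_addKet v b)

theorem eval_addBra {N : ℕ} (v : Fin N → Bool) {a b : Bool} (h : a ≠ b) :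
    eval (addBra N b) (List.ofFn (Fin.snoc v a : Fin (N + 1) → Bool)) = none := by
  refine Option.eq_none_iff_forall_ne_some.2 fun l hl => ?_
  obtain ⟨u, rfl, -⟩ := ket_comp _ _ hl
  rw [eval_dagger, dagger_addBra, eval_addKet] at hl
  have := congrFun (List.ofFn_injective (Option.some.inj hl)) (Fin.last N)
  rw [Fin.snoc_last, Fin.snoc_last] at this
  exact h this.symm

theorem ket_comp_perm {N : ℕ} (v : Fin N → Bool) (π : Equiv.Perm (Fin N)) : ket v ⊚ perm π = ket (v ∘ π) :=
  (ket_comp_iff _ _ _).2 (perm_realizes π v)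

/-- For the last wire the projection is absorbed by its own ket; a wire permutation brings any other
wire there. -/
theorem ket_comp_Q {N : ℕ} (v : Fin N → Bool) (i : Fin N) : ket v ⊚ Q (v i) i = ket v := by
  cases N with
  | zero => exact i.elim0
  | succ N =>
    have h : ∀ u : Fin (N + 1) → Bool, ket u ⊚ Q (u (Fin.last N)) (Fin.last N) = ket u := fun u => by
      have := ket_comp_addKet (fun j : Fin N => u j.castSucc) (u (Fin.last N))
      rw [show (Fin.snoc (fun j : Fin N => u j.castSucc) (u (Fin.last N)) : Fin (N + 1) → Bool) = u from
        Fin.snoc_init_self u] at this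
      rw [← this, assoc, addKet_Q]
    have h1 := perm_conj_Q (Equiv.swap (Fin.last N) i) (v i) (Fin.last N)
    rw [Equiv.swap_apply_left] at h1
    rw [← h1, mul_def, mul_def, ← assoc, ← assoc, ket_comp_perm]
    have h2 := h (v ∘ Equiv.swap (Fin.last N) i)
    rw [Function.comp_apply, Equiv.swap_apply_left] at h2
    rw [h2, ← ket_comp_perm, assoc, ← mul_def, perm_mul_perm_inv]
    exact comp_one _

/-- On a point every tested wire has a known value, so the decision tree reduces to a single leaf.
-/
theorem ket_comp_E {α : Type} (l : List α) (S : List Bool → Bool) {N : ℕ} (φ : α → Fin N) (y : Fin N)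
    (h : ∀ x ∈ l, y ≠ φ x) (v : Fin N → Bool) :
    ket v ⊚ E l S φ y = ket v ⊚ if S (l.map fun x => v (φ x)) then 1 else Q false y := by
  induction l generalizing S with
  | nil => rfl
  | cons x l ih =>
    have hl : ∀ x ∈ l, y ≠ φ x := fun x hx => h x (List.mem_cons_of_mem _ hx)
    have hx := h x List.mem_cons_self
    have key : ∀ b, v (φ x) = b → ket v ⊚ E (x :: l) S φ y = ket v ⊚ E l (fun w => S (b :: w)) φ y := by
      rintro b rfl
      have : Q (v (φ x)) (φ x) * E (x :: l) S φ y = Q (v (φ x)) (φ x) * E l (fun w => S (v (φ x) :: w)) φ y := by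
        cases v (φ x)
        · exact Q_false_mul_E_cons _ _ _ _ _ hx
        · exact Q_true_mul_E_cons _ _ _ _ _ hx hl
      rw [← ket_comp_Q v (φ x), assoc, assoc, ← mul_def, this, mul_def]
    rw [key _ rfl, ih _ hl]
    rfl

theorem eval_pfilter {N : ℕ} (l : List (Fin N)) (S : List Bool → Bool) (v : Fin N → Bool) :
    eval (pfilter l S) (List.ofFn v) = if S (l.map v) then some (List.ofFn v) else none := by
  have h1 := ket_comp_E l S Fin.castSucc (Fin.last N) (fun x _ => last_ne x) (Fin.snoc v true : Fin (N + 1) → Bool)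
  simp only [Fin.snoc_castSucc] at h1
  have h2 : ket v ⊚ pfilter l S =
      ket v ⊚ (addKet N true ⊚ (if S (l.map v) then 1 else Q false (Fin.last N)) ⊚ addBra N true) := by
    rw [pfilter, ancilla, ← assoc, ← assoc, ket_comp_addKet, h1, ← assoc, ← assoc, ket_comp_addKet]
  have h3 := congrArg (fun f => eval f []) h2
  simp only [eval_comp, eval_ket, Option.bind_some] at h3
  rw [h3, eval_addKet, Option.bind_some]
  split
  · rw [show eval (1 : Diag (N + 1) (N + 1)) _ = _ from eval_one (by simp), Option.bind_some, eval_dagger,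
      dagger_addBra, eval_addKet]
  -- The leaf demands flag 0 whereas the flag was prepared as 1, so the result is undefined.
  · rw [← addBra_addKet, eval_comp, eval_addBra _ (by simp)]
    rfl

/-! ### Restriction idempotents are filters -/

/-- The filter on all wires. -/
noncomputable def filter (N : ℕ) (S : List Bool → Bool) : Diag N N := pfilter (List.finRange N) S

def IsFilter {N : ℕ} (e : Diag N N) : Prop := ∃ S, e = filter N S

theorem eval_filter {N : ℕ} (S : List Bool → Bool) (v : Fin N → Bool) :
    eval (filter N S) (List.ofFn v) = if S (List.ofFn v) then some (List.ofFn v) else none := by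
  rw [filter, eval_pfilter, List.ofFn_eq_map]

theorem eval_filter_eq_some_iff {N : ℕ} (S : List Bool → Bool) (b c : Fin N → Bool) :
    eval (filter N S) (List.ofFn b) = some (List.ofFn c) ↔ b = c ∧ S (List.ofFn b) = true := by
  rw [eval_filter, Option.ite_none_right_eq_some, Option.some.injEq, and_comm]
  exact and_congr_left fun _ => ⟨fun h => List.ofFn_injective h, fun h => h ▸ rfl⟩

theorem filter_congr {N : ℕ} {S S' : List Bool → Bool} (h : ∀ v : Fin N → Bool, S (List.ofFn v) = S' (List.ofFn v)) :
    filter N S = filter N S' := by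
  refine congrArg (ancilla true) (E_congr_table _ _ _ fun w hw => ?_)
  rw [List.length_finRange] at hw
  subst hw
  simpa using h w.get

/-- The values on points recover the table on all words of length `N`, and the tree never consults
another word. This is the source of faithfulness. -/
theorem IsFilter.eq_of_eval {N : ℕ} {e e' : Diag N N} (he : IsFilter e) (he' : IsFilter e')
    (h : ∀ v : Fin N → Bool, eval e (List.ofFn v) = eval e' (List.ofFn v)) : e = e' := by
  obtain ⟨S, rfl⟩ := he
  obtain ⟨S', rfl⟩ := he'
  refine filter_congr fun v => ?_
  have := h v
  rw [eval_filter, eval_filter] at this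
  cases h1 : S (List.ofFn v) <;> cases h2 : S' (List.ofFn v) <;> simp [h1, h2] at this ⊢

theorem IsFilter.one (N : ℕ) : IsFilter (1 : Diag N N) := ⟨_, (pfilter_true _).symm⟩

theorem isFilter_pfilter {N : ℕ} {l : List (Fin N)} (h : l.Perm (List.finRange N)) (S : List Bool → Bool) :
    IsFilter (pfilter l S) := pfilter_perm h (h.nodup_iff.2 (List.nodup_finRange N)) S

theorem IsFilter.exists_pfilter {N : ℕ} {e : Diag N N} (he : IsFilter e) {l : List (Fin N)}
    (h : l.Perm (List.finRange N)) : ∃ S, e = pfilter l S := by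
  obtain ⟨S, rfl⟩ := he
  exact pfilter_perm h.symm (List.nodup_finRange N) S

theorem perm_finRange {N : ℕ} {l : List (Fin N)} (h : l.Nodup) (h' : ∀ i, i ∈ l) : l.Perm (List.finRange N) :=
  (List.perm_ext_iff_of_nodup h (List.nodup_finRange N)).2 fun i => by simp [h' i]

theorem perm_finRange_succ (N : ℕ) :
    (Fin.last N :: (List.finRange N).map Fin.castSucc).Perm (List.finRange (N + 1)) :=
  perm_finRange (nodup_castSucc (List.nodup_finRange N)) fun i => by
    refine Fin.lastCases (by simp) (fun i => ?_) i
    simp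

/-- Conjugation with `f` turns filters into filters. -/
def ReflectsFilters {n m : ℕ} (f : Diag n m) : Prop := ∀ e : Diag m m, IsFilter e → IsFilter (f ⊚ e ⊚ dagger f)

theorem ReflectsFilters.comp {n m k : ℕ} {f : Diag n m} {g : Diag m k} (hf : ReflectsFilters f)
    (hg : ReflectsFilters g) : ReflectsFilters (f ⊚ g) := fun e he => by
  have := hf _ (hg e he)
  rw [dagger_comp]
  simpa only [assoc] using this

theorem ReflectsFilters.dcast {a b a' b' : ℕ} {f : Diag a b} (h : a = a') (h' : b = b') (hf : ReflectsFilters f) :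
    ReflectsFilters (dcast h h' f) := by
  subst h; subst h'; exact hf

/-- A wire permutation only renames the tested wires; the renamed list again enumerates all wires
and may be reordered. -/
theorem IsPerm.reflectsFilters {n m : ℕ} {f : Diag n m} (hf : IsPerm f) : ReflectsFilters f := by
  obtain ⟨rfl, hf⟩ := hf
  obtain ⟨π, hπ⟩ := exists_realizes hf
  have h : f = perm π := eq_perm hf hπ
  rintro e ⟨S, rfl⟩
  rw [h, dagger_perm, ← mul_def, ← mul_def, filter, perm_mul_pfilter, mul_assoc, perm_mul_perm_inv, mul_one]
  refine isFilter_pfilter (perm_finRange ((List.nodup_finRange m).map π.injective) fun i => ?_) S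
  exact List.mem_map.2 ⟨π.symm i, List.mem_finRange _, π.apply_symm_apply i⟩

/-- A filter may be rewritten so as to test the wires of the gate first; the gate then passes
through by a substitution in the table and cancels against its own flip. -/
theorem reflectsFilters_T {N : ℕ} {i j k : Fin N} (h : [i, j, k].Nodup) : ReflectsFilters (T i j k) := by
  intro e he
  obtain ⟨l, hl⟩ : ∃ l, (i :: j :: k :: l).Perm (List.finRange N) := by
    have hs : [i, j, k].Subperm (List.finRange N) := h.subperm fun x _ => List.mem_finRange x
    obtain ⟨l', hp, hs⟩ := hs
    obtain ⟨l, hl⟩ := hs.exists_perm_append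
    exact ⟨l, ((hp.append_right l).symm.trans hl.symm :)⟩
  obtain ⟨S, rfl⟩ := he.exists_pfilter hl
  obtain ⟨S', hS⟩ := T_mul_pfilter (hl.nodup_iff.2 (List.nodup_finRange N)) S
  rw [dagger_T, ← mul_def, ← mul_def, hS, mul_assoc, T_sq, mul_one]
  exact isFilter_pfilter hl S'

theorem reflectsFilters_addKet (N : ℕ) : ReflectsFilters (addKet N true) := by
  intro e he
  obtain ⟨S, rfl⟩ := he.exists_pfilter (perm_finRange_succ N)
  rw [dagger_addKet]
  exact ⟨_, ancilla_pfilter _ S⟩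

theorem reflectsFilters_addBra (N : ℕ) : ReflectsFilters (addBra N true) := by
  rintro e ⟨S, rfl⟩
  rw [dagger_addBra, addBra_comp, assoc, addBra_addKet, ← mul_def, ← Q_last_comm_above, filter, Q_mul_above_pfilter]
  exact isFilter_pfilter (perm_finRange_succ N) _

/-- Induction on circuits, with arbitrary idle wires above so that parallel composition can be
treated one factor at a time. -/
theorem reflectsFilters_one_tens {n m : ℕ} (f : Circ n m) (k : ℕ) : ReflectsFilters (one k ⊛ mk f) := by
  induction f generalizing k with
  | id n => exact ((IsPerm.one k).tens (IsPerm.one n)).reflectsFilters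
  | comp f g hf hg =>
    rw [mk_comp, one_tens_comp]
    exact (hf k).comp (hg k)
  | @tensor a b c d f g hf hg =>
    rw [mk_tensor, ← tens_assoc]
    refine ReflectsFilters.dcast _ _ ?_
    rw [tens_split]
    refine ReflectsFilters.comp ?_ (hg _)
    -- Idle wires below `f` are carried above it by the symmetry, where the induction hypothesis
    -- applies.
    have h1 : (one k ⊛ mk f ⊛ one c : Diag (k + a + c) (k + b + c)) =
        mk (.swap (k + a) c) ⊚ (one c ⊛ (one k ⊛ mk f) ⊚ mk (.swap c (k + b))) := by
      rw [swap_natural, ← assoc, show mk (.swap (k + a) c) ⊚ mk (.swap c (k + a)) = one (k + a + c) from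
        mk_eq (.swap_swap _ _), one_comp]
    rw [h1]
    refine (isPerm_swap _ _).reflectsFilters.comp (ReflectsFilters.comp ?_ (isPerm_swap _ _).reflectsFilters)
    rw [← tens_assoc, one_tens_one]
    exact ReflectsFilters.dcast _ _ (hf _)
  | swap a b => exact ((IsPerm.one k).tens (isPerm_swap a b)).reflectsFilters
  | ket1 => exact reflectsFilters_addKet k
  | bra1 => exact reflectsFilters_addBra k
  | tof =>
    rw [show one k ⊛ mk .tof = below k 3 (mk .tof) from rfl, ← place_natAdd, mk_tof_eq,
      place_T (Fin.natAdd_injective 3 k)]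
    exact reflectsFilters_T (by simp)

/-- The restriction is the conjugate by `f` of the identity, which is the filter of the full table.
-/
theorem isFilter_bar {n m : ℕ} (f : Diag n m) : IsFilter (f ⊚ dagger f) := by
  refine Quotient.inductionOn f fun f => ?_
  have h := (reflectsFilters_one_tens f 0).dcast (Nat.zero_add n) (Nat.zero_add m)
  rw [zero_tens] at h
  have h1 := h 1 (IsFilter.one m)
  rw [show mk f ⊚ (1 : Diag m m) = mk f from comp_one _] at h1
  exact h1

end Diag

/-! ### Transfer to partial injections along the functor -/

open Diag

/-- A morphism of `FPinj₂` as a partial bijection. -/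
def FPinj₂.toPEquiv {X Y : FPinj₂} (p : X ⟶ Y) : (Fin X → Bool) ≃. (Fin Y → Bool) := p.hom

theorem FPinj₂.hom_ext {X Y : FPinj₂} {p q : X ⟶ Y} (h : ∀ b c, c ∈ toPEquiv p b ↔ c ∈ toPEquiv q b) : p = q :=
  InducedCategory.hom_ext (PEquiv.ext fun b => Option.ext fun c => h b c)

namespace TOF

theorem mem_conj {A B A' B' : Type} (a : A ≃ A') (b : B ≃ B') (f : A' ≃. B') (x : A) (y : B) :
    y ∈ ((a.toPEquiv.trans f).trans b.symm.toPEquiv) x ↔ b y ∈ f (a x) := by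
  rw [PEquiv.mem_trans]
  constructor
  · rintro ⟨k, h1, h2⟩
    obtain ⟨g, h3, h4⟩ := (PEquiv.mem_trans _ _ _ _).1 h1
    obtain rfl := Option.some.inj h3
    have h5 : b.symm k = y := Option.some.inj h2
    rw [← h5, Equiv.apply_symm_apply]
    exact h4
  · intro h
    exact ⟨_, (PEquiv.mem_trans _ _ _ _).2 ⟨_, rfl, h⟩, congrArg some (b.symm_apply_apply y)⟩

theorem mem_Htilde₀_map {n m : TOF} (f : n ⟶ m) (b : Fin n → Bool) (c : Fin m → Bool) :
    c ∈ FPinj₂.toPEquiv (Htilde₀.map f) b ↔ Diag.eval f (List.ofFn b) = some (List.ofFn c) := by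
  refine Iff.trans ?_ (mem_onPoints_ket f b c)
  exact mem_conj (pointEquiv n) (pointEquiv m) (H₀.map f) b c

theorem eval_eq_of_Htilde₀_map_eq {n m : TOF} {f g : n ⟶ m} (h : Htilde₀.map f = Htilde₀.map g) (b : Fin n → Bool) :
    Diag.eval f (List.ofFn b) = Diag.eval g (List.ofFn b) := by
  refine Option.ext fun l => ⟨fun hl => ?_, fun hl => ?_⟩
  · obtain ⟨c, rfl, -⟩ := ket_comp f b hl
    exact (mem_Htilde₀_map g b c).1 (h ▸ (mem_Htilde₀_map f b c).2 hl :)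
  · obtain ⟨c, rfl, -⟩ := ket_comp g b hl
    exact (mem_Htilde₀_map f b c).1 (h ▸ (mem_Htilde₀_map g b c).2 hl)

theorem IsRestrictionIdempotent.isFilter {n : TOF} {e : n ⟶ n} (he : IsRestrictionIdempotent e) :
    Diag.IsFilter e := by
  rw [he]
  exact isFilter_bar e

/-- A filter and its restriction are both filters, so it suffices to compare their values on points.
-/
theorem isRestrictionIdempotent_filter (n : ℕ) (S : List Bool → Bool) :
    IsRestrictionIdempotent (n := n) (Diag.filter n S) := by
  refine IsFilter.eq_of_eval ⟨S, rfl⟩ (isFilter_bar _) fun v => ?_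
  refine Eq.trans ?_ (eval_comp _ _ _).symm
  rw [eval_filter]
  split
  · rename_i h
    rw [Option.bind_some]
    exact ((Diag.eval_dagger _).1 (by rw [eval_filter, if_pos h])).symm
  · rfl

end TOF

/-- Equal to its own restriction, `p` is a partial identity and hence determined by its domain. -/
theorem FPinj₂.IsRestrictionIdempotent.mem_iff {X : FPinj₂} {p : X ⟶ X} (hp : FPinj₂.IsRestrictionIdempotent p)
    (b c : Fin X → Bool) : c ∈ toPEquiv p b ↔ b = c ∧ (toPEquiv p b).isSome := by
  have h : toPEquiv p = Pinj.bar p.hom := congrArg toPEquiv hp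
  have h1 : c ∈ toPEquiv p b ↔ b = c ∧ b ∈ {x | (toPEquiv p x).isSome} := by
    refine (Eq.to_iff (congrArg (fun q : (Fin X → Bool) ≃. (Fin X → Bool) => c ∈ q b) h)).trans ?_
    refine Iff.trans (@PEquiv.mem_ofSet_iff (Fin X → Bool) {x | (toPEquiv p x).isSome}
      (fun _ => Classical.propDecidable _) _ _) ⟨?_, ?_⟩ <;> rintro ⟨rfl, h⟩ <;> exact ⟨rfl, h⟩
  exact h1

end Toffoli
theorem mainTheorem4 :
    (∀ (n : Toffoli.TOF) (p : Toffoli.TOF.Htilde₀.obj n ⟶ Toffoli.TOF.Htilde₀.obj n),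
      Toffoli.FPinj₂.IsRestrictionIdempotent p →
        ∃ e : n ⟶ n, Toffoli.TOF.IsRestrictionIdempotent e ∧ Toffoli.TOF.Htilde₀.map e = p) ∧
    (∀ (n : Toffoli.TOF) (e e' : n ⟶ n),
      Toffoli.TOF.IsRestrictionIdempotent e → Toffoli.TOF.IsRestrictionIdempotent e' →
        Toffoli.TOF.Htilde₀.map e = Toffoli.TOF.Htilde₀.map e' → e = e') := by
  classical
  refine ⟨fun n p hp => ?_, fun n e e' he he' h => ?_⟩
  -- The table is the indicator of the domain of `p`, extended by false to lists of other lengths.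
  · let S : List Bool → Bool := fun w => decide (∃ b : Fin n → Bool, w = List.ofFn b ∧ (Toffoli.FPinj₂.toPEquiv p b).isSome)
    refine ⟨Toffoli.Diag.filter n S, Toffoli.TOF.isRestrictionIdempotent_filter n S, ?_⟩
    refine Toffoli.FPinj₂.hom_ext fun b c => ?_
    refine (Toffoli.TOF.mem_Htilde₀_map _ b c).trans (Iff.trans ?_ (hp.mem_iff b c).symm)
    have hS : S (List.ofFn b) = true ↔ (Toffoli.FPinj₂.toPEquiv p b).isSome := by
      refine decide_eq_true_iff.trans ⟨?_, fun h => ⟨b, rfl, h⟩⟩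
      rintro ⟨b', h1, h2⟩
      rwa [List.ofFn_injective h1]
    exact (Toffoli.Diag.eval_filter_eq_some_iff S b c).trans (and_congr_right fun _ => hS)
  -- Both idempotents are filters, and the functor retains exactly their values on points.
  · exact he.isFilter.eq_of_eval he'.isFilter fun v => Toffoli.TOF.eval_eq_of_Htilde₀_map_eq h v
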